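/- For a Borel measure $\mu$ on $\mathbb R$ write $U_\mu(x)=\int\log|x-y|\,d\mu(y)$ and $I(\mu)=\iint\log|x-y|\,d\mu(x)\,d\mu(y)$. For a finite set $A\subset\mathbb Z[x]$ let $$\lambda_A=\inf_\mu\int x\,d\mu(x),$$ where $\mu$ varies among the Borel probability measures on $[0,\infty)$ with $I(\mu)\ge 0$ and $\int\log|Q|\,d\mu\ge0$ for every $Q\in A$. **Proposition.** Let $A\subset\mathbb Z[x]$ be finite and let $\Sigma=\bigcup_{i=0}^{l}[a_{2i},a_{2i+1}]\subset[0,18]$ with $a_0<a_1<\dots<a_{2l+1}$. Let $\mu$ be a Borel probability measure with support $\Sigma$, and let $\lambda>0$, $\lambda_0>0$ and $\lambda_Q>0$ $(Q\in A)$ be such that $$x=\lambda+\sum_{Q\in A}\lambda_Q\log|Q(x)|+\lambda_0\Bigl(U_\mu(x)-\frac{I(\mu)}2\Bigr)\qquad\text{for all }x\in\Sigma$$ (all the quantities being finite). Let $\mu_{eq}$ be the equilibrium measure of $\Sigma$, i.e. the probability measure on $\Sigma$ with the largest energy $I$, and assume that $I(\mu_{eq})\ge0$. Suppose that $\mu$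 and $\mu_{eq}$ have density functions $\rho$ and $\rho_{eq}$. Let $\mathcal R$ be the set of the real roots of the members of $A$, and suppose that $$\mathcal R\cap(a_{2i+1},a_{2i+2})=\{r_i\}\ \ (0\le i\le l-1),\qquad \mathcal R\cap\bigl([0,a_0)\cup(a_{2l+1},\infty)\bigr)=\{0\}.$$ Let $\delta>0$, and suppose that for every boundary point $a_j$ of $\Sigma$ $(0\le j\le 2l+1)$ the limit $$\delta_j:=\lim_{x\to a_j,\ x\in\Sigma\setminus\{a_j\}}\frac{\rho(x)}{\rho_{eq}(x)}$$ exists and satisfies $\delta_j\le\delta$. Put $f_j:=\rho-\delta_j\rho_{eq}$, the density function of $\mu-\delta_j\mu_{eq}$, and $$K_j(x):=\sum_{Q\in A}\ \sum_{Q(\alpha)=0}\frac{\lambda_Q}{(x-\alpha)^2}+\lambda_0\int_\Sigma\frac{f_j(y)}{(x-y)^2}\,dy\qquad(x\notin\Sigma),$$ where $\alpha$ runs through the complex roots of $Q$, with multiplicity. Suppose that * for $0\le i\le l-1$: $K_{2i+1}(x)>0$ for all $x\in(a_{2i+1},r_i)$, and $K_{2i+2}(x)>0$ for all $x\in(r_i,a_{2i+2})$;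 * $K_0(x)>0$ for all $x\in(0,a_0)$, and $K_{2l+1}(x)>0$ for all $x\in(a_{2l+1},18)$. Then $\lambda-\delta\lambda_0\log 18\le\lambda_A$. -/

import Mathlib

open MeasureTheory Set Filter Topology Polynomial

noncomputable section

namespace TraceProblem

/-- `log |t|` with the value `-∞` at `t = 0`. -/
def logAbs (t : ℝ) : EReal := if t = 0 then ⊥ else ((Real.log |t| : ℝ) : EReal)

/-- The integral of an extended-real function, `∫ f⁺ - ∫ f⁻`, with values in `[-∞, ∞]`.
When both parts are infinite the integral is undefined, and the value here is `⊤ - ⊤ = ⊥`. -/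
def extIntegral {α : Type*} [MeasurableSpace α] (f : α → EReal) (μ : Measure α) : EReal :=
  ((∫⁻ x, (f x).toENNReal ∂μ : ENNReal) : EReal) - ((∫⁻ x, (-f x).toENNReal ∂μ : ENNReal) : EReal)

/-- The logarithmic potential `U_μ(x) = ∫ log |x - y| dμ(y)`. -/
def logPotential (μ : Measure ℝ) (x : ℝ) : EReal :=
  extIntegral (fun y => logAbs (x - y)) μ

/-- The logarithmic energy `I(μ) = ∫∫ log |x - y| dμ(x) dμ(y)`. -/
def logEnergy (μ : Measure ℝ) : EReal :=
  extIntegral (fun p : ℝ × ℝ => logAbs (p.1 - p.2)) (μ.prod μ)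

/-- The constraints of the optimization problem: `μ` is a probability measure on `[0, ∞)` with
`I(μ) ≥ 0` and `∫ log |Q| dμ ≥ 0` for all `Q ∈ A`. -/
structure IsFeasible (A : Finset ℤ[X]) (μ : Measure ℝ) : Prop where
  isProbability : IsProbabilityMeasure μ
  nonneg_support : μ (Iio 0) = 0
  energy_nonneg : 0 ≤ logEnergy μ
  log_nonneg : ∀ Q ∈ A, 0 ≤ extIntegral (fun x => logAbs (aeval x Q)) μ

/-- `λ_A`, the infimum of `∫ x dμ(x)` over the feasible measures. -/
def lambdaA (A : Finset ℤ[X]) : EReal :=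
  ⨅ μ ∈ {μ : Measure ℝ | IsFeasible A μ}, extIntegral (fun x : ℝ => (x : EReal)) μ

/-- `μ` is an equilibrium measure of `S`: a probability measure on `S` of largest energy
`∫∫ log |x - y|` among all the probability measures on `S`. -/
structure IsEquilibriumMeasure (S : Set ℝ) (μ : Measure ℝ) : Prop where
  isProbability : IsProbabilityMeasure μ
  null_compl : μ Sᶜ = 0
  energy_max : ∀ ν : Measure ℝ, IsProbabilityMeasure ν → ν Sᶜ = 0 → logEnergy ν ≤ logEnergy μ

/-- `ρ` is a density function of `μ` with respect to Lebesgue measure. -/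
structure IsDensity (ρ : ℝ → ℝ) (μ : Measure ℝ) : Prop where
  measurable : Measurable ρ
  nonneg : ∀ x, 0 ≤ ρ x
  eq_withDensity : μ = volume.withDensity (fun x => ENNReal.ofReal (ρ x))

/-- The union of intervals `[a₀, a₁] ∪ [a₂, a₃] ∪ ⋯ ∪ [a₂ₗ, a₂ₗ₊₁]`. -/
def bands (l : ℕ) (a : ℕ → ℝ) : Set ℝ :=
  ⋃ i ∈ Finset.range (l + 1), Icc (a (2 * i)) (a (2 * i + 1))

/-- The set of real roots of the members of `A`. -/
def realRoots (A : Finset ℤ[X]) : Set ℝ := {α | ∃ Q ∈ A, aeval α Q = 0}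

/-- `∑ 1 / (x - α)²` over the complex roots `α` of `Q`, with multiplicity. The roots are closed
under conjugation, so that this sum is real. -/
def rootSum (Q : ℤ[X]) (x : ℝ) : ℝ :=
  (((Q.map (Int.castRingHom ℂ)).roots.map (fun α => 1 / ((x : ℂ) - α) ^ 2)).sum).re

/-- `∑_Q ∑_{Q(α)=0} λ_Q / (x - α)² + λ₀ ∫_S f(y) / (x - y)² dy`. -/
def curvature (A : Finset ℤ[X]) (lam : ℤ[X] → ℝ) (lam₀ : ℝ) (S : Set ℝ) (f : ℝ → ℝ) (x : ℝ) : ℝ :=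
  (∑ Q ∈ A, lam Q * rootSum Q x) + lam₀ * ∫ y in S, f y / (x - y) ^ 2

end TraceProblem

end

set_option linter.unusedSectionVars false

/-! The bound is weak duality. Suppose that `x ≥ κ + ∑ λ_Q log |Q(x)| + λ₀ (U_μ(x) - I(μ)/2)` on
`(0, 18)` off the roots of `A`. Integrating against a feasible `τ` on `[0, 18]` gives `∫ x dτ ≥ κ`:
the terms in `Q` are nonnegative by feasibility, and `I(μ) + I(τ) ≤ 2 I(μ, τ)` (`energyDiff_nonpos`)
with `I(τ) ≥ 0` gives `∫ U_μ dτ ≥ I(μ)/2`. This is `le_lambdaA_of_forall_le`. A feasible measure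
with mass beyond 18 is first replaced by one on `[0, 18]` whose mean is no larger
(`exists_truncation`).

It remains to prove the pointwise inequality with `κ = λ - δ λ₀ log 18`. On `Σ` it follows from the
dual equation. On an interval between an endpoint `a_j` and the neighbouring root, or the outer
limit 0 or 18, consider `g = x - λ - ∑ λ_Q log |Q| - λ₀ (U_μ - I(μ)/2) + λ₀ δ_j (U_eq - I(μ_eq))`.
Here `g'' = K_j > 0`, and `g = 0` almost everywhere on `Σ`. Once `g ≥ 0` is known, `0 ≤ I(μ_eq) ≤
U_eq ≤ log 18` and `δ_j ≤ δ` bound the last term by `δ λ₀ log 18`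
(`DualConfiguration.le_of_curvature_pos`).

For `g ≥ 0` (`nonneg_of_endpoint`) write the band as `[m - |k|, m + |k|]` with `a_j = m + k`, put `x
= m + k cosh θ` and `H(θ) = g(x)`. Subtracting the integral of `g` against the balayage of `x` on
the band changes nothing, but it turns each `log |x - α|` into `log |e^θ - ζ| - log |e^{-θ} - ζ|`,
which is odd in `θ`. Hence `H(2θ) - 2H(θ) = O(θ³)`. Since `ρ / ρ_eq → δ_j`, near `a_j` one has `μ ≤
(δ_j + ε) μ_eq`, which gives `H(θ) ≥ -Mθ² - εθ` for each `ε > 0`. Repeated halving improves this to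
`H(θ) ≥ -Cθ³` (`lower_bound_of_doubling`). But a convex function of `cosh θ` that tends to 0 at the
endpoint and is negative somewhere lies below a negative multiple of `θ²` for small `θ`, a
contradiction (`nonneg_of_convexOn_of_cosh`).

The passage from the limit of `ρ / ρ_eq` to the domination of measures needs `ρ_eq > 0` almost
everywhere on the band, because `ρ / 0 = 0`. This comes from potential theory: on a band the
equilibrium measure is the arcsine law minus the balayage of the outer mass, and the density of that
balayage is strictly convex, hence less than 1 inside. -/

namespace TraceProblem

/-! ### Extended-real integrals of logarithms -/

section ExtendedIntegrals

variable {α : Type*} [MeasurableSpace α] {μ : Measure α} {f : α → ℝ}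

theorem toENNReal_logAbs (t : ℝ) : (logAbs t).toENNReal = ENNReal.ofReal (Real.log |t|) := by
  unfold logAbs
  split_ifs with h
  · simp [h]
  · rfl

theorem toENNReal_neg_logAbs {t : ℝ} (ht : t ≠ 0) :
    (-logAbs t).toENNReal = ENNReal.ofReal (-Real.log |t|) := by
  unfold logAbs
  rw [if_neg ht, ← EReal.coe_neg]
  rfl

theorem toENNReal_neg_logAbs_zero : (-logAbs 0).toENNReal = ⊤ := by
  simp [logAbs]

theorem measurable_logAbs : Measurable logAbs := by
  unfold logAbs
  refine Measurable.ite (measurableSet_singleton 0) measurable_const ?_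
  exact measurable_coe_real_ereal.comp (Real.measurable_log.comp (by fun_prop))

theorem extIntegral_eq_coe_integral {g : α → ℝ} (hi : Integrable g μ) {F : α → EReal}
    (hF : ∀ᵐ x ∂μ, F x = (g x : EReal)) : extIntegral F μ = ((∫ x, g x ∂μ : ℝ) : EReal) := by
  have h1 : ∫⁻ x, (F x).toENNReal ∂μ = ∫⁻ x, ENNReal.ofReal (g x) ∂μ :=
    lintegral_congr_ae (by filter_upwards [hF] with x hx; rw [hx]; rfl)
  have h2 : ∫⁻ x, (-F x).toENNReal ∂μ = ∫⁻ x, ENNReal.ofReal (-g x) ∂μ :=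
    lintegral_congr_ae (by filter_upwards [hF] with x hx; rw [hx, ← EReal.coe_neg]; rfl)
  unfold extIntegral
  rw [h1, h2, integral_eq_lintegral_pos_part_sub_lintegral_neg_part hi, EReal.coe_sub,
    EReal.coe_ennreal_toReal hi.lintegral_lt_top.ne, EReal.coe_ennreal_toReal]
  exact hi.neg.lintegral_lt_top.ne

theorem extIntegral_logAbs_eq (h0 : ∀ᵐ x ∂μ, f x ≠ 0)
    (hi : Integrable (fun x => Real.log |f x|) μ) :
    extIntegral (fun x => logAbs (f x)) μ = ((∫ x, Real.log |f x| ∂μ : ℝ) : EReal) := by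
  refine extIntegral_eq_coe_integral hi ?_
  filter_upwards [h0] with x hx
  rw [logAbs, if_neg hx]

/-- Since `a - ⊤ = ⊥` for every `a`, a value other than `⊥` makes the negative part finite. As
`-logAbs 0 = ⊤`, the zeros of `f` then form a null set, and the real logarithm, whose value at 0 is
a default, may be used from here on. -/
theorem ae_ne_zero_and_integrable_log_of_extIntegral_ne_bot (hf : Measurable f)
    (hpos : ∫⁻ x, ENNReal.ofReal (Real.log |f x|) ∂μ ≠ ⊤)
    (h : extIntegral (fun x => logAbs (f x)) μ ≠ ⊥) :
    (∀ᵐ x ∂μ, f x ≠ 0) ∧ Integrable (fun x => Real.log |f x|) μ := by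
  have hneg : ∫⁻ x, (-logAbs (f x)).toENNReal ∂μ ≠ ⊤ := by
    intro hT
    apply h
    unfold extIntegral
    rw [hT]
    simp
  have hm : Measurable fun x => (-logAbs (f x)).toENNReal :=
    (measurable_logAbs.comp hf).neg.ereal_toENNReal
  have h0 : ∀ᵐ x ∂μ, f x ≠ 0 := by
    filter_upwards [ae_lt_top hm hneg] with x hx h0
    rw [h0, toENNReal_neg_logAbs_zero] at hx
    exact lt_irrefl _ hx
  refine ⟨h0, ?_⟩
  have hlm : Measurable fun x => Real.log |f x| := Real.measurable_log.comp (by fun_prop)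
  refine ⟨hlm.aestronglyMeasurable, ?_⟩
  have he : ∀ᵐ x ∂μ, ‖Real.log |f x|‖ₑ =
      ENNReal.ofReal (Real.log |f x|) + (-logAbs (f x)).toENNReal := by
    filter_upwards [h0] with x hx
    rw [toENNReal_neg_logAbs hx, ← ofReal_norm, Real.norm_eq_abs]
    rcases le_total 0 (Real.log |f x|) with h | h
    · rw [abs_of_nonneg h, ENNReal.ofReal_of_nonpos (neg_nonpos.2 h), add_zero]
    · rw [abs_of_nonpos h, ENNReal.ofReal_of_nonpos h, zero_add]
  rw [HasFiniteIntegral, lintegral_congr_ae he, lintegral_add_right _ hm]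
  exact ENNReal.add_lt_top.2 ⟨hpos.lt_top, hneg.lt_top⟩

theorem extIntegral_logAbs_ne_top
    (hpos : ∫⁻ x, ENNReal.ofReal (Real.log |f x|) ∂μ ≠ ⊤) :
    extIntegral (fun x => logAbs (f x)) μ ≠ ⊤ := by
  unfold extIntegral
  simp_rw [toENNReal_logAbs]
  lift ∫⁻ x, ENNReal.ofReal (Real.log |f x|) ∂μ to NNReal using hpos with c
  generalize ∫⁻ x, (-logAbs (f x)).toENNReal ∂μ = d
  induction d with
  | top => simp
  | coe d => exact EReal.coe_ne_top (c - d : ℝ)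

end ExtendedIntegrals

/-! ### Negative definiteness of the logarithmic energy -/

section Energy

/-- The mass of the ball of diameter `s` around `t`, divided by `s`. -/
noncomputable def ballRatio (μ : Measure ℝ) (p : ℝ × ℝ) : ℝ :=
  p.1⁻¹ * (μ (Metric.ball p.2 (p.1 / 2))).toReal

/-- The strip of the pairs `(s, t)` with `0 < s ≤ R`, with Lebesgue measure. -/
noncomputable def stripMeasure (R : ℝ) : Measure (ℝ × ℝ) :=
  (volume.restrict (Ioc 0 R)).prod volume

/-- `log (R / u) - 1 + u / R`, the integral of `(s - u)⁺ / s²` over `0 < s ≤ R`. -/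
noncomputable def tentKernel (R u : ℝ) : ℝ := Real.log R - Real.log u - 1 + u / R

theorem lintegral_tent {R u : ℝ} (hu : 0 < u) (huR : u ≤ R) :
    ∫⁻ s in Ioc 0 R, ENNReal.ofReal ((s⁻¹) ^ 2) * ENNReal.ofReal (s - u) =
      ENNReal.ofReal (tentKernel R u) := by
  have hR : 0 < R := hu.trans_le huR
  have h1 : ∫⁻ s in Ioc 0 R, ENNReal.ofReal ((s⁻¹) ^ 2) * ENNReal.ofReal (s - u) =
      ∫⁻ s in Ioc u R, ENNReal.ofReal ((s⁻¹) ^ 2 * (s - u)) := by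
    rw [← lintegral_indicator measurableSet_Ioc, ← lintegral_indicator measurableSet_Ioc]
    congr 1
    ext s
    by_cases hs : s ∈ Ioc u R
    · rw [indicator_of_mem hs, indicator_of_mem (show s ∈ Ioc 0 R from ⟨hu.trans hs.1, hs.2⟩),
        ENNReal.ofReal_mul (by positivity)]
    · rw [indicator_of_notMem hs]
      by_cases hs' : s ∈ Ioc 0 R
      · have : s ≤ u := by
          by_contra h
          exact hs ⟨not_le.1 h, hs'.2⟩
        rw [indicator_of_mem hs', ENNReal.ofReal_of_nonpos (sub_nonpos.2 this), mul_zero]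
      · rw [indicator_of_notMem hs']
  have hder : ∀ s ∈ uIcc u R, HasDerivAt (fun s => Real.log s + u * s⁻¹) ((s⁻¹) ^ 2 * (s - u)) s := by
    intro s hs
    rw [uIcc_of_le huR] at hs
    have hs0 : s ≠ 0 := (hu.trans_le hs.1).ne'
    refine ((Real.hasDerivAt_log hs0).add ((hasDerivAt_inv hs0).const_mul u)).congr_deriv ?_
    field_simp
    ring
  have hcont : ContinuousOn (fun s : ℝ => (s⁻¹) ^ 2 * (s - u)) (uIcc u R) := by
    rw [uIcc_of_le huR]
    refine ContinuousOn.mul (ContinuousOn.pow (continuousOn_id.inv₀ ?_) 2) (by fun_prop)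
    intro s hs
    exact (hu.trans_le hs.1).ne'
  have hint := hcont.intervalIntegrable (μ := volume)
  rw [h1, ← ofReal_integral_eq_lintegral_ofReal]
  · rw [← intervalIntegral.integral_of_le huR,
      intervalIntegral.integral_eq_sub_of_hasDerivAt hder hint, tentKernel]
    congr 1
    field_simp
    ring
  · exact (intervalIntegrable_iff_integrableOn_Ioc_of_le huR).1 hint
  · filter_upwards [ae_restrict_mem measurableSet_Ioc] with s hs
    exact mul_nonneg (by positivity) (sub_nonneg.2 hs.1.le)

theorem volume_ball_inter_ball (x y s : ℝ) :
    volume {t : ℝ | x ∈ Metric.ball t (s / 2) ∧ y ∈ Metric.ball t (s / 2)} =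
      ENNReal.ofReal (s - |x - y|) := by
  have : {t : ℝ | x ∈ Metric.ball t (s / 2) ∧ y ∈ Metric.ball t (s / 2)} =
      Ioo (max x y - s / 2) (min x y + s / 2) := by
    ext t
    simp only [Metric.mem_ball, Real.dist_eq, abs_lt, mem_ofPred_eq, mem_Ioo]
    constructor
    · rintro ⟨⟨h1, h2⟩, h3, h4⟩
      refine ⟨?_, ?_⟩
      · have : max x y < t + s / 2 := max_lt (by linarith) (by linarith)
        linarith
      · have : t - s / 2 < min x y := lt_min (by linarith) (by linarith)
        linarith
    · rintro ⟨h1, h2⟩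
      have := le_max_left x y
      have := le_max_right x y
      have := min_le_left x y
      have := min_le_right x y
      refine ⟨⟨?_, ?_⟩, ?_, ?_⟩ <;> linarith
  rw [this, Real.volume_Ioo]
  congr 1
  have := max_sub_min_eq_abs' x y
  linarith

theorem measurable_ballRatio (μ : Measure ℝ) [IsFiniteMeasure μ] : Measurable (ballRatio μ) := by
  have hS : MeasurableSet {q : (ℝ × ℝ) × ℝ | q.2 ∈ Metric.ball q.1.2 (q.1.1 / 2)} := by
    simp only [Metric.mem_ball, Real.dist_eq]
    exact measurableSet_lt (by fun_prop) (by fun_prop)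
  have := measurable_measure_prodMk_left (ν := μ) hS
  exact (measurable_fst.inv).mul this.ennreal_toReal

theorem ballRatio_nonneg (μ : Measure ℝ) (R : ℝ) : ∀ᵐ p ∂(stripMeasure R), 0 ≤ ballRatio μ p := by
  have : ∀ᵐ p ∂(stripMeasure R), p.1 ∈ Ioc 0 R :=
    Measure.quasiMeasurePreserving_fst.ae (ae_restrict_mem measurableSet_Ioc)
  filter_upwards [this] with p hp
  exact mul_nonneg (inv_nonneg.2 hp.1.le) ENNReal.toReal_nonneg

variable {μ ν : Measure ℝ} [IsFiniteMeasure μ] [IsFiniteMeasure ν]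

/-- Tonelli for the incidence of a ball with a pair of points. For a fixed ball the pairs inside it
have measure `μ(B) ν(B)`; for a fixed pair at distance `u` the centres `t` of the balls of diameter
`s` containing both have length `(s - u)⁺`. Without atoms in `ν` the diagonal, where the kernel is
infinite, is null. -/
theorem lintegral_ballRatio_mul {R : ℝ} [NullSingletonClass ν] {S : Set ℝ} (hμ : ∀ᵐ x ∂μ, x ∈ S)
    (hν : ∀ᵐ x ∂ν, x ∈ S) (hS : ∀ x ∈ S, ∀ y ∈ S, |x - y| ≤ R) :
    ∫⁻ p, ENNReal.ofReal (ballRatio μ p * ballRatio ν p) ∂(stripMeasure R) =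
      ∫⁻ z, ENNReal.ofReal (tentKernel R |z.1 - z.2|) ∂(μ.prod ν) := by
  have hB : MeasurableSet {q : (ℝ × ℝ) × (ℝ × ℝ) |
      q.2.1 ∈ Metric.ball q.1.2 (q.1.1 / 2) ∧ q.2.2 ∈ Metric.ball q.1.2 (q.1.1 / 2)} := by
    simp only [Metric.mem_ball, Real.dist_eq]
    have h1 : MeasurableSet {q : (ℝ × ℝ) × (ℝ × ℝ) | |q.2.1 - q.1.2| < q.1.1 / 2} :=
      measurableSet_lt (by fun_prop) (by fun_prop)
    have h2 : MeasurableSet {q : (ℝ × ℝ) × (ℝ × ℝ) | |q.2.2 - q.1.2| < q.1.1 / 2} :=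
      measurableSet_lt (by fun_prop) (by fun_prop)
    exact h1.inter h2
  set B := {q : (ℝ × ℝ) × (ℝ × ℝ) |
      q.2.1 ∈ Metric.ball q.1.2 (q.1.1 / 2) ∧ q.2.2 ∈ Metric.ball q.1.2 (q.1.1 / 2)} with hBdef
  set f : (ℝ × ℝ) → (ℝ × ℝ) → ENNReal := fun p z =>
    B.indicator (fun q => ENNReal.ofReal ((q.1.1⁻¹) ^ 2)) (p, z) with hf
  have hfm : Measurable (Function.uncurry f) := by
    have : Measurable fun q : (ℝ × ℝ) × (ℝ × ℝ) => ENNReal.ofReal ((q.1.1⁻¹) ^ 2) :=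
      ENNReal.measurable_ofReal.comp ((measurable_fst.comp measurable_fst).inv.pow_const 2)
    exact this.indicator hB
  have h1 : ∀ p, ∫⁻ z, f p z ∂(μ.prod ν) = ENNReal.ofReal (ballRatio μ p * ballRatio ν p) := by
    intro p
    have : (fun z => f p z) = (Metric.ball p.2 (p.1 / 2) ×ˢ Metric.ball p.2 (p.1 / 2)).indicator
        (fun _ => ENNReal.ofReal ((p.1⁻¹) ^ 2)) := by
      ext z
      by_cases hz : (p, z) ∈ B
      · rw [indicator_of_mem (show z ∈ _ ×ˢ _ from hz)]
        exact indicator_of_mem hz _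
      · rw [indicator_of_notMem (show z ∉ _ ×ˢ _ from hz)]
        exact indicator_of_notMem hz _
    rw [this, lintegral_indicator_const (measurableSet_ball.prod measurableSet_ball),
      Measure.prod_prod]
    have : ballRatio μ p * ballRatio ν p = (p.1⁻¹) ^ 2 *
      ((μ (Metric.ball p.2 (p.1 / 2))).toReal * (ν (Metric.ball p.2 (p.1 / 2))).toReal) := by
      unfold ballRatio
      ring
    rw [this, ENNReal.ofReal_mul (by positivity), ENNReal.ofReal_mul ENNReal.toReal_nonneg,
      ENNReal.ofReal_toReal (measure_ne_top _ _), ENNReal.ofReal_toReal (measure_ne_top _ _)]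
  have h2 : ∀ z : ℝ × ℝ, z.1 ≠ z.2 → |z.1 - z.2| ≤ R →
      ∫⁻ p, f p z ∂(stripMeasure R) = ENNReal.ofReal (tentKernel R |z.1 - z.2|) := by
    intro z hz hzR
    have hfz : Measurable fun p => f p z := hfm.comp (measurable_id.prodMk measurable_const)
    rw [← lintegral_tent (abs_pos.2 (sub_ne_zero.2 hz)) hzR, stripMeasure,
      lintegral_prod _ hfz.aemeasurable]
    refine lintegral_congr fun s => ?_
    have : (fun t => f (s, t) z) = {t : ℝ | z.1 ∈ Metric.ball t (s / 2) ∧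
        z.2 ∈ Metric.ball t (s / 2)}.indicator (fun _ => ENNReal.ofReal ((s⁻¹) ^ 2)) := by
      ext t
      by_cases ht : ((s, t), z) ∈ B
      · rw [indicator_of_mem (show t ∈ {t : ℝ | z.1 ∈ Metric.ball t (s / 2) ∧ z.2 ∈ Metric.ball t (s / 2)} from ht)]
        exact indicator_of_mem ht _
      · rw [indicator_of_notMem (show t ∉ {t : ℝ | z.1 ∈ Metric.ball t (s / 2) ∧ z.2 ∈ Metric.ball t (s / 2)} from ht)]
        exact indicator_of_notMem ht _
    rw [this, lintegral_indicator_const, volume_ball_inter_ball]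
    simp only [Metric.mem_ball, Real.dist_eq]
    have h1 : MeasurableSet {t : ℝ | |z.1 - t| < s / 2} :=
      measurableSet_lt (by fun_prop) (by fun_prop)
    have h2 : MeasurableSet {t : ℝ | |z.2 - t| < s / 2} :=
      measurableSet_lt (by fun_prop) (by fun_prop)
    exact h1.inter h2
  have hne : ∀ᵐ z ∂(μ.prod ν), z.1 ≠ z.2 := by
    refine (Measure.ae_prod_iff_ae_ae ?_).2 ?_
    · exact (measurableSet_eq_fun measurable_fst measurable_snd).compl
    · refine Eventually.of_forall fun x => ?_
      filter_upwards [measure_eq_zero_iff_ae_notMem.1 (measure_singleton (μ := ν) x)] with y hy h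
      exact hy h.symm
  have hle : ∀ᵐ z ∂(μ.prod ν), |z.1 - z.2| ≤ R := by
    filter_upwards [Measure.quasiMeasurePreserving_fst.ae hμ,
      Measure.quasiMeasurePreserving_snd.ae hν] with z h1 h2
    exact hS _ h1 _ h2
  have : SFinite (stripMeasure R) := by unfold stripMeasure; infer_instance
  calc _ = ∫⁻ p, ∫⁻ z, f p z ∂(μ.prod ν) ∂(stripMeasure R) := by simp_rw [h1]
    _ = ∫⁻ z, ∫⁻ p, f p z ∂(stripMeasure R) ∂(μ.prod ν) :=
      lintegral_lintegral_swap hfm.aemeasurable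
    _ = _ := by
      refine lintegral_congr_ae ?_
      filter_upwards [hne, hle] with z h1 h2'
      exact h2 z h1 h2'

theorem integral_ballRatio_mul {R : ℝ} (hR : 0 < R) [NullSingletonClass ν] {S : Set ℝ}
    (hμ : ∀ᵐ x ∂μ, x ∈ S) (hν : ∀ᵐ x ∂ν, x ∈ S) (hS : ∀ x ∈ S, ∀ y ∈ S, |x - y| ≤ R)
    (hlog : Integrable (fun z : ℝ × ℝ => Real.log |z.1 - z.2|) (μ.prod ν)) :
    Integrable (fun p => ballRatio μ p * ballRatio ν p) (stripMeasure R) ∧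
    ∫ p, ballRatio μ p * ballRatio ν p ∂(stripMeasure R) =
      (Real.log R - 1) * (μ.real univ * ν.real univ)
        - ∫ z, Real.log |z.1 - z.2| ∂(μ.prod ν) + (∫ z, |z.1 - z.2| ∂(μ.prod ν)) / R := by
  have hle : ∀ᵐ z ∂(μ.prod ν), |z.1 - z.2| ≤ R := by
    filter_upwards [Measure.quasiMeasurePreserving_fst.ae hμ,
      Measure.quasiMeasurePreserving_snd.ae hν] with z h1 h2
    exact hS _ h1 _ h2
  have habs : Integrable (fun z : ℝ × ℝ => |z.1 - z.2|) (μ.prod ν) := by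
    refine Integrable.mono' (integrable_const R) (by fun_prop) ?_
    filter_upwards [hle] with z hz
    rwa [Real.norm_eq_abs, abs_abs]
  have hK1 : Integrable (fun z : ℝ × ℝ => Real.log R - Real.log |z.1 - z.2|) (μ.prod ν) :=
    (integrable_const (Real.log R)).sub hlog
  have hK2 : Integrable (fun z : ℝ × ℝ => Real.log R - Real.log |z.1 - z.2| - 1) (μ.prod ν) :=
    hK1.sub (integrable_const 1)
  have hK : Integrable (fun z : ℝ × ℝ => tentKernel R |z.1 - z.2|) (μ.prod ν) :=
    hK2.add (habs.div_const R)
  have hne : ∀ᵐ z ∂(μ.prod ν), z.1 ≠ z.2 := by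
    refine (Measure.ae_prod_iff_ae_ae ?_).2 ?_
    · exact (measurableSet_eq_fun measurable_fst measurable_snd).compl
    · refine Eventually.of_forall fun x => ?_
      filter_upwards [measure_eq_zero_iff_ae_notMem.1 (measure_singleton (μ := ν) x)] with y hy h
      exact hy h.symm
  have hKnn : ∀ᵐ z ∂(μ.prod ν), 0 ≤ tentKernel R |z.1 - z.2| := by
    filter_upwards [hle, hne] with z h1 h2
    have hu : 0 < |z.1 - z.2| := abs_pos.2 (sub_ne_zero.2 h2)
    have := Real.log_le_sub_one_of_pos (div_pos hu hR)
    rw [Real.log_div hu.ne' hR.ne'] at this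
    unfold tentKernel
    linarith
  have hG : AEStronglyMeasurable (fun p => ballRatio μ p * ballRatio ν p) (stripMeasure R) :=
    ((measurable_ballRatio μ).mul (measurable_ballRatio ν)).aestronglyMeasurable
  have hGnn : ∀ᵐ p ∂(stripMeasure R), 0 ≤ ballRatio μ p * ballRatio ν p := by
    filter_upwards [ballRatio_nonneg μ R, ballRatio_nonneg ν R] with p h1 h2
    exact mul_nonneg h1 h2
  have hlin := lintegral_ballRatio_mul hμ hν hS
  refine ⟨⟨hG, ?_⟩, ?_⟩
  · rw [hasFiniteIntegral_iff_ofReal hGnn, hlin]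
    exact hK.lintegral_lt_top
  · rw [integral_eq_lintegral_of_nonneg_ae hGnn hG, hlin,
      ← integral_eq_lintegral_of_nonneg_ae hKnn hK.aestronglyMeasurable]
    unfold tentKernel
    rw [integral_add hK2 (habs.div_const R), integral_sub hK1 (integrable_const 1),
      integral_sub (integrable_const _) hlog, integral_const, integral_const, integral_div]
    simp only [smul_eq_mul, measureReal_prod_prod, ← univ_prod_univ]
    ring

/-- The energy `I(μ) + I(ν) - 2 I(μ, ν)` of the difference of two measures. -/
noncomputable def energyDiff (μ ν : Measure ℝ) : ℝ :=
  ∫ z, Real.log |z.1 - z.2| ∂(μ.prod μ) + ∫ z, Real.log |z.1 - z.2| ∂(ν.prod ν)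
    - 2 * ∫ z, Real.log |z.1 - z.2| ∂(μ.prod ν)

variable [NullSingletonClass μ] [NullSingletonClass ν]

/-- In the expanded square the constants `log R - 1` cancel because the masses agree. What is left
is minus the energy of `μ - ν` plus a term `V / R` with `V` independent of `R`. -/
theorem exists_forall_integral_sq_ballRatio_sub {D : ℝ} (hD : 0 < D) {S : Set ℝ}
    (hμ : ∀ᵐ x ∂μ, x ∈ S) (hν : ∀ᵐ x ∂ν, x ∈ S) (hS : ∀ x ∈ S, ∀ y ∈ S, |x - y| ≤ D)
    (hmass : μ univ = ν univ)
    (h1 : Integrable (fun z : ℝ × ℝ => Real.log |z.1 - z.2|) (μ.prod μ))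
    (h2 : Integrable (fun z : ℝ × ℝ => Real.log |z.1 - z.2|) (ν.prod ν))
    (h3 : Integrable (fun z : ℝ × ℝ => Real.log |z.1 - z.2|) (μ.prod ν)) :
    ∃ V : ℝ, ∀ R, D ≤ R →
      Integrable (fun p => (ballRatio μ p - ballRatio ν p) ^ 2) (stripMeasure R) ∧
      ∫ p, (ballRatio μ p - ballRatio ν p) ^ 2 ∂(stripMeasure R) = V / R - energyDiff μ ν := by
  refine ⟨∫ z, |z.1 - z.2| ∂(μ.prod μ) + ∫ z, |z.1 - z.2| ∂(ν.prod ν)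
    - 2 * ∫ z, |z.1 - z.2| ∂(μ.prod ν), fun R hR => ?_⟩
  have hS' : ∀ x ∈ S, ∀ y ∈ S, |x - y| ≤ R := fun x hx y hy => (hS x hx y hy).trans hR
  have hR0 := hD.trans_le hR
  obtain ⟨i1, e1⟩ := integral_ballRatio_mul hR0 hμ hμ hS' h1
  obtain ⟨i2, e2⟩ := integral_ballRatio_mul hR0 hν hν hS' h2
  obtain ⟨i3, e3⟩ := integral_ballRatio_mul hR0 hμ hν hS' h3
  have hexp : (fun p => (ballRatio μ p - ballRatio ν p) ^ 2) = fun p =>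
      ballRatio μ p * ballRatio μ p + ballRatio ν p * ballRatio ν p
        - 2 * (ballRatio μ p * ballRatio ν p) := by
    ext p
    ring
  rw [hexp]
  have i12 : Integrable (fun p => ballRatio μ p * ballRatio μ p + ballRatio ν p * ballRatio ν p)
    (stripMeasure R) := i1.add i2
  refine ⟨i12.sub (i3.const_mul 2), ?_⟩
  rw [integral_sub i12 (i3.const_mul 2), integral_add i1 i2, integral_const_mul, e1, e2, e3,
    energyDiff]
  have : μ.real univ = ν.real univ := by rw [Measure.real, Measure.real, hmass]
  rw [this]
  ring

/-- A square has nonnegative integral, and `V / R → 0`. -/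
theorem energyDiff_nonpos {D : ℝ} (hD : 0 < D) {S : Set ℝ}
    (hμ : ∀ᵐ x ∂μ, x ∈ S) (hν : ∀ᵐ x ∂ν, x ∈ S) (hS : ∀ x ∈ S, ∀ y ∈ S, |x - y| ≤ D)
    (hmass : μ univ = ν univ)
    (h1 : Integrable (fun z : ℝ × ℝ => Real.log |z.1 - z.2|) (μ.prod μ))
    (h2 : Integrable (fun z : ℝ × ℝ => Real.log |z.1 - z.2|) (ν.prod ν))
    (h3 : Integrable (fun z : ℝ × ℝ => Real.log |z.1 - z.2|) (μ.prod ν)) :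
    energyDiff μ ν ≤ 0 := by
  obtain ⟨V, hV⟩ := exists_forall_integral_sq_ballRatio_sub hD hμ hν hS hmass h1 h2 h3
  have hlim : Tendsto (fun R : ℝ => V / R) atTop (𝓝 0) := tendsto_const_nhds.div_atTop tendsto_id
  refine ge_of_tendsto hlim ?_
  filter_upwards [eventually_ge_atTop D] with R hR
  have := (hV R hR).2
  have h0 : 0 ≤ ∫ p, (ballRatio μ p - ballRatio ν p) ^ 2 ∂(stripMeasure R) :=
    integral_nonneg fun p => sq_nonneg _
  linarith

/-- If the energy vanishes, so does the integral of the square over every strip; the two measures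
then agree on almost all balls, and large balls act on the bounded set `S` as half-lines. -/
theorem eq_of_energyDiff_eq_zero {D : ℝ} (hD : 0 < D) {S : Set ℝ}
    (hμ : ∀ᵐ x ∂μ, x ∈ S) (hν : ∀ᵐ x ∂ν, x ∈ S) (hS : ∀ x ∈ S, ∀ y ∈ S, |x - y| ≤ D)
    (hmass : μ univ = ν univ)
    (h1 : Integrable (fun z : ℝ × ℝ => Real.log |z.1 - z.2|) (μ.prod μ))
    (h2 : Integrable (fun z : ℝ × ℝ => Real.log |z.1 - z.2|) (ν.prod ν))
    (h3 : Integrable (fun z : ℝ × ℝ => Real.log |z.1 - z.2|) (μ.prod ν))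
    (h0 : energyDiff μ ν = 0) : μ = ν := by
  obtain ⟨V, hV⟩ := exists_forall_integral_sq_ballRatio_sub hD hμ hν hS hmass h1 h2 h3
  -- This leaves room for diameters `s` in `(2D, 3D]`.
  set R₀ := 3 * D with hR₀
  have hzero : ∫ p, (ballRatio μ p - ballRatio ν p) ^ 2 ∂(stripMeasure R₀) = 0 := by
    refine le_antisymm ?_ (integral_nonneg fun p => sq_nonneg _)
    have hlim : Tendsto (fun R : ℝ => V / R) atTop (𝓝 0) := tendsto_const_nhds.div_atTop tendsto_id
    refine ge_of_tendsto hlim ?_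
    filter_upwards [eventually_ge_atTop R₀] with R hR
    -- The integral over a fixed strip is at most the one over any longer strip, which is `V / R`
    -- and tends to 0.
    have hmono : stripMeasure R₀ ≤ stripMeasure R :=
      Measure.prod_mono (Measure.restrict_mono (Ioc_subset_Ioc_right hR) le_rfl) le_rfl
    have hle := integral_mono_measure hmono (Eventually.of_forall fun p => sq_nonneg _)
      (hV R (by linarith)).1
    rw [(hV R (by linarith)).2, h0, sub_zero] at hle
    exact hle
  rw [integral_eq_zero_iff_of_nonneg (fun p => sq_nonneg _) (hV R₀ (by linarith)).1] at hzero
  have hae : ∀ᵐ s ∂(volume.restrict (Ioc 0 R₀)), ∀ᵐ t : ℝ, ballRatio μ (s, t) = ballRatio ν (s, t) := by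
    have h : ∀ᵐ p ∂((volume.restrict (Ioc 0 R₀)).prod volume), ballRatio μ p = ballRatio ν p := by
      filter_upwards [hzero] with p hp
      exact sub_eq_zero.1 (pow_eq_zero_iff two_ne_zero |>.1 hp)
    exact Measure.ae_ae_of_ae_prod h
  obtain ⟨s, hs, hst⟩ : ∃ s, s ∈ Ioc (2 * D) R₀ ∧
      ∀ᵐ t : ℝ, ballRatio μ (s, t) = ballRatio ν (s, t) := by
    have h : ∀ᵐ s ∂(volume.restrict (Ioc (2 * D) R₀)), s ∈ Ioc (2 * D) R₀ ∧
        ∀ᵐ t : ℝ, ballRatio μ (s, t) = ballRatio ν (s, t) :=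
      (ae_restrict_mem measurableSet_Ioc).and
        (ae_restrict_of_ae_restrict_of_subset (Ioc_subset_Ioc_left (by linarith)) hae)
    have : (ae (volume.restrict (Ioc (2 * D) R₀))).NeBot := by
      rw [ae_neBot]
      intro h
      have := congrArg (fun m => m univ) h
      simp only [Measure.restrict_apply_univ, Real.volume_Ioc, Measure.coe_zero, Pi.zero_apply,
        ENNReal.ofReal_eq_zero] at this
      linarith
    exact h.exists
  have hs0 : 0 < s := by linarith [hs.1]
  by_cases hne : S.Nonempty
  swap
  · rw [not_nonempty_iff_eq_empty] at hne
    subst hne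
    simp only [mem_empty_iff_false, eventually_false_iff_eq_bot, ae_eq_bot] at hμ hν
    rw [hμ, hν]
  obtain ⟨x₀, hx₀⟩ := hne
  have hIio : ∀ᵐ t : ℝ, μ (Iio (t + s / 2)) = ν (Iio (t + s / 2)) := by
    filter_upwards [hst] with t ht
    -- If the right end `t + s/2` is at most `x₀ + D`, the left end is below `x₀ - D` because `s >
    -- 2D`, so that the ball cuts out of `S` the same set as the half-line. Otherwise the half-line
    -- contains all of `S`.
    rcases le_or_gt (t + s / 2) (x₀ + D) with hq | hq
    · have key : ∀ σ : Measure ℝ, (∀ᵐ x ∂σ, x ∈ S) →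
          σ (Iio (t + s / 2)) = σ (Metric.ball t (s / 2)) := by
        intro σ hσ
        refine measure_congr ?_
        filter_upwards [hσ] with x hx
        have := (abs_le.1 (hS x hx x₀ hx₀)).1
        refine propext ⟨fun h => ?_, fun h => ?_⟩
        · rw [Real.ball_eq_Ioo]
          exact ⟨by linarith [hs.1], h⟩
        · rw [Real.ball_eq_Ioo] at h
          exact h.2
      rw [key μ hμ, key ν hν]
      have h := mul_left_cancel₀ (inv_ne_zero hs0.ne') ht
      exact (ENNReal.toReal_eq_toReal_iff' (measure_ne_top _ _) (measure_ne_top _ _)).1 h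
    · have key : ∀ σ : Measure ℝ, (∀ᵐ x ∂σ, x ∈ S) → σ (Iio (t + s / 2)) = σ univ := by
        intro σ hσ
        refine measure_congr ?_
        filter_upwards [hσ] with x hx
        have := (abs_le.1 (hS x hx x₀ hx₀)).2
        exact propext ⟨fun _ => trivial, fun _ => (by linarith : x < t + s / 2)⟩
      rw [key μ hμ, key ν hν, hmass]
  -- Equality almost everywhere holds on a dense set of end points; approaching `a` from the right
  -- through them gives the distribution functions at `a`.
  have hdense : Dense {q : ℝ | μ (Iio q) = ν (Iio q)} := by
    have h1 : Dense {t : ℝ | μ (Iio (t + s / 2)) = ν (Iio (t + s / 2))} :=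
      Measure.dense_of_ae hIio
    have h2 := h1.preimage (Homeomorph.addRight (-(s / 2))).isOpenMap
    refine h2.mono fun q hq => ?_
    simpa using hq
  refine Measure.ext_of_Iic μ ν fun a => ?_
  obtain ⟨u, hu, hua, hlim⟩ := hdense.exists_seq_strictAnti_tendsto a
  have hInter : Iic a = ⋂ n, Iio (u n) := by
    ext x
    simp only [mem_Iic, mem_iInter, mem_Iio]
    exact ⟨fun h n => h.trans_lt (hua n).1, fun h => ge_of_tendsto' hlim fun n => (h n).le⟩
  have key : ∀ σ : Measure ℝ, IsFiniteMeasure σ →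
      Tendsto (fun n => σ (Iio (u n))) atTop (𝓝 (σ (Iic a))) := by
    intro σ _
    rw [hInter]
    exact tendsto_measure_iInter_atTop (fun n => measurableSet_Iio.nullMeasurableSet)
      (fun m n h => Iio_subset_Iio (hu.antitone h)) ⟨0, measure_ne_top _ _⟩
  refine tendsto_nhds_unique (key μ inferInstance) ?_
  have : (fun n => μ (Iio (u n))) = fun n => ν (Iio (u n)) := funext fun n => (hua n).2
  rw [this]
  exact key ν inferInstance

end Energy

/-! ### The arcsine distribution of an interval -/

section Arcsine

/-- The arcsine distribution on `[m - |k|, m + |k|]`. -/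
noncomputable def arcs (m k : ℝ) : Measure ℝ :=
  Measure.map (fun φ : ℝ => m + k * Real.cos φ)
    (ENNReal.ofReal ((2 * Real.pi)⁻¹) • volume.restrict (Ioc 0 (2 * Real.pi)))

/-- The interval `[m - |k|, m + |k|]`. -/
def seg (m k : ℝ) : Set ℝ := Icc (m - |k|) (m + |k|)

variable {m k q : ℝ}

theorem measurable_arcs_map (m k : ℝ) : Measurable (fun φ : ℝ => m + k * Real.cos φ) := by fun_prop

instance : IsProbabilityMeasure (arcs m k) := by
  constructor
  rw [arcs, Measure.map_apply (measurable_arcs_map m k) MeasurableSet.univ, preimage_univ,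
    Measure.smul_apply, Measure.restrict_apply_univ, Real.volume_Ioc, sub_zero, smul_eq_mul,
    ← ENNReal.ofReal_mul (by positivity), inv_mul_cancel₀ (by positivity), ENNReal.ofReal_one]

theorem mem_seg_cos (m k φ : ℝ) : m + k * Real.cos φ ∈ seg m k := by
  have h : |k * Real.cos φ| ≤ |k| := by
    rw [abs_mul]
    exact mul_le_of_le_one_right (abs_nonneg k) (Real.abs_cos_le_one φ)
  have := abs_le.1 h
  exact ⟨by linarith, by linarith⟩

theorem exists_cos_eq_of_mem_seg (hk : k ≠ 0) {y : ℝ} (hy : y ∈ seg m k) :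
    ∃ φ ∈ Icc 0 Real.pi, y = m + k * Real.cos φ := by
  have h : |(y - m) / k| ≤ 1 := by
    rw [abs_div, div_le_one (abs_pos.2 hk), abs_le]
    exact ⟨by linarith [hy.1], by linarith [hy.2]⟩
  have := abs_le.1 h
  refine ⟨Real.arccos ((y - m) / k), ⟨Real.arccos_nonneg _, Real.arccos_le_pi _⟩, ?_⟩
  rw [Real.cos_arccos this.1 this.2]
  field_simp
  ring

theorem ae_arcs_mem_seg : ∀ᵐ y ∂(arcs m k), y ∈ seg m k := by
  refine (ae_map_iff (measurable_arcs_map m k).aemeasurable measurableSet_Icc).2 ?_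
  exact Eventually.of_forall fun φ => mem_seg_cos m k φ

theorem integrable_arcs_iff {F : ℝ → ℝ} (hF : Measurable F) :
    Integrable F (arcs m k) ↔
      IntegrableOn (fun φ => F (m + k * Real.cos φ)) (Ioc 0 (2 * Real.pi)) := by
  rw [arcs, integrable_map_measure hF.aestronglyMeasurable (measurable_arcs_map m k).aemeasurable,
    integrable_smul_measure (by simp [Real.pi_pos]) ENNReal.ofReal_ne_top]
  rfl

theorem integral_arcs {F : ℝ → ℝ} (hF : Measurable F) :
    ∫ y, F y ∂(arcs m k) = Real.circleAverage (fun z => F (m + k * z.re)) 0 1 := by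
  rw [arcs, integral_map (measurable_arcs_map m k).aemeasurable hF.aestronglyMeasurable,
    integral_smul_measure, ENNReal.toReal_ofReal (by positivity), Real.circleAverage_def,
    intervalIntegral.integral_of_le (by positivity)]
  simp [circleMap, Complex.exp_ofReal_mul_I_re]

theorem absolutelyContinuous_arcs (hk : k ≠ 0) : arcs m k ≪ volume := by
  refine Measure.AbsolutelyContinuous.mk fun N hN hN0 => ?_
  rw [arcs, Measure.map_apply (measurable_arcs_map m k) hN]
  have harc : ∀ M : Set ℝ, volume M = 0 →
      volume ((fun y => Real.arccos ((y - m) / k)) '' (M ∩ {y | (y - m) / k ∈ Ioo (-1) 1})) = 0 := by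
    intro M hM
    refine addHaar_image_eq_zero_of_differentiableOn_of_addHaar_eq_zero volume ?_
      (measure_mono_null inter_subset_left hM)
    intro y hy
    have hd := Real.differentiableAt_arccos.2 ⟨hy.2.1.ne', hy.2.2.ne⟩
    have hl : DifferentiableAt ℝ (fun y => (y - m) / k) y := by fun_prop
    exact (DifferentiableAt.comp y hd hl).differentiableWithinAt
  have hA := harc N hN0
  set A := (fun y => Real.arccos ((y - m) / k)) '' (N ∩ {y | (y - m) / k ∈ Ioo (-1) 1})
  have hA' : volume ((fun φ => 2 * Real.pi - φ) '' A) = 0 :=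
    addHaar_image_eq_zero_of_differentiableOn_of_addHaar_eq_zero volume (by fun_prop) hA
  -- Apart from the angles `π` and `2π`, every `φ` is the arc cosine of the normalised point or `2π`
  -- minus it. Both branches are differentiable there, so they preserve null sets.
  have hsub : (fun φ : ℝ => m + k * Real.cos φ) ⁻¹' N ∩ Ioc 0 (2 * Real.pi) ⊆
      A ∪ (fun φ => 2 * Real.pi - φ) '' A ∪ {Real.pi, 2 * Real.pi} := by
    rintro φ ⟨hφ, h0, h2⟩
    have hdiv : (m + k * Real.cos φ - m) / k = Real.cos φ := by
      field_simp
      ring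
    by_cases hs : φ = Real.pi ∨ φ = 2 * Real.pi
    · right
      exact hs
    · rw [not_or] at hs
      left
      rcases lt_or_gt_of_ne hs.1 with h | h
      · left
        refine ⟨m + k * Real.cos φ, ⟨hφ, ?_⟩, ?_⟩
        · show (m + k * Real.cos φ - m) / k ∈ Ioo (-1) 1
          rw [hdiv]
          refine ⟨?_, ?_⟩
          · rw [← Real.cos_pi]
            exact Real.cos_lt_cos_of_nonneg_of_le_pi h0.le le_rfl h
          · rw [← Real.cos_zero]
            exact Real.cos_lt_cos_of_nonneg_of_le_pi le_rfl h.le h0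
        · show Real.arccos ((m + k * Real.cos φ - m) / k) = φ
          rw [hdiv, Real.arccos_cos h0.le h.le]
      · right
        have h2' : φ < 2 * Real.pi := lt_of_le_of_ne h2 hs.2
        have hc : Real.cos φ = Real.cos (2 * Real.pi - φ) := (Real.cos_two_pi_sub φ).symm
        refine ⟨2 * Real.pi - φ, ⟨m + k * Real.cos φ, ⟨hφ, ?_⟩, ?_⟩, by simp⟩
        · show (m + k * Real.cos φ - m) / k ∈ Ioo (-1) 1
          rw [hdiv, hc]
          refine ⟨?_, ?_⟩
          · rw [← Real.cos_pi]
            exact Real.cos_lt_cos_of_nonneg_of_le_pi (by linarith) le_rfl (by linarith)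
          · rw [← Real.cos_zero]
            exact Real.cos_lt_cos_of_nonneg_of_le_pi le_rfl (by linarith) (by linarith)
        · show Real.arccos ((m + k * Real.cos φ - m) / k) = 2 * Real.pi - φ
          rw [hdiv, hc, Real.arccos_cos (by linarith) (by linarith)]
  rw [Measure.smul_apply, Measure.restrict_apply (measurable_arcs_map m k hN)]
  have h0 : volume (A ∪ (fun φ => 2 * Real.pi - φ) '' A ∪ {Real.pi, 2 * Real.pi}) = 0 := by
    refine measure_union_null (measure_union_null hA hA') ?_
    exact (Set.toFinite _).measure_zero _
  rw [measure_mono_null hsub h0, smul_zero]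

theorem absolutelyContinuous_restrict_seg (hk : k ≠ 0) : volume.restrict (seg m k) ≪ arcs m k := by
  refine Measure.AbsolutelyContinuous.mk fun N hN hN0 => ?_
  rw [arcs, Measure.map_apply (measurable_arcs_map m k) hN, Measure.smul_apply, smul_eq_mul,
    mul_eq_zero, or_iff_right (by simp [Real.pi_pos]),
    Measure.restrict_apply (measurable_arcs_map m k hN)] at hN0
  rw [Measure.restrict_apply hN]
  have h1 : volume ((fun φ : ℝ => m + k * Real.cos φ) ''
      ((fun φ : ℝ => m + k * Real.cos φ) ⁻¹' N ∩ Ioc 0 (2 * Real.pi))) = 0 :=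
    addHaar_image_eq_zero_of_differentiableOn_of_addHaar_eq_zero volume (by fun_prop) hN0
  refine measure_mono_null ?_ (measure_union_null h1 (measure_singleton (m + k)))
  rintro y ⟨hyN, hy⟩
  obtain ⟨φ, hφ, rfl⟩ := exists_cos_eq_of_mem_seg hk hy
  rcases hφ.1.eq_or_lt with h | h
  · right
    simp [← h]
  · left
    exact ⟨φ, ⟨hyN, h, by linarith [hφ.2, Real.pi_pos]⟩, rfl⟩

end Arcsine

/-! ### Poisson measures and their logarithmic potentials -/

section Balayage

/-- The density with respect to `arcs m k` of the Poisson measure with parameter `q`. -/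
noncomputable def balDensity (m k q y : ℝ) : ℝ := (1 - q ^ 2) / (1 - 2 * q * ((y - m) / k) + q ^ 2)

/-- The image on `[m - |k|, m + |k|]` of the Poisson measure of the point `q` of the unit disc.
This is the balayage of the point mass at `m + k (q + q⁻¹) / 2`. -/
noncomputable def bal (m k q : ℝ) : Measure ℝ :=
  (arcs m k).withDensity (fun y => ENNReal.ofReal (balDensity m k q y))

variable {m k q : ℝ}

theorem measurable_balDensity (m k q : ℝ) : Measurable (balDensity m k q) := by
  unfold balDensity
  fun_prop

theorem abs_div_le_one_of_mem_seg (hk : k ≠ 0) {y : ℝ} (hy : y ∈ seg m k) : |(y - m) / k| ≤ 1 := by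
  rw [abs_div, div_le_one (abs_pos.2 hk), abs_le]
  exact ⟨by linarith [hy.1], by linarith [hy.2]⟩

theorem balDensity_denom_mem (hk : k ≠ 0) {y : ℝ} (hy : y ∈ seg m k) :
    1 - 2 * q * ((y - m) / k) + q ^ 2 ∈ Icc ((1 - |q|) ^ 2) ((1 + |q|) ^ 2) := by
  have h := abs_div_le_one_of_mem_seg hk hy
  have h2 : |q * ((y - m) / k)| ≤ |q| := by
    rw [abs_mul]
    exact mul_le_of_le_one_right (abs_nonneg q) h
  have h3 := abs_le.1 h2
  have h4 := sq_abs q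
  constructor <;> nlinarith

theorem balDensity_mem (hk : k ≠ 0) (hq : |q| < 1) {y : ℝ} (hy : y ∈ seg m k) :
    balDensity m k q y ∈ Icc ((1 - |q|) / (1 + |q|)) ((1 + |q|) / (1 - |q|)) := by
  have h := balDensity_denom_mem (q := q) hk hy
  have h0 := abs_nonneg q
  have h1 : 0 < (1 - |q|) ^ 2 := by
    have : 0 < 1 - |q| := by linarith
    positivity
  have h2 : 1 - q ^ 2 = (1 - |q|) * (1 + |q|) := by
    rw [← sq_abs q]
    ring
  have h3 : 0 < 1 - |q| := by linarith
  unfold balDensity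
  rw [h2]
  constructor
  · rw [div_le_div_iff₀ (by linarith) (by linarith [h.1])]
    calc (1 - |q|) * (1 - 2 * q * ((y - m) / k) + q ^ 2) ≤ (1 - |q|) * (1 + |q|) ^ 2 :=
          mul_le_mul_of_nonneg_left h.2 h3.le
      _ = _ := by ring
  · rw [div_le_div_iff₀ (by linarith [h.1]) h3]
    calc (1 - |q|) * (1 + |q|) * (1 - |q|) = (1 + |q|) * (1 - |q|) ^ 2 := by ring
      _ ≤ _ := mul_le_mul_of_nonneg_left h.1 (by linarith)

theorem balDensity_pos (hk : k ≠ 0) (hq : |q| < 1) {y : ℝ} (hy : y ∈ seg m k) :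
    0 < balDensity m k q y := by
  refine lt_of_lt_of_le ?_ (balDensity_mem hk hq hy).1
  have := abs_nonneg q
  exact div_pos (by linarith) (by linarith)

theorem bal_zero (m k : ℝ) : bal m k 0 = arcs m k := by
  simp [bal, balDensity]

theorem ae_bal_mem_seg : ∀ᵐ y ∂(bal m k q), y ∈ seg m k :=
  (withDensity_absolutelyContinuous _ _).ae_le ae_arcs_mem_seg

theorem absolutelyContinuous_bal (hk : k ≠ 0) : bal m k q ≪ volume :=
  (withDensity_absolutelyContinuous _ _).trans (absolutelyContinuous_arcs hk)

theorem integrable_bal_of_arcs (hk : k ≠ 0) (hq : |q| < 1) {F : ℝ → ℝ}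
    (hi : Integrable F (arcs m k)) :
    Integrable F (bal m k q) := by
  rw [bal, integrable_withDensity_iff_integrable_smul' (measurable_balDensity m k q).ennreal_ofReal
    (Eventually.of_forall fun _ => ENNReal.ofReal_lt_top)]
  refine (hi.norm.const_mul ((1 + |q|) / (1 - |q|))).mono' ?_ ?_
  · exact ((measurable_balDensity m k q).ennreal_ofReal.ennreal_toReal.aestronglyMeasurable).smul
      hi.aestronglyMeasurable
  · filter_upwards [ae_arcs_mem_seg] with y hy
    have h := balDensity_mem hk hq hy
    have h0 := balDensity_pos hk hq hy
    rw [norm_smul, ENNReal.toReal_ofReal h0.le, Real.norm_of_nonneg h0.le]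
    exact mul_le_mul_of_nonneg_right h.2 (norm_nonneg _)

theorem integral_bal_eq (hk : k ≠ 0) (hq : |q| < 1) (F : ℝ → ℝ) :
    ∫ y, F y ∂(bal m k q) = ∫ y, balDensity m k q y * F y ∂(arcs m k) := by
  rw [bal, integral_withDensity_eq_integral_toReal_smul
    (measurable_balDensity m k q).ennreal_ofReal
    (Eventually.of_forall fun _ => ENNReal.ofReal_lt_top)]
  refine integral_congr_ae ?_
  filter_upwards [ae_arcs_mem_seg] with y hy
  rw [ENNReal.toReal_ofReal (balDensity_pos hk hq hy).le, smul_eq_mul]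

/-- On the unit circle `|z - q|² = 1 - 2 q Re z + q²` for real `q`. The Poisson kernel thus depends
on `Re z` only and descends to the interval. -/
theorem poissonKernel_eq_balDensity (hk : k ≠ 0) {z : ℂ} (hz : ‖z‖ = 1) :
    poissonKernel 0 (q : ℂ) z = balDensity m k q (m + k * z.re) := by
  have h1 : (m + k * z.re - m) / k = z.re := by
    field_simp
    ring
  have h2 : ‖z - (q : ℂ)‖ ^ 2 = 1 - 2 * q * z.re + q ^ 2 := by
    have hz' : z.re ^ 2 + z.im ^ 2 = 1 := by
      have : ‖z‖ ^ 2 = 1 := by rw [hz]; norm_num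
      rw [← Complex.normSq_eq_norm_sq, Complex.normSq_apply] at this
      linarith
    rw [← Complex.normSq_eq_norm_sq, Complex.normSq_apply]
    simp only [Complex.sub_re, Complex.ofReal_re, Complex.sub_im, Complex.ofReal_im, sub_zero]
    linarith
  rw [poissonKernel_def, balDensity, h1]
  simp only [sub_zero]
  rw [h2, hz, Complex.norm_real, Real.norm_eq_abs, sq_abs]
  norm_num

theorem integral_bal (hk : k ≠ 0) (hq : |q| < 1) {F : ℝ → ℝ} (hF : Measurable F) :
    ∫ y, F y ∂(bal m k q) =
      Real.circleAverage (poissonKernel 0 (q : ℂ) • fun z => F (m + k * z.re)) 0 1 := by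
  rw [integral_bal_eq hk hq,
    integral_arcs (F := fun y => balDensity m k q y * F y) ((measurable_balDensity m k q).mul hF)]
  refine Real.circleAverage_congr_sphere fun z hz => ?_
  rw [abs_one, mem_sphere_zero_iff_norm] at hz
  show balDensity m k q (m + k * z.re) * _ = poissonKernel 0 (q : ℂ) z • _
  rw [poissonKernel_eq_balDensity hk hz, smul_eq_mul]

theorem mem_ball_of_abs_lt (hq : |q| < 1) : (q : ℂ) ∈ Metric.ball (0 : ℂ) 1 := by
  rw [mem_ball_zero_iff, Complex.norm_real]
  exact hq

theorem integral_bal_one (hk : k ≠ 0) (hq : |q| < 1) : ∫ _, (1 : ℝ) ∂(bal m k q) = 1 := by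
  rw [integral_bal hk hq measurable_const]
  have h : InnerProductSpace.HarmonicOnNhd (fun _ : ℂ => (1 : ℝ)) (Metric.closedBall 0 1) :=
    fun z _ => (analyticAt_const (𝕜 := ℂ) (v := (1 : ℂ))).harmonicAt_re
  exact h.circleAverage_poissonKernel_smul (mem_ball_of_abs_lt hq)

theorem isProbabilityMeasure_bal (hk : k ≠ 0) (hq : |q| < 1) : IsProbabilityMeasure (bal m k q) := by
  have h := integral_bal_one (m := m) hk hq
  constructor
  rw [integral_const, smul_eq_mul, mul_one, Measure.real] at h
  rwa [← ENNReal.toReal_eq_one_iff]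

theorem integral_bal_id (hk : k ≠ 0) (hq : |q| < 1) : ∫ y, y ∂(bal m k q) = m + k * q := by
  rw [integral_bal (F := fun y => y) hk hq measurable_id]
  have h : InnerProductSpace.HarmonicOnNhd (fun z : ℂ => m + k * z.re) (Metric.closedBall 0 1) := by
    intro z _
    have : AnalyticAt ℂ (fun z : ℂ => (m : ℂ) + k * z) z := by fun_prop
    have := this.harmonicAt_re
    simpa using this
  have := h.circleAverage_poissonKernel_smul (mem_ball_of_abs_lt hq)
  simpa using this

theorem ae_circleMap_ne (ζ : ℂ) : ∀ᵐ φ : ℝ, circleMap 0 1 φ ≠ ζ := by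
  have h := ((countable_singleton ζ).preimage_circleMap 0 one_ne_zero).ae_notMem volume
  filter_upwards [h] with φ hφ h'
  exact hφ h'

/-- Moving the pole radially outwards increases its distance to every point of the circle. This
supplies the dominating function when the pole tends back to the circle. -/
theorem norm_sub_le_norm_sub_mul {z ζ : ℂ} {s : ℝ} (hz : ‖z‖ = 1) (hζ : ‖ζ‖ = 1) (hs : 1 ≤ s) :
    ‖z - ζ‖ ≤ ‖z - s * ζ‖ := by
  have h1 : z.re ^ 2 + z.im ^ 2 = 1 := by
    have : ‖z‖ ^ 2 = 1 := by rw [hz]; norm_num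
    rw [← Complex.normSq_eq_norm_sq, Complex.normSq_apply] at this
    linarith
  have h2 : ζ.re ^ 2 + ζ.im ^ 2 = 1 := by
    have : ‖ζ‖ ^ 2 = 1 := by rw [hζ]; norm_num
    rw [← Complex.normSq_eq_norm_sq, Complex.normSq_apply] at this
    linarith
  refine le_of_sq_le_sq ?_ (norm_nonneg _)
  rw [← Complex.normSq_eq_norm_sq, ← Complex.normSq_eq_norm_sq, Complex.normSq_apply,
    Complex.normSq_apply]
  simp only [Complex.sub_re, Complex.sub_im, Complex.mul_re, Complex.mul_im, Complex.ofReal_re,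
    Complex.ofReal_im]
  have h3 : z.re * ζ.re + z.im * ζ.im ≤ 1 := by nlinarith [sq_nonneg (z.re - ζ.re), sq_nonneg (z.im - ζ.im)]
  nlinarith [mul_nonneg (sub_nonneg.2 hs) (sub_nonneg.2 h3), mul_nonneg (sub_nonneg.2 hs) (sub_nonneg.2 hs)]

theorem circleAverage_poissonKernel_log_of_one_lt (hq : |q| < 1) {ζ : ℂ} (hζ : 1 < ‖ζ‖) :
    Real.circleAverage (poissonKernel 0 (q : ℂ) • fun z => Real.log ‖z - ζ‖) 0 1 =
      Real.log ‖(q : ℂ) - ζ‖ := by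
  have h : InnerProductSpace.HarmonicOnNhd (fun z : ℂ => Real.log ‖z - ζ‖)
      (Metric.closedBall 0 1) := by
    intro z hz
    refine AnalyticAt.harmonicAt_log_norm (by fun_prop) ?_
    intro h0
    rw [mem_closedBall_zero_iff, sub_eq_zero.1 h0] at hz
    linarith
  exact h.circleAverage_poissonKernel_smul (mem_ball_of_abs_lt hq)

theorem continuous_poissonKernel_circleMap (hq : |q| < 1) :
    Continuous fun φ : ℝ => poissonKernel 0 (q : ℂ) (circleMap 0 1 φ) := by
  unfold poissonKernel
  refine Continuous.div (by fun_prop) (by fun_prop) fun φ => ?_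
  simp only [sub_zero]
  have h : (q : ℂ) ≠ circleMap 0 1 φ := by
    intro h
    have h1 := congrArg norm h
    rw [Complex.norm_real, Real.norm_eq_abs, norm_circleMap_zero, abs_one] at h1
    linarith
  exact pow_ne_zero 2 (norm_ne_zero_iff.2 (sub_ne_zero.2 h.symm))

/-- For a pole off the closed disc this is the Poisson formula for a harmonic function. A pole on
the circle is the limit of the poles `s ζ` with `s ↓ 1`, by dominated convergence. -/
theorem circleAverage_poissonKernel_log (hq : |q| < 1) {ζ : ℂ} (hζ : 1 ≤ ‖ζ‖) :
    Real.circleAverage (poissonKernel 0 (q : ℂ) • fun z => Real.log ‖z - ζ‖) 0 1 =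
      Real.log ‖(q : ℂ) - ζ‖ := by
  rcases hζ.lt_or_eq with h | h
  · exact circleAverage_poissonKernel_log_of_one_lt hq h
  set s : ℕ → ℝ := fun n => 1 + 1 / ((n : ℝ) + 1) with hs
  have hs1 : ∀ n, 1 < s n := fun n => by
    have : 0 < 1 / ((n : ℝ) + 1) := by positivity
    simp only [hs]
    linarith
  have hs2 : ∀ n, s n ≤ 2 := fun n => by
    have : 1 / ((n : ℝ) + 1) ≤ 1 := by
      rw [div_le_one (by positivity)]
      linarith [(Nat.cast_nonneg n : (0 : ℝ) ≤ n)]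
    simp only [hs]
    linarith
  have hlim : Tendsto s atTop (𝓝 1) := by
    simpa [hs] using tendsto_one_div_add_atTop_nhds_zero_nat.const_add (1 : ℝ)
  have hlimc : Tendsto (fun n => (s n : ℂ) * ζ) atTop (𝓝 ζ) := by
    have := (Complex.continuous_ofReal.tendsto 1).comp hlim
    simpa using this.mul_const ζ
  have hqζ : (q : ℂ) ≠ ζ := by
    intro h1
    rw [← h1, Complex.norm_real, Real.norm_eq_abs] at h
    linarith
  have hR : Tendsto (fun n => Real.log ‖(q : ℂ) - s n * ζ‖) atTop (𝓝 (Real.log ‖(q : ℂ) - ζ‖)) :=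
    ((tendsto_const_nhds.sub hlimc).norm).log (norm_ne_zero_iff.2 (sub_ne_zero.2 hqζ))
  have heq : ∀ n, Real.circleAverage (poissonKernel 0 (q : ℂ) • fun z => Real.log ‖z - s n * ζ‖) 0 1
      = Real.log ‖(q : ℂ) - s n * ζ‖ := fun n =>
    circleAverage_poissonKernel_log_of_one_lt hq (by
      rw [norm_mul, ← h, mul_one, Complex.norm_real, Real.norm_of_nonneg (by linarith [hs1 n])]
      exact hs1 n)
  refine tendsto_nhds_unique ?_ hR
  simp_rw [← heq, Real.circleAverage_def]
  refine Tendsto.const_smul ?_ _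
  have hci : IntervalIntegrable (fun φ => Real.log ‖circleMap 0 1 φ - ζ‖) volume 0 (2 * Real.pi) :=
    circleIntegrable_log_norm_sub_const (c := 0) (a := ζ) 1
  -- The bound comes from `|z - ζ| ≤ |z - s ζ| ≤ 3`, valid because `1 < s ≤ 2`.
  refine intervalIntegral.tendsto_integral_filter_of_dominated_convergence
    (fun φ => |poissonKernel 0 (q : ℂ) (circleMap 0 1 φ)| *
      (|Real.log ‖circleMap 0 1 φ - ζ‖| + Real.log 3)) ?_ ?_ ?_ ?_
  · refine Eventually.of_forall fun n => Measurable.aestronglyMeasurable ?_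
    refine ((continuous_poissonKernel_circleMap hq).measurable).mul ?_
    exact Real.measurable_log.comp (by fun_prop)
  · refine Eventually.of_forall fun n => ?_
    filter_upwards [ae_circleMap_ne ζ] with φ hφ _
    have hz : ‖circleMap 0 1 φ‖ = 1 := by simp
    show ‖poissonKernel 0 (q : ℂ) (circleMap 0 1 φ) * Real.log ‖circleMap 0 1 φ - s n * ζ‖‖ ≤ _
    rw [norm_mul, Real.norm_eq_abs, Real.norm_eq_abs]
    refine mul_le_mul_of_nonneg_left ?_ (abs_nonneg _)
    have h0 : 0 < ‖circleMap 0 1 φ - ζ‖ := norm_pos_iff.2 (sub_ne_zero.2 hφ)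
    have h1 := norm_sub_le_norm_sub_mul hz h.symm (hs1 n).le
    have h2 : ‖circleMap 0 1 φ - s n * ζ‖ ≤ 3 := by
      refine (norm_sub_le _ _).trans ?_
      rw [hz, norm_mul, ← h, mul_one, Complex.norm_real,
        Real.norm_of_nonneg (by linarith [hs1 n])]
      linarith [hs2 n]
    have h3 := Real.log_le_log h0 h1
    have h4 := Real.log_le_log (h0.trans_le h1) h2
    rw [abs_le]
    have := neg_abs_le (Real.log ‖circleMap 0 1 φ - ζ‖)
    have := abs_nonneg (Real.log ‖circleMap 0 1 φ - ζ‖)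
    have h5 : 0 ≤ Real.log 3 := Real.log_nonneg (by norm_num)
    constructor <;> linarith
  · refine IntervalIntegrable.continuousOn_mul ?_
      ((continuous_poissonKernel_circleMap hq).abs.continuousOn)
    exact hci.abs.add intervalIntegrable_const
  · filter_upwards [ae_circleMap_ne ζ] with φ hφ _
    refine Tendsto.const_mul _ ?_
    exact ((tendsto_const_nhds.sub hlimc).norm).log (norm_ne_zero_iff.2 (sub_ne_zero.2 hφ))

/-- The two solutions `β ± w` of the quadratic equation for `ζ` have product 1, so one of them lies
outside the open unit disc. -/
theorem exists_joukowski (hk : k ≠ 0) (α : ℂ) :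
    ∃ ζ : ℂ, 1 ≤ ‖ζ‖ ∧ α = m + k / 2 * (ζ + ζ⁻¹) := by
  have hkc : (k : ℂ) ≠ 0 := Complex.ofReal_ne_zero.2 hk
  set β : ℂ := (α - m) / k with hβ
  obtain ⟨w, hw⟩ := IsAlgClosed.exists_pow_nat_eq (β ^ 2 - 1) (n := 2) (by norm_num)
  have hmul : (β + w) * (β - w) = 1 := by linear_combination -hw
  have h0 : β + w ≠ 0 := left_ne_zero_of_mul_eq_one hmul
  have hinv : (β + w)⁻¹ = β - w := inv_eq_of_mul_eq_one_right hmul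
  have hα : α = m + k / 2 * ((β + w) + (β + w)⁻¹) := by
    rw [hinv, hβ]
    field_simp
    ring
  rcases le_total 1 ‖β + w‖ with h | h
  · exact ⟨β + w, h, hα⟩
  · refine ⟨(β + w)⁻¹, ?_, by rw [inv_inv, add_comm, add_comm _ (β + w)] at *; exact hα⟩
    rw [norm_inv]
    exact (one_le_inv₀ (norm_pos_iff.2 h0)).2 h

/-- The Joukowski map factors the difference: `x - α = (k/2) (z - ζ) (ζ - z⁻¹) ζ⁻¹`, and on the
circle `z⁻¹` is the conjugate of `z`. -/
theorem log_norm_cos_sub (hk : k ≠ 0) {α ζ z : ℂ} (hζ : 1 ≤ ‖ζ‖) (hα : α = m + k / 2 * (ζ + ζ⁻¹))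
    (hz : ‖z‖ = 1) (h1 : z ≠ ζ) (h2 : z ≠ (starRingEnd ℂ) ζ) :
    Real.log ‖((m + k * z.re : ℝ) : ℂ) - α‖ =
      Real.log (|k| / 2) - Real.log ‖ζ‖ + Real.log ‖z - ζ‖ + Real.log ‖z - (starRingEnd ℂ) ζ‖ := by
  have hz0 : z ≠ 0 := by
    rintro rfl
    simp at hz
  have hζ0 : ζ ≠ 0 := norm_pos_iff.1 (by linarith)
  have hconj : (starRingEnd ℂ) z = z⁻¹ := (Complex.inv_eq_conj hz).symm
  have hre : (z.re : ℂ) = (z + z⁻¹) / 2 := by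
    rw [← hconj, Complex.add_conj]
    push_cast
    ring
  have hfac : ((m + k * z.re : ℝ) : ℂ) - α = (k / 2) * (z - ζ) * (ζ - z⁻¹) * ζ⁻¹ := by
    push_cast
    rw [hre, hα]
    field_simp
    ring
  have hn : ‖ζ - z⁻¹‖ = ‖z - (starRingEnd ℂ) ζ‖ := by
    rw [← hconj, ← Complex.norm_conj, map_sub, Complex.conj_conj, norm_sub_rev]
  have hk2 : ‖(k / 2 : ℂ)‖ = |k| / 2 := by
    rw [norm_div, Complex.norm_real, Real.norm_eq_abs]
    norm_num
  have e1 : |k| / 2 ≠ 0 := by positivity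
  have e2 : ‖z - ζ‖ ≠ 0 := norm_ne_zero_iff.2 (sub_ne_zero.2 h1)
  have e3 : ‖z - (starRingEnd ℂ) ζ‖ ≠ 0 := norm_ne_zero_iff.2 (sub_ne_zero.2 h2)
  have e4 : ‖ζ‖ ≠ 0 := norm_ne_zero_iff.2 hζ0
  rw [hfac, norm_mul, norm_mul, norm_mul, hk2, hn, norm_inv,
    Real.log_mul (mul_ne_zero (mul_ne_zero e1 e2) e3) (inv_ne_zero e4),
    Real.log_mul (mul_ne_zero e1 e2) e3, Real.log_mul e1 e2, Real.log_inv]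
  ring

theorem measurable_log_norm_sub (α : ℂ) : Measurable fun y : ℝ => Real.log ‖(y : ℂ) - α‖ :=
  Real.measurable_log.comp (by fun_prop)

theorem circleMap_zero_one_re (φ : ℝ) : (circleMap 0 1 φ).re = Real.cos φ := by
  simp [circleMap, Complex.exp_ofReal_mul_I_re]

theorem integrable_arcs_log (hk : k ≠ 0) (α : ℂ) :
    Integrable (fun y : ℝ => Real.log ‖(y : ℂ) - α‖) (arcs m k) := by
  obtain ⟨ζ, hζ, hα⟩ := exists_joukowski (m := m) hk α
  rw [integrable_arcs_iff (measurable_log_norm_sub α),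
    ← intervalIntegrable_iff_integrableOn_Ioc_of_le (by positivity)]
  have i1 : IntervalIntegrable (fun φ => Real.log ‖circleMap 0 1 φ - ζ‖) volume 0 (2 * Real.pi) :=
    circleIntegrable_log_norm_sub_const (c := 0) (a := ζ) 1
  have i2 : IntervalIntegrable (fun φ => Real.log ‖circleMap 0 1 φ - (starRingEnd ℂ) ζ‖) volume 0
      (2 * Real.pi) :=
    circleIntegrable_log_norm_sub_const (c := 0) (a := (starRingEnd ℂ) ζ) 1
  have i3 := ((intervalIntegrable_const (μ := volume) (a := 0) (b := 2 * Real.pi)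
    (c := Real.log (|k| / 2) - Real.log ‖ζ‖)).add i1).add i2
  refine i3.congr_ae (ae_restrict_of_ae ?_)
  filter_upwards [ae_circleMap_ne ζ, ae_circleMap_ne ((starRingEnd ℂ) ζ)] with φ h1 h2
  have := log_norm_cos_sub (m := m) hk hζ hα (z := circleMap 0 1 φ) (by simp) h1 h2
  rw [circleMap_zero_one_re] at this
  exact this.symm

/-- Both factors of the Joukowski product have their poles outside the open disc, so the Poisson
formula evaluates their logarithms at `q`; the two values agree because `q` is real. -/
theorem integral_bal_log (hk : k ≠ 0) (hq : |q| < 1) {α ζ : ℂ} (hζ : 1 ≤ ‖ζ‖)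
    (hα : α = m + k / 2 * (ζ + ζ⁻¹)) :
    ∫ y : ℝ, Real.log ‖(y : ℂ) - α‖ ∂(bal m k q) =
      Real.log (|k| / 2) - Real.log ‖ζ‖ + 2 * Real.log ‖(q : ℂ) - ζ‖ := by
  rw [integral_bal hk hq (measurable_log_norm_sub α)]
  have hconst : InnerProductSpace.HarmonicOnNhd
      (fun _ : ℂ => Real.log (|k| / 2) - Real.log ‖ζ‖) (Metric.closedBall 0 1) := fun z _ =>
    (analyticAt_const (𝕜 := ℂ) (v := ((Real.log (|k| / 2) - Real.log ‖ζ‖ : ℝ) : ℂ))).harmonicAt_re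
  have a0 := hconst.circleAverage_poissonKernel_smul (mem_ball_of_abs_lt hq)
  have a1 := circleAverage_poissonKernel_log hq hζ
  have a2 := circleAverage_poissonKernel_log hq (ζ := (starRingEnd ℂ) ζ) (by rwa [Complex.norm_conj])
  have hqc : ‖(q : ℂ) - (starRingEnd ℂ) ζ‖ = ‖(q : ℂ) - ζ‖ := by
    rw [← Complex.norm_conj, map_sub, Complex.conj_conj, Complex.conj_ofReal]
  rw [hqc] at a2
  have hP := (continuous_poissonKernel_circleMap hq).continuousOn (s := uIcc 0 (2 * Real.pi))
  have i0 : CircleIntegrable (poissonKernel 0 (q : ℂ) • fun _ : ℂ => Real.log (|k| / 2) - Real.log ‖ζ‖)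
      0 1 := intervalIntegrable_const.continuousOn_mul hP
  have i1 : CircleIntegrable (poissonKernel 0 (q : ℂ) • fun z : ℂ => Real.log ‖z - ζ‖) 0 1 :=
    IntervalIntegrable.continuousOn_mul
      (circleIntegrable_log_norm_sub_const (c := 0) (a := ζ) 1) hP
  have i2 : CircleIntegrable (poissonKernel 0 (q : ℂ) •
      fun z : ℂ => Real.log ‖z - (starRingEnd ℂ) ζ‖) 0 1 :=
    IntervalIntegrable.continuousOn_mul
      (circleIntegrable_log_norm_sub_const (c := 0) (a := (starRingEnd ℂ) ζ) 1) hP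
  have hsum := Real.circleAverage_add (i0.add i1) i2
  rw [Real.circleAverage_add i0 i1, a0, a1, a2] at hsum
  have : Real.circleAverage (poissonKernel 0 (q : ℂ) •
      fun z : ℂ => Real.log ‖((m + k * z.re : ℝ) : ℂ) - α‖) 0 1 =
      Real.log (|k| / 2) - Real.log ‖ζ‖ + Real.log ‖(q : ℂ) - ζ‖ + Real.log ‖(q : ℂ) - ζ‖ := by
    rw [← hsum, Real.circleAverage_def, Real.circleAverage_def]
    congr 1
    refine intervalIntegral.integral_congr_ae ?_
    filter_upwards [ae_circleMap_ne ζ, ae_circleMap_ne ((starRingEnd ℂ) ζ)] with φ h1 h2 _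
    have := log_norm_cos_sub (m := m) hk hζ hα (z := circleMap 0 1 φ) (by simp) h1 h2
    set P := poissonKernel 0 (q : ℂ) (circleMap 0 1 φ)
    show P * Real.log ‖((m + k * (circleMap 0 1 φ).re : ℝ) : ℂ) - α‖ = P * (Real.log (|k| / 2) - Real.log ‖ζ‖) + P * Real.log ‖circleMap 0 1 φ - ζ‖ +
      P * Real.log ‖circleMap 0 1 φ - (starRingEnd ℂ) ζ‖
    rw [this]
    ring
  rw [this]
  ring

end Balayage

/-! ### Potentials and mutual energies -/

section Potentials

/-- The logarithmic potential as a real number. -/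
noncomputable def pot (σ : Measure ℝ) (x : ℝ) : ℝ := ∫ y, Real.log |x - y| ∂σ

/-- The logarithmic kernel is integrable for `μ × ν`. -/
def LogIntegrable (μ ν : Measure ℝ) : Prop :=
  Integrable (fun z : ℝ × ℝ => Real.log |z.1 - z.2|) (μ.prod ν)

/-- The mutual energy as a real number. -/
noncomputable def mutualEnergy (μ ν : Measure ℝ) : ℝ :=
  ∫ z, Real.log |z.1 - z.2| ∂(μ.prod ν)

theorem measurable_log_abs_sub : Measurable fun z : ℝ × ℝ => Real.log |z.1 - z.2| :=
  Real.measurable_log.comp (by fun_prop)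

theorem measurable_log_abs_sub_left (x : ℝ) : Measurable fun y : ℝ => Real.log |x - y| :=
  Real.measurable_log.comp (by fun_prop)

variable {μ ν σ : Measure ℝ} [IsFiniteMeasure μ] [IsFiniteMeasure ν] [IsFiniteMeasure σ]

theorem measurable_pot (σ : Measure ℝ) [IsFiniteMeasure σ] : Measurable (pot σ) :=
  (measurable_log_abs_sub.stronglyMeasurable.integral_prod_right (ν := σ)).measurable

theorem log_abs_sub_comm (x y : ℝ) : Real.log |x - y| = Real.log |y - x| := by rw [abs_sub_comm]

theorem LogIntegrable.symm (h : LogIntegrable μ ν) : LogIntegrable ν μ := by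
  have := Integrable.swap h
  refine this.congr (Eventually.of_forall fun z => ?_)
  exact log_abs_sub_comm _ _

theorem mutualEnergy_comm (μ ν : Measure ℝ) [IsFiniteMeasure μ] [IsFiniteMeasure ν] :
    mutualEnergy μ ν = mutualEnergy ν μ := by
  unfold mutualEnergy
  rw [← integral_prod_swap]
  exact integral_congr_ae (Eventually.of_forall fun z => log_abs_sub_comm _ _)

theorem mutualEnergy_eq_integral_pot (h : LogIntegrable μ ν) :
    mutualEnergy μ ν = ∫ x, pot ν x ∂μ := integral_prod _ h

theorem LogIntegrable.integrable_pot (h : LogIntegrable μ ν) : Integrable (pot ν) μ :=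
  Integrable.integral_prod_left h

theorem LogIntegrable.ae_integrable (h : LogIntegrable μ ν) :
    ∀ᵐ x ∂μ, Integrable (fun y => Real.log |x - y|) ν := Integrable.prod_right_ae h

theorem LogIntegrable.mono {μ' ν' : Measure ℝ} [SFinite ν'] (h : LogIntegrable μ ν) (hμ : μ' ≤ μ)
    (hν : ν' ≤ ν) : LogIntegrable μ' ν' :=
  Integrable.mono_measure h (Measure.prod_mono hμ hν)

theorem LogIntegrable.smul_left (h : LogIntegrable μ ν) (c : NNReal) :
    LogIntegrable (c • μ) ν := by
  unfold LogIntegrable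
  rw [Measure.prod_smul_left]
  exact Integrable.smul_measure_nnreal h

theorem mutualEnergy_smul_left (c : NNReal) (μ ν : Measure ℝ) [IsFiniteMeasure μ]
    [IsFiniteMeasure ν] : mutualEnergy (c • μ) ν = c * mutualEnergy μ ν := by
  unfold mutualEnergy
  rw [Measure.prod_smul_left, integral_smul_nnreal_measure]
  rfl

theorem LogIntegrable.smul_right (h : LogIntegrable μ ν) (c : NNReal) :
    LogIntegrable μ (c • ν) := (h.symm.smul_left c).symm

theorem mutualEnergy_smul_right (c : NNReal) (μ ν : Measure ℝ) [IsFiniteMeasure μ]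
    [IsFiniteMeasure ν] : mutualEnergy μ (c • ν) = c * mutualEnergy μ ν := by
  rw [mutualEnergy_comm, mutualEnergy_smul_left, mutualEnergy_comm]

theorem LogIntegrable.add_left (h1 : LogIntegrable μ σ) (h2 : LogIntegrable ν σ) :
    LogIntegrable (μ + ν) σ := by
  unfold LogIntegrable
  rw [Measure.add_prod]
  exact Integrable.add_measure h1 h2

theorem mutualEnergy_add_left (h1 : LogIntegrable μ σ) (h2 : LogIntegrable ν σ) :
    mutualEnergy (μ + ν) σ = mutualEnergy μ σ + mutualEnergy ν σ := by
  unfold mutualEnergy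
  rw [Measure.add_prod]
  exact integral_add_measure h1 h2

theorem LogIntegrable.add_right (h1 : LogIntegrable σ μ) (h2 : LogIntegrable σ ν) :
    LogIntegrable σ (μ + ν) := (h1.symm.add_left h2.symm).symm

theorem mutualEnergy_add_right (h1 : LogIntegrable σ μ) (h2 : LogIntegrable σ ν) :
    mutualEnergy σ (μ + ν) = mutualEnergy σ μ + mutualEnergy σ ν := by
  rw [mutualEnergy_comm, mutualEnergy_add_left h1.symm h2.symm, mutualEnergy_comm,
    mutualEnergy_comm ν]

theorem logIntegrable_combination (h1 : LogIntegrable μ μ) (h2 : LogIntegrable ν ν)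
    (h3 : LogIntegrable μ ν) (a b : NNReal) :
    LogIntegrable (a • μ + b • ν) (a • μ + b • ν) :=
  (((h1.smul_left a).smul_right a).add_left ((h3.symm.smul_left b).smul_right a)).add_right
    (((h3.smul_left a).smul_right b).add_left ((h2.smul_left b).smul_right b))

theorem mutualEnergy_combination (h1 : LogIntegrable μ μ) (h2 : LogIntegrable ν ν)
    (h3 : LogIntegrable μ ν) (a b : NNReal) :
    mutualEnergy (a • μ + b • ν) (a • μ + b • ν) =
      a ^ 2 * mutualEnergy μ μ + 2 * a * b * mutualEnergy μ ν + b ^ 2 * mutualEnergy ν ν := by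
  rw [mutualEnergy_add_right, mutualEnergy_add_left, mutualEnergy_add_left]
  · simp only [mutualEnergy_smul_left, mutualEnergy_smul_right]
    rw [mutualEnergy_comm ν μ]
    ring
  · exact (h3.smul_left a).smul_right b
  · exact (h2.smul_left b).smul_right b
  · exact (h1.smul_left a).smul_right a
  · exact (h3.symm.smul_left b).smul_right a
  · exact ((h1.smul_left a).smul_right a).add_left ((h3.symm.smul_left b).smul_right a)
  · exact ((h3.smul_left a).smul_right b).add_left ((h2.smul_left b).smul_right b)

theorem abs_log_le {M u : ℝ} (h : Real.log |u| ≤ M) (hM : 0 ≤ M) :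
    |(Real.log |u|)| ≤ 2 * M - Real.log |u| := by
  rw [abs_le]
  constructor <;> linarith

/-- The assumption `1 ≤ T` covers `u = 0`, where `Real.log 0 = 0`. -/
theorem log_abs_le {T u : ℝ} (hT : 1 ≤ T) (h : |u| ≤ T) : Real.log |u| ≤ Real.log T := by
  rcases (abs_nonneg u).eq_or_lt with h0 | h0
  · rw [← h0, Real.log_zero]
    exact Real.log_nonneg hT
  · exact Real.log_le_log h0 h

/-- A potential bounded below on a bounded set makes the kernel integrable. -/
theorem logIntegrable_of_le_pot {c T : ℝ} (hT : 1 ≤ T)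
    (hbd : ∀ᵐ x ∂μ, ∀ᵐ y ∂ν, |x - y| ≤ T)
    (hi : ∀ᵐ x ∂μ, Integrable (fun y => Real.log |x - y|) ν ∧ c ≤ pot ν x) :
    LogIntegrable μ ν := by
  refine (integrable_prod_iff measurable_log_abs_sub.aestronglyMeasurable).2
    ⟨hi.mono fun x hx => hx.1, ?_⟩
  refine (integrable_const (2 * Real.log T * ν.real univ - c)).mono' ?_ ?_
  · exact (measurable_log_abs_sub.norm.stronglyMeasurable.integral_prod_right
      (ν := ν)).aestronglyMeasurable
  · filter_upwards [hbd, hi] with x h1 h2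
    have h3 : ∫ y, ‖Real.log |x - y|‖ ∂ν ≤ ∫ y, (2 * Real.log T - Real.log |x - y|) ∂ν := by
      refine integral_mono_ae h2.1.norm ((integrable_const _).sub h2.1) ?_
      filter_upwards [h1] with y hy
      exact abs_log_le (log_abs_le hT hy) (Real.log_nonneg hT)
    rw [integral_sub (integrable_const _) h2.1, integral_const, smul_eq_mul] at h3
    rw [Real.norm_of_nonneg (integral_nonneg fun y => norm_nonneg _)]
    have h4 := h2.2
    unfold pot at h4
    linarith

theorem pot_le {T x : ℝ} (hT : 1 ≤ T) (hbd : ∀ᵐ y ∂ν, |x - y| ≤ T) :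
    pot ν x ≤ Real.log T * ν.real univ := by
  by_cases hi : Integrable (fun y => Real.log |x - y|) ν
  · calc pot ν x ≤ ∫ _, Real.log T ∂ν := by
          refine integral_mono_ae hi (integrable_const _) ?_
          filter_upwards [hbd] with y hy
          exact log_abs_le hT hy
      _ = _ := by rw [integral_const, smul_eq_mul, mul_comm]
  -- A non-integrable kernel gives the default value 0, which obeys the bound because `log T ≥ 0`.
  · rw [pot, integral_undef hi]
    exact mul_nonneg (Real.log_nonneg hT) ENNReal.toReal_nonneg

theorem norm_ofReal_sub (y t : ℝ) : ‖(y : ℂ) - (t : ℂ)‖ = |y - t| := by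
  rw [← Complex.ofReal_sub, Complex.norm_real, Real.norm_eq_abs]

theorem integrable_log_arcs {m k : ℝ} (hk : k ≠ 0) (t : ℝ) :
    Integrable (fun y => Real.log |t - y|) (arcs m k) := by
  have := integrable_arcs_log (m := m) hk (t : ℂ)
  simp_rw [norm_ofReal_sub] at this
  simpa only [log_abs_sub_comm t] using this

theorem integrable_log_bal {m k q : ℝ} (hk : k ≠ 0) (hq : |q| < 1) (t : ℝ) :
    Integrable (fun y => Real.log |t - y|) (bal m k q) :=
  integrable_bal_of_arcs hk hq (integrable_log_arcs hk t)

theorem pot_bal {m k q : ℝ} (hk : k ≠ 0) (hq : |q| < 1) {t : ℝ} {ζ : ℂ} (hζ : 1 ≤ ‖ζ‖)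
    (ht : (t : ℂ) = m + k / 2 * (ζ + ζ⁻¹)) :
    pot (bal m k q) t = Real.log (|k| / 2) - Real.log ‖ζ‖ + 2 * Real.log ‖(q : ℂ) - ζ‖ := by
  rw [← integral_bal_log hk hq hζ ht, pot]
  simp_rw [norm_ofReal_sub, log_abs_sub_comm t]

theorem norm_sub_ge {q : ℝ} {ζ : ℂ} (hζ : 1 ≤ ‖ζ‖) : (1 - |q|) * ‖ζ‖ ≤ ‖(q : ℂ) - ζ‖ := by
  have h1 : ‖ζ‖ - |q| ≤ ‖(q : ℂ) - ζ‖ := by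
    rw [norm_sub_rev]
    have := norm_sub_norm_le ζ (q : ℂ)
    rwa [Complex.norm_real, Real.norm_eq_abs] at this
  have := abs_nonneg q
  nlinarith

/-- The bound does not depend on `t`. Hence the logarithmic kernel is integrable for these measures
against every finite measure of bounded support, whatever its singularities. -/
theorem le_pot_bal {m k q : ℝ} (hk : k ≠ 0) (hq : |q| < 1) (t : ℝ) :
    Real.log (|k| / 2) + 2 * Real.log (1 - |q|) ≤ pot (bal m k q) t := by
  obtain ⟨ζ, hζ, ht⟩ := exists_joukowski (m := m) hk (t : ℂ)
  rw [pot_bal hk hq hζ ht]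
  have h1 := norm_sub_ge (q := q) hζ
  have h0 : 0 < 1 - |q| := by linarith
  have h2 := Real.log_le_log (by positivity) h1
  rw [Real.log_mul h0.ne' (by positivity)] at h2
  have h3 := Real.log_nonneg hζ
  linarith

theorem abs_sub_le_of_mem_seg {m k x y : ℝ} (hy : y ∈ seg m k) :
    |x - y| ≤ |x| + |m| + |k| := by
  have h1 : |m - y| ≤ |k| := by
    rw [abs_le]
    exact ⟨by linarith [hy.2], by linarith [hy.1]⟩
  calc |x - y| = |x + -m + (m - y)| := by ring_nf
    _ ≤ |x| + |-m| + |m - y| := abs_add_three _ _ _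
    _ ≤ _ := by rw [abs_neg]; linarith

theorem logIntegrable_bal {m k q : ℝ} (hk : k ≠ 0) (hq : |q| < 1) {T : ℝ}
    (hσ : ∀ᵐ x ∂σ, |x| ≤ T) : LogIntegrable σ (bal m k q) := by
  have := isProbabilityMeasure_bal (m := m) hk hq
  refine logIntegrable_of_le_pot (T := 1 + |T| + |m| + |k|) (by linarith [abs_nonneg T, abs_nonneg m, abs_nonneg k]) ?_
    (Eventually.of_forall fun x => ⟨integrable_log_bal hk hq x, le_pot_bal hk hq x⟩)
  filter_upwards [hσ] with x hx
  filter_upwards [ae_bal_mem_seg] with y hy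
  have := abs_sub_le_of_mem_seg (x := x) hy
  linarith [le_abs_self T]

end Potentials

/-! ### Minimum principle and semicontinuity of potentials -/

section MinimumPrinciple

variable {σ : Measure ℝ} [IsFiniteMeasure σ]

theorem abs_log_le_of_mem {d T u : ℝ} (hd : 0 < d) (h1 : d ≤ u) (h2 : u ≤ T) :
    |(Real.log u)| ≤ |(Real.log d)| + |(Real.log T)| := by
  have h3 := Real.log_le_log hd h1
  have h4 := Real.log_le_log (hd.trans_le h1) h2
  have := neg_abs_le (Real.log d)
  have := le_abs_self (Real.log T)
  have := abs_nonneg (Real.log d)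
  have := abs_nonneg (Real.log T)
  rw [abs_le]
  constructor <;> linarith

theorem integrable_log_of_dist {x d T : ℝ} (hd : 0 < d) (h1 : ∀ᵐ y ∂σ, d ≤ |x - y|)
    (h2 : ∀ᵐ y ∂σ, |x - y| ≤ T) : Integrable (fun y => Real.log |x - y|) σ := by
  refine (integrable_const (|(Real.log d)| + |(Real.log T)|)).mono'
    (measurable_log_abs_sub_left x).aestronglyMeasurable ?_
  filter_upwards [h1, h2] with y h3 h4
  exact abs_log_le_of_mem hd h3 h4

theorem exists_dist_bounds {K : Set ℝ} (hK : IsCompact K) {x : ℝ} (hx : x ∉ K) :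
    ∃ d T, 0 < d ∧ ∀ y ∈ K, d ≤ |x - y| ∧ |x - y| ≤ T := by
  obtain ⟨T, hT⟩ := hK.isBounded.subset_closedBall x
  obtain ⟨d, hd, hb⟩ := Metric.isOpen_iff.1 hK.isClosed.isOpen_compl x hx
  refine ⟨d, T, hd, fun y hy => ⟨?_, ?_⟩⟩
  · by_contra h
    refine hb (a := y) ?_ hy
    rw [Metric.mem_ball, dist_comm, Real.dist_eq]
    exact not_le.1 h
  · have := hT hy
    rwa [Metric.mem_closedBall, dist_comm, Real.dist_eq] at this

theorem integrable_log_of_notMem {K : Set ℝ} (hK : IsCompact K) (hσ : ∀ᵐ y ∂σ, y ∈ K) {x : ℝ}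
    (hx : x ∉ K) : Integrable (fun y => Real.log |x - y|) σ := by
  obtain ⟨d, T, hd, h⟩ := exists_dist_bounds hK hx
  exact integrable_log_of_dist hd (hσ.mono fun y hy => (h y hy).1) (hσ.mono fun y hy => (h y hy).2)

theorem log_abs_concave {c₁ c₂ y t : ℝ} (ht0 : 0 ≤ t) (ht1 : t ≤ 1) (hc : c₁ ≤ c₂)
    (hy : y < c₁ ∨ c₂ < y) :
    (1 - t) * Real.log |c₁ - y| + t * Real.log |c₂ - y| ≤
      Real.log |((1 - t) * c₁ + t * c₂) - y| := by
  have hconc := strictConcaveOn_log_Ioi.concaveOn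
  have e1 : 0 < |c₁ - y| := abs_pos.2 fun h0 => by rcases hy with h | h <;> linarith
  have e2 : 0 < |c₂ - y| := abs_pos.2 fun h0 => by rcases hy with h | h <;> linarith
  rcases hy with h | h
  · have := hconc.2 e1 e2 (sub_nonneg.2 ht1) ht0 (by ring)
    simp only [smul_eq_mul] at this
    refine this.trans_eq ?_
    rw [abs_of_pos (by linarith : 0 < c₁ - y), abs_of_pos (by linarith : 0 < c₂ - y),
      abs_of_pos (by nlinarith : 0 < ((1 - t) * c₁ + t * c₂) - y)]
    ring_nf
  · have := hconc.2 e1 e2 (sub_nonneg.2 ht1) ht0 (by ring)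
    simp only [smul_eq_mul] at this
    refine this.trans_eq ?_
    rw [abs_of_neg (by linarith : c₁ - y < 0), abs_of_neg (by linarith : c₂ - y < 0),
      abs_of_neg (by nlinarith : ((1 - t) * c₁ + t * c₂) - y < 0)]
    ring_nf

/-- The minimum principle: a lower bound for a potential on a compact set that carries the measure
holds on the whole line. -/
theorem le_pot_of_le_pot_on [NullSingletonClass σ] {K : Set ℝ} (hK : IsCompact K) (hne : K.Nonempty)
    (hσ : ∀ᵐ y ∂σ, y ∈ K) {c : ℝ}
    (h : ∀ x ∈ K, Integrable (fun y => Real.log |x - y|) σ ∧ c ≤ pot σ x) (x : ℝ) :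
    Integrable (fun y => Real.log |x - y|) σ ∧ c ≤ pot σ x := by
  by_cases hx : x ∈ K
  · exact h x hx
  have hi := integrable_log_of_notMem hK hσ hx
  refine ⟨hi, ?_⟩
  have hnull : ∀ z : ℝ, ∀ᵐ y ∂σ, y ≠ z := fun z => by
    filter_upwards [measure_eq_zero_iff_ae_notMem.1 (measure_singleton (μ := σ) z)] with y hy h
    exact hy h
  by_cases hL : (K ∩ Iic x).Nonempty
  · have hLc : IsCompact (K ∩ Iic x) := hK.inter_right isClosed_Iic
    obtain ⟨c₁, hc₁, hmax⟩ := hLc.exists_isGreatest hL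
    by_cases hR : (K ∩ Ici x).Nonempty
    · have hRc : IsCompact (K ∩ Ici x) := hK.inter_right isClosed_Ici
      obtain ⟨c₂, hc₂, hmin⟩ := hRc.exists_isLeast hR
      have h12 : c₁ < c₂ := by
        rcases (hc₁.2.trans hc₂.2 : c₁ ≤ c₂).lt_or_eq with h | h
        · exact h
        · exfalso
          have : x = c₁ := le_antisymm (h ▸ hc₂.2) hc₁.2
          exact hx (this ▸ hc₁.1)
      set t := (x - c₁) / (c₂ - c₁) with ht
      have hpos : 0 < c₂ - c₁ := sub_pos.2 h12
      have ht0 : 0 ≤ t := div_nonneg (sub_nonneg.2 hc₁.2) hpos.le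
      have ht1 : t ≤ 1 := (div_le_one hpos).2 (by linarith [hc₂.2.out])
      have hxt : x = (1 - t) * c₁ + t * c₂ := by
        have : t * (c₂ - c₁) = x - c₁ := div_mul_cancel₀ _ hpos.ne'
        linarith
      have hi₁ := h c₁ hc₁.1
      have hi₂ := h c₂ hc₂.1
      -- The points `c₁ < x < c₂` bound a component of the complement of `K`. No mass lies inside,
      -- so `log |· - y|` is concave there for almost every `y`, and so is the potential.
      have hle : (1 - t) * pot σ c₁ + t * pot σ c₂ ≤ pot σ x := by
        unfold pot
        rw [← integral_const_mul, ← integral_const_mul,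
          ← integral_add (hi₁.1.const_mul _) (hi₂.1.const_mul _)]
        refine integral_mono_ae ((hi₁.1.const_mul _).add (hi₂.1.const_mul _)) hi ?_
        filter_upwards [hσ, hnull c₁, hnull c₂] with y hy h1 h2
        have hy' : y < c₁ ∨ c₂ < y := by
          rcases le_total y x with hyx | hyx
          · exact Or.inl (lt_of_le_of_ne (hmax ⟨hy, hyx⟩) h1)
          · exact Or.inr (lt_of_le_of_ne (hmin ⟨hy, hyx⟩) h2.symm)
        have := log_abs_concave ht0 ht1 h12.le hy'
        rwa [← hxt] at this
      nlinarith [hi₁.2, hi₂.2]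
    -- To the right of all of `K` every distance exceeds the one from `c₁`, so the potential exceeds
    -- its value at `c₁`.
    · refine (h c₁ hc₁.1).2.trans ?_
      refine integral_mono_ae (h c₁ hc₁.1).1 hi ?_
      filter_upwards [hσ, hnull c₁] with y hy h1
      have hyx : y ≤ x := by
        by_contra h'
        exact hR ⟨y, hy, (not_le.1 h').le⟩
      have hy1 : y < c₁ := lt_of_le_of_ne (hmax ⟨hy, hyx⟩) h1
      have hc₁x : c₁ ≤ x := hc₁.2
      refine Real.log_le_log (abs_pos.2 (by intro h0; linarith)) ?_
      rw [abs_of_pos (by linarith), abs_of_nonneg (by linarith)]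
      linarith
  · obtain ⟨c₂, hc₂, hmin⟩ := hK.exists_isLeast hne
    have hall : ∀ y ∈ K, x < y := fun y hy => by
      by_contra h'
      exact hL ⟨y, hy, not_lt.1 h'⟩
    refine (h c₂ hc₂).2.trans ?_
    refine integral_mono_ae (h c₂ hc₂).1 hi ?_
    filter_upwards [hσ, hnull c₂] with y hy h1
    have hy1 : c₂ < y := lt_of_le_of_ne (hmin hy) h1.symm
    have hc₂x := hall c₂ hc₂
    refine Real.log_le_log (abs_pos.2 (by intro h0; linarith)) ?_
    rw [abs_of_neg (by linarith), abs_of_neg (by linarith)]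
    linarith

/-- The set where a potential is at least `c` is closed. -/
theorem isClosed_setOf_le_pot [NullSingletonClass σ] {T c : ℝ} (hT : 1 ≤ T) {K : Set ℝ} (hK : IsClosed K)
    (hbd : ∀ x ∈ K, ∀ᵐ y ∂σ, |x - y| ≤ T) :
    IsClosed {x | x ∈ K ∧ Integrable (fun y => Real.log |x - y|) σ ∧ c ≤ pot σ x} := by
  refine IsSeqClosed.isClosed fun u x hu hux => ?_
  have hxK : x ∈ K := hK.mem_of_tendsto hux (Eventually.of_forall fun n => (hu n).1)
  have hnn : ∀ z ∈ K, ∀ᵐ y ∂σ, 0 ≤ Real.log T - Real.log |z - y| := fun z hz => by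
    filter_upwards [hbd z hz] with y hy
    exact sub_nonneg.2 (log_abs_le hT hy)
  have hP : ∀ n, ∫⁻ y, ENNReal.ofReal (Real.log T - Real.log |u n - y|) ∂σ ≤
      ENNReal.ofReal (Real.log T * σ.real univ - c) := fun n => by
    have hint : Integrable (fun y => Real.log T - Real.log |u n - y|) σ :=
      (integrable_const _).sub (hu n).2.1
    rw [← ofReal_integral_eq_lintegral_ofReal hint (hnn _ (hu n).1)]
    refine ENNReal.ofReal_le_ofReal ?_
    rw [integral_sub (integrable_const _) (hu n).2.1, integral_const, smul_eq_mul]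
    have := (hu n).2.2
    unfold pot at this
    linarith
  -- Fatou's lemma for the nonnegative functions `log T - log |u n - y|`: the potential is upper
  -- semicontinuous. The same bound yields integrability at the limit point.
  have hx : ∫⁻ y, ENNReal.ofReal (Real.log T - Real.log |x - y|) ∂σ ≤
      ENNReal.ofReal (Real.log T * σ.real univ - c) := by
    calc ∫⁻ y, ENNReal.ofReal (Real.log T - Real.log |x - y|) ∂σ
        = ∫⁻ y, liminf (fun n => ENNReal.ofReal (Real.log T - Real.log |u n - y|)) atTop ∂σ := by
          refine lintegral_congr_ae ?_
          filter_upwards [measure_eq_zero_iff_ae_notMem.1 (measure_singleton (μ := σ) x)] with y hy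
          have hne : |x - y| ≠ 0 := abs_ne_zero.2 (sub_ne_zero.2 fun h => hy h.symm)
          have h1 : Tendsto (fun n => Real.log |u n - y|) atTop (𝓝 (Real.log |x - y|)) :=
            ((hux.sub_const y).abs).log hne
          exact ((ENNReal.tendsto_ofReal (h1.const_sub _)).liminf_eq).symm
      _ ≤ liminf (fun n => ∫⁻ y, ENNReal.ofReal (Real.log T - Real.log |u n - y|) ∂σ) atTop :=
          lintegral_liminf_le fun n =>
            (measurable_const.sub (measurable_log_abs_sub_left (u n))).ennreal_ofReal
      _ ≤ _ := by
          refine (liminf_le_liminf (Eventually.of_forall hP)).trans ?_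
          rw [liminf_const]
  have hm : AEStronglyMeasurable (fun y => Real.log T - Real.log |x - y|) σ :=
    (measurable_const.sub (measurable_log_abs_sub_left x)).aestronglyMeasurable
  have hint : Integrable (fun y => Real.log T - Real.log |x - y|) σ :=
    ⟨hm, by
      rw [hasFiniteIntegral_iff_ofReal (hnn x hxK)]
      exact hx.trans_lt ENNReal.ofReal_lt_top⟩
  have hi : Integrable (fun y => Real.log |x - y|) σ := by
    refine ((integrable_const (Real.log T)).sub hint).congr (Eventually.of_forall fun y => ?_)
    exact sub_sub_cancel _ _
  refine ⟨hxK, hi, ?_⟩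
  rw [← ofReal_integral_eq_lintegral_ofReal hint (hnn x hxK)] at hx
  have hcu : 0 ≤ Real.log T * σ.real univ - c := by
    have h1 := pot_le hT (hbd _ (hu 0).1)
    have h2 := (hu 0).2.2
    linarith
  have h1 := (ENNReal.ofReal_le_ofReal_iff hcu).1 hx
  rw [integral_sub (integrable_const _) hi, integral_const, smul_eq_mul] at h1
  unfold pot
  linarith

end MinimumPrinciple

theorem lt_integral_of_ae_lt {α : Type*} [MeasurableSpace α] {τ : Measure α} [IsProbabilityMeasure τ]
    {f : α → ℝ} {c : ℝ} (hf : Integrable f τ) (h : ∀ᵐ x ∂τ, c < f x) : c < ∫ x, f x ∂τ := by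
  by_contra hle
  have h1 : ∫ x, (f x - c) ∂τ ≤ 0 := by
    rw [integral_sub hf (integrable_const _), integral_const, probReal_univ, one_smul]
    linarith
  have hnn : 0 ≤ᵐ[τ] fun x => f x - c := h.mono fun x hx => (sub_pos.2 hx).le
  have h2 := (integral_eq_zero_iff_of_nonneg_ae hnn (hf.sub (integrable_const _))).1
    (le_antisymm h1 (integral_nonneg_of_ae hnn))
  obtain ⟨x, hx1, hx2⟩ := (h.and h2).exists
  have : f x - c = 0 := hx2
  linarith

/-! ### Frostman's theorem for the equilibrium measure -/

section Equilibrium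

variable {S : Set ℝ} {μ : Measure ℝ}

theorem logEnergy_eq_mutualEnergy [IsFiniteMeasure μ] [NullSingletonClass μ]
    (h : LogIntegrable μ μ) : logEnergy μ = (mutualEnergy μ μ : EReal) := by
  refine extIntegral_logAbs_eq ?_ h
  refine (Measure.ae_prod_iff_ae_ae ?_).2 (Eventually.of_forall fun x => ?_)
  · exact (measurableSet_eq_fun (measurable_fst.sub measurable_snd) measurable_const).compl
  · filter_upwards [measure_eq_zero_iff_ae_notMem.1 (measure_singleton (μ := μ) x)] with y hy h
    exact hy (sub_eq_zero.1 h).symm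

theorem logIntegrable_of_logEnergy_ne_bot [IsFiniteMeasure μ] {T : ℝ} (hT : 1 ≤ T)
    (hbd : ∀ᵐ x ∂μ, ∀ᵐ y ∂μ, |x - y| ≤ T) (h : logEnergy μ ≠ ⊥) :
    (∀ᵐ z ∂(μ.prod μ), z.1 - z.2 ≠ 0) ∧ LogIntegrable μ μ := by
  refine ae_ne_zero_and_integrable_log_of_extIntegral_ne_bot
    (f := fun z : ℝ × ℝ => z.1 - z.2) (by fun_prop) ?_ h
  have hb : ∀ᵐ z ∂(μ.prod μ), |z.1 - z.2| ≤ T :=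
    (Measure.ae_prod_iff_ae_ae (measurableSet_le (by fun_prop) measurable_const)).2 hbd
  refine ne_top_of_le_ne_top (b := ∫⁻ _, ENNReal.ofReal (Real.log T) ∂(μ.prod μ)) ?_ ?_
  · rw [lintegral_const]
    exact ENNReal.mul_ne_top ENNReal.ofReal_ne_top (measure_ne_top _ _)
  · refine lintegral_mono_ae ?_
    filter_upwards [hb] with z hz
    exact ENNReal.ofReal_le_ofReal (log_abs_le hT hz)

theorem abs_sub_le_of_mem_Icc {T x y : ℝ} (hx : x ∈ Icc 0 T) (hy : y ∈ Icc 0 T) : |x - y| ≤ T :=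
  abs_le.2 ⟨by linarith [hx.1, hy.2], by linarith [hx.2, hy.1]⟩

theorem ae_ae_abs_sub_le {T : ℝ} {ν : Measure ℝ} (hμ : ∀ᵐ x ∂μ, x ∈ Icc 0 T)
    (hν : ∀ᵐ x ∂ν, x ∈ Icc 0 T) : ∀ᵐ x ∂μ, ∀ᵐ y ∂ν, |x - y| ≤ T := by
  filter_upwards [hμ] with x hx
  filter_upwards [hν] with y hy
  exact abs_sub_le_of_mem_Icc hx hy

/-- The variational inequality for the equilibrium measure. -/
theorem mutualEnergy_le_of_isEquilibriumMeasure
    (h : IsEquilibriumMeasure S μ) [NullSingletonClass μ] (hμ : LogIntegrable μ μ)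
    {τ : Measure ℝ} [IsProbabilityMeasure τ] [NullSingletonClass τ] (hτS : τ Sᶜ = 0)
    (hτ : LogIntegrable τ τ) (hμτ : LogIntegrable μ τ) :
    mutualEnergy μ τ ≤ mutualEnergy μ μ := by
  have := h.isProbability
  by_contra hlt
  rw [not_le] at hlt
  -- Compare the energy of `(1 - t) μ + t τ` with the maximum `I(μ)`, expand and divide by `t`; the
  -- limit `t → 0` gives the first-order condition.
  have key : ∀ t : ℝ, 0 < t → t < 1 →
      2 * (mutualEnergy μ τ - mutualEnergy μ μ) ≤
        t * (2 * mutualEnergy μ τ - mutualEnergy μ μ - mutualEnergy τ τ) := by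
    intro t ht0 ht1
    set a : NNReal := ⟨1 - t, by linarith⟩ with ha
    set b : NNReal := ⟨t, ht0.le⟩ with hb
    have hab : a + b = 1 := NNReal.eq (sub_add_cancel 1 t)
    set ν := a • μ + b • τ with hν
    have hνp : IsProbabilityMeasure ν := by
      constructor
      simp only [hν, Measure.add_apply, Measure.smul_apply, measure_univ]
      rw [ENNReal.smul_def, ENNReal.smul_def, smul_eq_mul, smul_eq_mul, mul_one, mul_one,
        ← ENNReal.coe_add, hab, ENNReal.coe_one]
    have hνS : ν Sᶜ = 0 := by
      simp only [hν, Measure.add_apply, Measure.smul_apply, h.null_compl, hτS, smul_zero, add_zero]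
    have hνa : NullSingletonClass ν := by
      constructor
      intro x
      simp only [hν, Measure.add_apply, Measure.smul_apply, measure_singleton, smul_zero, add_zero]
    have hlog : LogIntegrable ν ν := logIntegrable_combination hμ hτ hμτ a b
    have hmax := h.energy_max ν hνp hνS
    rw [logEnergy_eq_mutualEnergy hlog, logEnergy_eq_mutualEnergy hμ, EReal.coe_le_coe_iff,
      mutualEnergy_combination hμ hτ hμτ a b] at hmax
    have e1 : (a : ℝ) = 1 - t := rfl
    have e2 : (b : ℝ) = t := rfl
    rw [e1, e2] at hmax
    have : t * (2 * (mutualEnergy μ τ - mutualEnergy μ μ) -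
        t * (2 * mutualEnergy μ τ - mutualEnergy μ μ - mutualEnergy τ τ)) ≤ 0 := by nlinarith
    have := nonpos_of_mul_nonpos_right this ht0
    linarith
  have hlim : Tendsto (fun t : ℝ => t * (2 * mutualEnergy μ τ - mutualEnergy μ μ - mutualEnergy τ τ))
      (𝓝[>] 0) (𝓝 0) := by
    have : Tendsto (fun t : ℝ => t * (2 * mutualEnergy μ τ - mutualEnergy μ μ - mutualEnergy τ τ))
        (𝓝 0) (𝓝 (0 * _)) := tendsto_id.mul_const _
    rw [zero_mul] at this
    exact this.mono_left nhdsWithin_le_nhds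
  have := ge_of_tendsto hlim (b := 2 * (mutualEnergy μ τ - mutualEnergy μ μ)) (by
    filter_upwards [Ioo_mem_nhdsGT (zero_lt_one' ℝ)] with t ht
    exact key t ht.1 ht.2)
  linarith

theorem nullSingletonClass_of_absolutelyContinuous (h : μ ≪ volume) : NullSingletonClass μ :=
  ⟨fun x => h (measure_singleton x)⟩

theorem ae_pot_le_of_isEquilibriumMeasure {T : ℝ} (hT : 1 ≤ T) (hS : IsCompact S) (hST : S ⊆ Icc 0 T)
    (h : IsEquilibriumMeasure S μ) [IsFiniteMeasure μ] [NullSingletonClass μ] (hμ : LogIntegrable μ μ) :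
    ∀ᵐ x ∂(volume.restrict S), pot μ x ≤ mutualEnergy μ μ := by
  have hk : T / 2 ≠ 0 := by positivity
  set ω := arcs (T / 2) (T / 2) with hω
  have hseg : seg (T / 2) (T / 2) = Icc 0 T := by
    rw [seg, abs_of_pos (by positivity)]
    ring_nf
  have hμT : ∀ᵐ x ∂μ, x ∈ Icc 0 T := by
    filter_upwards [measure_eq_zero_iff_ae_notMem.1 h.null_compl] with x hx
    exact hST (not_not.1 hx)
  have hωac : ω ≪ volume := absolutelyContinuous_arcs hk
  have hlogarcs : ∀ {σ : Measure ℝ} [IsFiniteMeasure σ], (∀ᵐ x ∂σ, x ∈ Icc 0 T) → LogIntegrable σ ω := by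
    intro σ _ hσ
    rw [hω, ← bal_zero]
    refine logIntegrable_bal hk (by simp) (T := T) (hσ.mono fun x hx => ?_)
    exact abs_le.2 ⟨by linarith [hx.1], hx.2⟩
  have hωT : ∀ᵐ x ∂ω, x ∈ Icc 0 T := by
    rw [← hseg]
    exact ae_arcs_mem_seg
  set B := {x | x ∈ S ∧ mutualEnergy μ μ < pot μ x} with hB
  have hBm : MeasurableSet B :=
    hS.measurableSet.inter (measurableSet_lt measurable_const (measurable_pot μ))
  -- The arcsine law of `[0, T]` restricted to `B` and normalised is a competitor with finite
  -- energies. On `B` the potential exceeds `I(μ)`, which contradicts the variational inequality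
  -- unless `B` is null for the arcsine law, hence for Lebesgue measure.
  have hωB : ω B = 0 := by
    by_contra hpos
    set c : NNReal := (ω B).toNNReal⁻¹ with hc
    have hBne : (ω B).toNNReal ≠ 0 := by
      rw [Ne, ENNReal.toNNReal_eq_zero_iff, not_or]
      exact ⟨hpos, measure_ne_top _ _⟩
    set τ := c • ω.restrict B with hτ
    have hτp : IsProbabilityMeasure τ := by
      constructor
      rw [hτ, Measure.smul_apply, Measure.restrict_apply_univ, ENNReal.smul_def, smul_eq_mul, hc,
        ENNReal.coe_inv hBne, ENNReal.coe_toNNReal (measure_ne_top _ _)]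
      exact ENNReal.inv_mul_cancel hpos (measure_ne_top _ _)
    have hτac : τ ≪ ω :=
      Measure.AbsolutelyContinuous.trans (Measure.smul_absolutelyContinuous)
        (Measure.absolutelyContinuous_of_le Measure.restrict_le_self)
    have hτB : ∀ᵐ x ∂τ, x ∈ B :=
      Measure.smul_absolutelyContinuous.ae_le (ae_restrict_mem hBm)
    have hτS : τ Sᶜ = 0 := measure_eq_zero_iff_ae_notMem.2 (hτB.mono fun x hx h => h hx.1)
    have : NullSingletonClass τ := nullSingletonClass_of_absolutelyContinuous (hτac.trans hωac)
    have hωω : LogIntegrable (ω.restrict B) (ω.restrict B) :=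
      (hlogarcs hωT).mono Measure.restrict_le_self Measure.restrict_le_self
    have hττ : LogIntegrable τ τ := (hωω.smul_left c).smul_right c
    have hμτ : LogIntegrable μ τ :=
      ((hlogarcs hμT).mono le_rfl Measure.restrict_le_self).smul_right c
    have hle := mutualEnergy_le_of_isEquilibriumMeasure h hμ hτS hττ hμτ
    rw [mutualEnergy_comm, mutualEnergy_eq_integral_pot hμτ.symm] at hle
    have hlt := lt_integral_of_ae_lt hμτ.symm.integrable_pot (hτB.mono fun x hx => hx.2)
    exact absurd hle (not_le.2 hlt)
  have hvol : volume.restrict (Icc 0 T) B = 0 := by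
    rw [← hseg]
    exact absolutelyContinuous_restrict_seg hk hωB
  rw [ae_restrict_iff' hS.measurableSet]
  have hB0 : volume B = 0 := by
    rwa [Measure.restrict_apply hBm, inter_eq_left.2 fun x hx => hST hx.1] at hvol
  filter_upwards [measure_eq_zero_iff_ae_notMem.1 hB0] with x hx hxS
  exact not_lt.1 fun h => hx ⟨hxS, h⟩

/-- The potential of an absolutely continuous equilibrium measure is at least the energy. -/
theorem le_pot_of_isEquilibriumMeasure {T : ℝ} (hT : 1 ≤ T) (hS : IsCompact S) (hST : S ⊆ Icc 0 T)
    (h : IsEquilibriumMeasure S μ) [IsFiniteMeasure μ] (hac : μ ≪ volume) (hμ : LogIntegrable μ μ)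
    (x : ℝ) : Integrable (fun y => Real.log |x - y|) μ ∧ mutualEnergy μ μ ≤ pot μ x := by
  have := h.isProbability
  have := nullSingletonClass_of_absolutelyContinuous hac
  have hμS : ∀ᵐ x ∂μ, x ∈ S :=
    (measure_eq_zero_iff_ae_notMem.1 h.null_compl).mono fun x hx => not_not.1 hx
  have hle : ∀ᵐ x ∂μ, pot μ x ≤ mutualEnergy μ μ := by
    have h1 := (ae_restrict_iff' hS.measurableSet).1 (ae_pot_le_of_isEquilibriumMeasure hT hS hST h hμ)
    filter_upwards [hac.ae_le h1, hμS] with x h2 h3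
    exact h2 h3
  -- The potential is at most `I(μ)` almost everywhere for `μ` and has mean `I(μ)`, so equality
  -- holds almost everywhere. The closed set where it is at least `I(μ)` therefore carries `μ`, and
  -- the minimum principle applies to that set.
  have heq : ∀ᵐ x ∂μ, mutualEnergy μ μ = pot μ x := by
    have h0 : ∫ x, (mutualEnergy μ μ - pot μ x) ∂μ = 0 := by
      rw [integral_sub (integrable_const _) hμ.integrable_pot, integral_const, probReal_univ,
        one_smul, ← mutualEnergy_eq_integral_pot hμ, sub_self]
    have hnn : 0 ≤ᵐ[μ] fun x => mutualEnergy μ μ - pot μ x := hle.mono fun x hx => sub_nonneg.2 hx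
    have h1 := (integral_eq_zero_iff_of_nonneg_ae hnn
      ((integrable_const _).sub hμ.integrable_pot)).1 h0
    exact h1.mono fun x hx => sub_eq_zero.1 hx
  set K := {x | x ∈ S ∧ Integrable (fun y => Real.log |x - y|) μ ∧ mutualEnergy μ μ ≤ pot μ x}
    with hK
  have hKc : IsClosed K := isClosed_setOf_le_pot hT hS.isClosed fun x hx => by
    filter_upwards [hμS] with y hy
    exact abs_sub_le_of_mem_Icc (hST hx) (hST hy)
  have hKcomp : IsCompact K := hS.of_isClosed_subset hKc fun x hx => hx.1
  have hμK : ∀ᵐ x ∂μ, x ∈ K := by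
    filter_upwards [hμS, hμ.ae_integrable, heq] with x h1 h2 h3
    exact ⟨h1, h2, h3.le⟩
  exact le_pot_of_le_pot_on hKcomp hμK.exists hμK (fun x hx => hx.2) x

theorem ae_pot_eq_of_isEquilibriumMeasure {T : ℝ} (hT : 1 ≤ T) (hS : IsCompact S) (hST : S ⊆ Icc 0 T)
    (h : IsEquilibriumMeasure S μ) [IsFiniteMeasure μ] (hac : μ ≪ volume) (hμ : LogIntegrable μ μ) :
    ∀ᵐ x ∂(volume.restrict S), pot μ x = mutualEnergy μ μ := by
  have := nullSingletonClass_of_absolutelyContinuous hac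
  filter_upwards [ae_pot_le_of_isEquilibriumMeasure hT hS hST h hμ] with x hx
  exact le_antisymm hx (le_pot_of_isEquilibriumMeasure hT hS hST h hac hμ x).2

end Equilibrium

/-! ### The disc parameter of an exterior point -/

section PoissonParameter

/-- The point `q` of the unit disc with `t = m + k (q + q⁻¹) / 2`. -/
noncomputable def diskPoint (m k t : ℝ) : ℝ :=
  (t - m) / k - SignType.sign ((t - m) / k) * √(((t - m) / k) ^ 2 - 1)

variable {m k t : ℝ}

theorem measurable_diskPoint (m k : ℝ) : Measurable (diskPoint m k) := by
  have : Measurable fun t : ℝ => ((SignType.sign ((t - m) / k) : SignType) : ℝ) := by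
    have h : (fun t : ℝ => ((SignType.sign ((t - m) / k) : SignType) : ℝ)) = fun t =>
        if 0 < (t - m) / k then 1 else if (t - m) / k < 0 then -1 else 0 := by
      ext t
      rcases lt_trichotomy ((t - m) / k) 0 with h | h | h
      · simp [h, h.not_gt]
      · simp [h]
      · simp [h]
    rw [h]
    exact Measurable.ite (measurableSet_lt measurable_const (by fun_prop)) measurable_const
      (Measurable.ite (measurableSet_lt (by fun_prop) measurable_const) measurable_const
        measurable_const)
  unfold diskPoint
  fun_prop

theorem one_lt_abs_of_notMem_seg (hk : k ≠ 0) (ht : t ∉ seg m k) : 1 < |(t - m) / k| := by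
  rw [abs_div, one_lt_div (abs_pos.2 hk)]
  by_contra h
  have := abs_le.1 (not_lt.1 h)
  exact ht ⟨by linarith, by linarith⟩

/-- With `u = (t - m)/k` the two parameters `u ± √(u² - 1)` are inverse to each other. The sign
selects the smaller one, whose modulus is `1 / (|u| + √(u² - 1)) ≤ 1 / |u|`. -/
theorem diskPoint_spec (hk : k ≠ 0) (ht : t ∉ seg m k) :
    diskPoint m k t ≠ 0 ∧ |diskPoint m k t| < 1 ∧ |diskPoint m k t| ≤ |(t - m) / k|⁻¹ ∧
      t = m + k / 2 * (diskPoint m k t + (diskPoint m k t)⁻¹) := by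
  have h1 := one_lt_abs_of_notMem_seg hk ht
  set u := (t - m) / k with hu
  set s : ℝ := ((SignType.sign u : SignType) : ℝ) with hs
  have hss : s * s = 1 := by
    have : u ≠ 0 := fun h0 => by rw [h0, abs_zero] at h1; linarith
    rcases lt_or_gt_of_ne this with h | h
    · simp [hs, h]
    · simp [hs, h]
  have hsu : s * u = |u| := sign_mul_self u
  have hr : 0 ≤ u ^ 2 - 1 := by
    rw [← sq_abs]
    nlinarith
  set r := √(u ^ 2 - 1) with hrdef
  have hr2 : r * r = u ^ 2 - 1 := Real.mul_self_sqrt hr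
  have hr0 : 0 ≤ r := Real.sqrt_nonneg _
  have hq : diskPoint m k t = u - s * r := rfl
  have hmul : (u - s * r) * (u + s * r) = 1 := by
    have : (u - s * r) * (u + s * r) = u ^ 2 - (s * s) * (r * r) := by ring
    rw [this, hss, hr2]
    ring
  have hne : u - s * r ≠ 0 := left_ne_zero_of_mul_eq_one hmul
  have hinv : (u - s * r)⁻¹ = u + s * r := inv_eq_of_mul_eq_one_right hmul
  have habs : |u + s * r| = |u| + r := by
    have : u + s * r = s * (|u| + r) := by
      rw [mul_add, ← hsu, ← mul_assoc, hss, one_mul]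
    have hs1 : |s| = 1 := by
      have := abs_mul_abs_self s
      rw [hss] at this
      nlinarith [abs_nonneg s]
    rw [this, abs_mul, hs1, one_mul, abs_of_nonneg (by positivity)]
  have habsq : |u - s * r| = (|u| + r)⁻¹ := by
    rw [← habs, ← abs_inv, ← hinv, inv_inv]
  refine ⟨by rwa [hq], ?_, ?_, ?_⟩
  · rw [hq, habsq]
    exact inv_lt_one_of_one_lt₀ (by linarith)
  · rw [hq, habsq]
    exact inv_anti₀ (by linarith) (by linarith)
  · rw [hq, hinv]
    have : u * k = t - m := div_mul_cancel₀ _ hk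
    linarith

/-- For a point `x` of the segment, the potential of the Poisson measure of an exterior point `t`
is `log |x - t|` up to a constant. -/
theorem pot_bal_diskPoint (hk : k ≠ 0) (ht : t ∉ seg m k) {x : ℝ} (hx : x ∈ seg m k) :
    pot (bal m k (diskPoint m k t)) x = Real.log |x - t| + Real.log |diskPoint m k t| := by
  obtain ⟨hq0, hq1, -, hqt⟩ := diskPoint_spec hk ht
  set q := diskPoint m k t with hq
  obtain ⟨φ, -, hφ⟩ := exists_cos_eq_of_mem_seg hk hx
  set ζ : ℂ := circleMap 0 1 φ with hζ
  have hζ1 : ‖ζ‖ = 1 := by simp [hζ]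
  have hζ0 : ζ ≠ 0 := fun h => by rw [h, norm_zero] at hζ1; exact zero_ne_one hζ1
  have hconj : (starRingEnd ℂ) ζ = ζ⁻¹ := (Complex.inv_eq_conj hζ1).symm
  have hre : (ζ.re : ℂ) = (ζ + ζ⁻¹) / 2 := by
    rw [← hconj, Complex.add_conj]
    push_cast
    ring
  have hxζ : (x : ℂ) = m + k / 2 * (ζ + ζ⁻¹) := by
    have h1 : x = m + k * ζ.re := by rw [hζ, circleMap_zero_one_re, hφ]
    rw [h1]
    push_cast
    rw [hre]
    ring
  rw [pot_bal hk hq1 hζ1.ge hxζ, hζ1, Real.log_one]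
  have hqc : (q : ℂ) ≠ 0 := Complex.ofReal_ne_zero.2 hq0
  have hfac : (x : ℂ) - (t : ℂ) = (k / 2) * (ζ - q) * (q - ζ⁻¹) * (q : ℂ)⁻¹ := by
    rw [hxζ, hqt]
    push_cast
    field_simp
    ring
  have hn1 : ‖ζ - q‖ = ‖(q : ℂ) - ζ‖ := norm_sub_rev _ _
  have hn2 : ‖(q : ℂ) - ζ⁻¹‖ = ‖(q : ℂ) - ζ‖ := by
    rw [← hconj, ← Complex.norm_conj, map_sub, Complex.conj_conj, Complex.conj_ofReal]
  have hk2 : ‖(k / 2 : ℂ)‖ = |k| / 2 := by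
    rw [norm_div, Complex.norm_real, Real.norm_eq_abs]
    norm_num
  have hqζ : ‖(q : ℂ) - ζ‖ ≠ 0 := by
    rw [norm_ne_zero_iff, sub_ne_zero]
    intro h
    rw [← h, Complex.norm_real, Real.norm_eq_abs] at hζ1
    linarith
  have e1 : |k| / 2 ≠ 0 := by positivity
  have e2 : |q| ≠ 0 := abs_ne_zero.2 hq0
  have hlog : Real.log |x - t| = Real.log (|k| / 2) + 2 * Real.log ‖(q : ℂ) - ζ‖ - Real.log |q| := by
    rw [← norm_ofReal_sub, hfac, norm_mul, norm_mul, norm_mul, hk2, hn1, hn2, norm_inv,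
      Complex.norm_real, Real.norm_eq_abs,
      Real.log_mul (mul_ne_zero (mul_ne_zero e1 hqζ) hqζ) (inv_ne_zero e2),
      Real.log_mul (mul_ne_zero e1 hqζ) hqζ, Real.log_mul e1 hqζ, Real.log_inv]
    ring
  rw [hlog]
  ring

theorem pot_arcs (hk : k ≠ 0) {x : ℝ} (hx : x ∈ seg m k) : pot (arcs m k) x = Real.log (|k| / 2) := by
  obtain ⟨φ, -, hφ⟩ := exists_cos_eq_of_mem_seg hk hx
  set ζ : ℂ := circleMap 0 1 φ with hζ
  have hζ1 : ‖ζ‖ = 1 := by simp [hζ]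
  have hconj : (starRingEnd ℂ) ζ = ζ⁻¹ := (Complex.inv_eq_conj hζ1).symm
  have hre : (ζ.re : ℂ) = (ζ + ζ⁻¹) / 2 := by
    rw [← hconj, Complex.add_conj]
    push_cast
    ring
  have hxζ : (x : ℂ) = m + k / 2 * (ζ + ζ⁻¹) := by
    have h1 : x = m + k * ζ.re := by rw [hζ, circleMap_zero_one_re, hφ]
    rw [h1]
    push_cast
    rw [hre]
    ring
  rw [← bal_zero, pot_bal hk (by simp) hζ1.ge hxζ]
  simp [hζ1]

/-- The denominator of the Poisson density equals `(2q/k)(t - y)`. So the density is a positive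
multiple of `1 / |t - y|`, whose convexity in `y` is used later. -/
theorem balDensity_diskPoint (hk : k ≠ 0) (ht : t ∉ seg m k) {y : ℝ} (hy : y ∈ seg m k) :
    balDensity m k (diskPoint m k t) y =
      (1 - (diskPoint m k t) ^ 2) / |2 * diskPoint m k t / k| * |t - y|⁻¹ := by
  obtain ⟨hq0, hq1, -, hqt⟩ := diskPoint_spec hk ht
  set q := diskPoint m k t with hq
  have hden := balDensity_denom_mem (q := q) hk hy
  have hpos : 0 < 1 - 2 * q * ((y - m) / k) + q ^ 2 := by
    refine lt_of_lt_of_le ?_ hden.1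
    have : 0 < 1 - |q| := by linarith
    positivity
  have hfac : 1 - 2 * q * ((y - m) / k) + q ^ 2 = (2 * q / k) * (t - y) := by
    rw [hqt]
    field_simp
    ring
  rw [balDensity, ← abs_of_pos hpos, hfac, abs_mul, ← div_div, div_eq_mul_inv _ |t - y|]

/-- The Poisson density is strictly convex in the point of the segment. -/
theorem balDensity_lt_midpoint (hk : k ≠ 0) (ht : t ∉ seg m k) {y η : ℝ} (hη : 0 < η)
    (h1 : y - η ∈ seg m k) (h2 : y + η ∈ seg m k) :
    balDensity m k (diskPoint m k t) y <
      (balDensity m k (diskPoint m k t) (y - η) + balDensity m k (diskPoint m k t) (y + η)) / 2 := by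
  have hy : y ∈ seg m k := ⟨by linarith [h1.1], by linarith [h2.2]⟩
  rw [balDensity_diskPoint hk ht hy, balDensity_diskPoint hk ht h1, balDensity_diskPoint hk ht h2]
  obtain ⟨hq0, hq1, -, -⟩ := diskPoint_spec hk ht
  set q := diskPoint m k t with hq
  have hA : 0 < (1 - q ^ 2) / |2 * q / k| := by
    refine div_pos ?_ (abs_pos.2 (by positivity))
    rw [← sq_abs]
    nlinarith [abs_nonneg q]
  have key : ∀ a : ℝ, η < a → a⁻¹ < ((a + η)⁻¹ + (a - η)⁻¹) / 2 := by
    intro a ha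
    have h1 : 0 < a - η := sub_pos.2 ha
    have h2 : 0 < a + η := by linarith
    have h3 : 0 < a := by linarith
    have : ((a + η)⁻¹ + (a - η)⁻¹) / 2 - a⁻¹ = η ^ 2 / (a * (a + η) * (a - η)) := by
      field_simp
      ring
    have hp : 0 < η ^ 2 / (a * (a + η) * (a - η)) := by positivity
    linarith
  rw [← mul_add]
  generalize (1 - q ^ 2) / |2 * q / k| = A at *
  rw [mul_div_assoc]
  refine mul_lt_mul_of_pos_left ?_ hA
  have hcases : t < m - |k| ∨ m + |k| < t := by
    by_contra h
    rw [not_or, not_lt, not_lt] at h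
    exact ht h
  rcases hcases with h | h
  · have ha : η < y - t := by linarith [h1.1]
    have := key (y - t) ha
    rw [abs_sub_comm, abs_of_pos (by linarith : 0 < y - t), abs_sub_comm t,
      abs_of_pos (by linarith : 0 < y - η - t), abs_sub_comm t (y + η),
      abs_of_pos (by linarith : 0 < y + η - t)]
    have e1 : y - η - t = y - t - η := by ring
    have e2 : y + η - t = y - t + η := by ring
    rw [e1, e2]
    linarith
  · have ha : η < t - y := by linarith [h2.2]
    have := key (t - y) ha
    rw [abs_of_pos (by linarith : 0 < t - y), abs_of_pos (by linarith : 0 < t - (y - η)),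
      abs_of_pos (by linarith : 0 < t - (y + η))]
    have e1 : t - (y - η) = t - y + η := by ring
    have e2 : t - (y + η) = t - y - η := by ring
    rw [e1, e2]
    linarith

end PoissonParameter

/-! ### Balayage of an exterior measure onto an interval -/

section Sweeping

/-- The density with respect to the arcsine distribution of the balayage of `τ`. -/
noncomputable def sweepDensity (m k : ℝ) (τ : Measure ℝ) (y : ℝ) : ℝ :=
  ∫ t, balDensity m k (diskPoint m k t) y ∂τ

/-- The balayage on `[m - |k|, m + |k|]` of a measure carried by the complement. -/
noncomputable def sweep (m k : ℝ) (τ : Measure ℝ) : Measure ℝ :=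
  (arcs m k).withDensity fun y => ENNReal.ofReal (sweepDensity m k τ y)

variable {m k q₀ T : ℝ} {τ : Measure ℝ} [IsFiniteMeasure τ]

theorem measurable_balDensity_diskPoint (m k : ℝ) :
    Measurable fun p : ℝ × ℝ => balDensity m k (diskPoint m k p.1) p.2 := by
  have := measurable_diskPoint m k
  unfold balDensity
  fun_prop

theorem measurable_sweepDensity (m k : ℝ) (τ : Measure ℝ) [IsFiniteMeasure τ] :
    Measurable (sweepDensity m k τ) := by
  have h : StronglyMeasurable fun p : ℝ × ℝ => balDensity m k (diskPoint m k p.2) p.1 :=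
    ((measurable_balDensity_diskPoint m k).comp measurable_swap).stronglyMeasurable
  exact (StronglyMeasurable.integral_prod_right (ν := τ) (f := fun y t =>
    balDensity m k (diskPoint m k t) y) h).measurable

theorem balDensity_diskPoint_mem (hk : k ≠ 0) (hq₀ : q₀ < 1) {t y : ℝ}
    (ht : |diskPoint m k t| ≤ q₀) (hy : y ∈ seg m k) :
    balDensity m k (diskPoint m k t) y ∈ Ioc 0 ((1 + q₀) / (1 - q₀)) := by
  refine ⟨balDensity_pos hk (ht.trans_lt hq₀) hy, (balDensity_mem hk (ht.trans_lt hq₀) hy).2.trans ?_⟩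
  have h0 := abs_nonneg (diskPoint m k t)
  exact div_le_div₀ (by linarith) (by linarith) (by linarith) (by linarith)

theorem integrable_balDensity_diskPoint (hk : k ≠ 0) (hq₀ : q₀ < 1)
    (hτ : ∀ᵐ t ∂τ, |diskPoint m k t| ≤ q₀) {y : ℝ} (hy : y ∈ seg m k) :
    Integrable (fun t => balDensity m k (diskPoint m k t) y) τ := by
  refine (integrable_const ((1 + q₀) / (1 - q₀))).mono' ?_ ?_
  · exact ((measurable_balDensity_diskPoint m k).comp
      (measurable_id.prodMk measurable_const)).aestronglyMeasurable
  · filter_upwards [hτ] with t ht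
    have h := balDensity_diskPoint_mem hk hq₀ ht hy
    rw [Real.norm_of_nonneg h.1.le]
    exact h.2

theorem sweepDensity_nonneg (hk : k ≠ 0) (hq₀ : q₀ < 1)
    (hτ : ∀ᵐ t ∂τ, |diskPoint m k t| ≤ q₀) {y : ℝ} (hy : y ∈ seg m k) :
    0 ≤ sweepDensity m k τ y :=
  integral_nonneg_of_ae (hτ.mono fun _ ht => (balDensity_diskPoint_mem hk hq₀ ht hy).1.le)

theorem sweepDensity_le (hk : k ≠ 0) (hq₀ : q₀ < 1)
    (hτ : ∀ᵐ t ∂τ, |diskPoint m k t| ≤ q₀) {y : ℝ} (hy : y ∈ seg m k) :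
    sweepDensity m k τ y ≤ (1 + q₀) / (1 - q₀) * τ.real univ := by
  calc sweepDensity m k τ y ≤ ∫ _, (1 + q₀) / (1 - q₀) ∂τ :=
        integral_mono_ae (integrable_balDensity_diskPoint hk hq₀ hτ hy) (integrable_const _)
          (hτ.mono fun _ ht => (balDensity_diskPoint_mem hk hq₀ ht hy).2)
    _ = _ := by rw [integral_const, smul_eq_mul, mul_comm]

theorem integrable_balDensity_mul (hk : k ≠ 0) (hq₀ : q₀ < 1)
    (hτ : ∀ᵐ t ∂τ, |diskPoint m k t| ≤ q₀) {F : ℝ → ℝ} (hF : Integrable F (arcs m k)) :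
    Integrable (fun p : ℝ × ℝ => balDensity m k (diskPoint m k p.1) p.2 * F p.2)
      (τ.prod (arcs m k)) := by
  have hF2 : Integrable (fun p : ℝ × ℝ => F p.2) (τ.prod (arcs m k)) := hF.comp_snd τ
  refine (hF2.norm.const_mul ((1 + q₀) / (1 - q₀))).mono' ?_ ?_
  · exact ((measurable_balDensity_diskPoint m k).aestronglyMeasurable).mul hF2.aestronglyMeasurable
  · filter_upwards [Measure.quasiMeasurePreserving_fst.ae hτ,
      Measure.quasiMeasurePreserving_snd.ae (ae_arcs_mem_seg (m := m) (k := k))] with p h1 h2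
    have h := balDensity_diskPoint_mem hk hq₀ h1 h2
    rw [norm_mul, Real.norm_of_nonneg h.1.le]
    exact mul_le_mul_of_nonneg_right h.2 (norm_nonneg _)

/-- Fubini. The uniform bound `|diskPoint m k t| ≤ q₀ < 1` expresses that the mass stays away from
the interval and keeps the densities bounded. -/
theorem integral_sweep (hk : k ≠ 0) (hq₀ : q₀ < 1)
    (hτ : ∀ᵐ t ∂τ, |diskPoint m k t| ≤ q₀) {F : ℝ → ℝ} (hF : Integrable F (arcs m k)) :
    ∫ y, F y ∂(sweep m k τ) = ∫ t, ∫ y, F y ∂(bal m k (diskPoint m k t)) ∂τ := by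
  have h1 : ∫ y, F y ∂(sweep m k τ) = ∫ y, sweepDensity m k τ y * F y ∂(arcs m k) := by
    rw [sweep, integral_withDensity_eq_integral_toReal_smul
      (measurable_sweepDensity m k τ).ennreal_ofReal
      (Eventually.of_forall fun _ => ENNReal.ofReal_lt_top)]
    refine integral_congr_ae ?_
    filter_upwards [ae_arcs_mem_seg] with y hy
    rw [ENNReal.toReal_ofReal (sweepDensity_nonneg hk hq₀ hτ hy), smul_eq_mul]
  rw [h1]
  have h2 : ∫ y, sweepDensity m k τ y * F y ∂(arcs m k) =
      ∫ y, ∫ t, balDensity m k (diskPoint m k t) y * F y ∂τ ∂(arcs m k) := by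
    refine integral_congr_ae (Eventually.of_forall fun y => ?_)
    exact (integral_mul_const _ _).symm
  rw [h2, ← integral_integral_swap (integrable_balDensity_mul hk hq₀ hτ hF)]
  refine integral_congr_ae ?_
  filter_upwards [hτ] with t ht
  exact (integral_bal_eq hk (ht.trans_lt hq₀) F).symm

theorem sweep_le (hk : k ≠ 0) (hq₀ : q₀ < 1) (hτ : ∀ᵐ t ∂τ, |diskPoint m k t| ≤ q₀) :
    sweep m k τ ≤ ENNReal.ofReal ((1 + q₀) / (1 - q₀) * τ.real univ) • arcs m k := by
  rw [← withDensity_const]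
  refine withDensity_mono ?_
  filter_upwards [ae_arcs_mem_seg] with y hy
  exact ENNReal.ofReal_le_ofReal (sweepDensity_le hk hq₀ hτ hy)

theorem isFiniteMeasure_sweep (hk : k ≠ 0) (hq₀ : q₀ < 1) (hτ : ∀ᵐ t ∂τ, |diskPoint m k t| ≤ q₀) :
    IsFiniteMeasure (sweep m k τ) := by
  have : IsFiniteMeasure (ENNReal.ofReal ((1 + q₀) / (1 - q₀) * τ.real univ) • arcs m k) :=
    Measure.smul_finite _ ENNReal.ofReal_ne_top
  exact isFiniteMeasure_of_le _ (sweep_le hk hq₀ hτ)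

theorem integrable_sweep (hk : k ≠ 0) (hq₀ : q₀ < 1) (hτ : ∀ᵐ t ∂τ, |diskPoint m k t| ≤ q₀)
    {F : ℝ → ℝ} (hF : Integrable F (arcs m k)) : Integrable F (sweep m k τ) :=
  (hF.smul_measure ENNReal.ofReal_ne_top).mono_measure (sweep_le hk hq₀ hτ)

theorem sweep_univ (hk : k ≠ 0) (hq₀ : q₀ < 1) (hτ : ∀ᵐ t ∂τ, |diskPoint m k t| ≤ q₀) :
    sweep m k τ univ = τ univ := by
  have := isFiniteMeasure_sweep hk hq₀ hτ
  have h := integral_sweep hk hq₀ hτ (F := fun _ => 1) (integrable_const 1)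
  have h2 : ∫ t, ∫ _, (1 : ℝ) ∂(bal m k (diskPoint m k t)) ∂τ = ∫ _, (1 : ℝ) ∂τ :=
    integral_congr_ae (hτ.mono fun t ht => integral_bal_one hk (ht.trans_lt hq₀))
  rw [h2, integral_const, integral_const, smul_eq_mul, smul_eq_mul, mul_one, mul_one] at h
  exact (ENNReal.toReal_eq_toReal_iff' (measure_ne_top _ _) (measure_ne_top _ _)).1 h

/-- Sweeping a point mass changes its potential on the interval by a constant only, so the same
holds for the measure `τ`. -/
theorem pot_sweep (hk : k ≠ 0) (hq₀ : q₀ < 1) (hτ : ∀ᵐ t ∂τ, t ∉ seg m k ∧ |diskPoint m k t| ≤ q₀)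
    {x : ℝ} (hx : x ∈ seg m k) (hi : Integrable (fun t => Real.log |x - t|) τ)
    (hi2 : Integrable (fun t => Real.log |diskPoint m k t|) τ) :
    pot (sweep m k τ) x = pot τ x + ∫ t, Real.log |diskPoint m k t| ∂τ := by
  have hτ2 := hτ.mono fun t ht => ht.2
  rw [pot, integral_sweep hk hq₀ hτ2 (integrable_log_arcs hk x), pot, ← integral_add hi hi2]
  refine integral_congr_ae ?_
  filter_upwards [hτ] with t ht
  exact pot_bal_diskPoint hk ht.1 hx

theorem ae_sweep_mem_seg : ∀ᵐ y ∂(sweep m k τ), y ∈ seg m k :=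
  (withDensity_absolutelyContinuous _ _).ae_le ae_arcs_mem_seg

end Sweeping

/-! ### Positivity of the equilibrium density -/

section Positivity

variable {m k q₀ T I : ℝ} {μ : Measure ℝ} [IsProbabilityMeasure μ]

/-- A measure whose potential is constant on an interval is there the arcsine distribution minus
the balayage of the outer part. -/
theorem restrict_add_sweep_eq_arcs (hk : k ≠ 0) (hT : 1 ≤ T) (hseg : seg m k ⊆ Icc 0 T)
    (hac : μ ≪ volume)
    (hq₀ : q₀ < 1) (hout : ∀ᵐ t ∂μ, t ∈ seg m k ∨ |diskPoint m k t| ≤ q₀)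
    (hq : Integrable (fun t => Real.log |diskPoint m k t|) (μ.restrict (seg m k)ᶜ))
    (hpot : ∀ x, Integrable (fun y => Real.log |x - y|) μ ∧ I ≤ pot μ x)
    (heq : ∀ᵐ x ∂(volume.restrict (seg m k)), pot μ x = I) :
    μ.restrict (seg m k) + sweep m k (μ.restrict (seg m k)ᶜ) = arcs m k := by
  have hsm : MeasurableSet (seg m k) := measurableSet_Icc
  set τ := μ.restrict (seg m k)ᶜ with hτdef
  have hτ : ∀ᵐ t ∂τ, t ∉ seg m k ∧ |diskPoint m k t| ≤ q₀ := by
    filter_upwards [ae_restrict_mem hsm.compl, ae_restrict_of_ae hout] with t h1 h2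
    exact ⟨h1, h2.resolve_left h1⟩
  have hτ2 := hτ.mono fun t ht => ht.2
  have := isFiniteMeasure_sweep hk hq₀ hτ2
  set κ := μ.restrict (seg m k) + sweep m k τ with hκ
  have hsac : sweep m k τ ≪ volume :=
    (withDensity_absolutelyContinuous _ _).trans (absolutelyContinuous_arcs hk)
  have hκac : κ ≪ volume := by
    refine Measure.AbsolutelyContinuous.mk fun N _ hN0 => ?_
    have h1 : μ.restrict (seg m k) N = 0 :=
      (Measure.absolutelyContinuous_of_le Measure.restrict_le_self).trans hac hN0
    rw [hκ, Measure.add_apply, hsac hN0, h1, add_zero]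
  have hκseg : ∀ᵐ x ∂κ, x ∈ seg m k := by
    rw [hκ, ae_add_measure_iff]
    exact ⟨ae_restrict_mem hsm, ae_sweep_mem_seg⟩
  have hκmass : κ univ = arcs m k univ := by
    rw [hκ, Measure.add_apply, sweep_univ hk hq₀ hτ2, hτdef,
      Measure.restrict_apply_univ, Measure.restrict_apply_univ, measure_add_measure_compl hsm,
      measure_univ, measure_univ]
  have : NullSingletonClass κ := nullSingletonClass_of_absolutelyContinuous hκac
  have : NullSingletonClass (arcs m k) :=
    nullSingletonClass_of_absolutelyContinuous (absolutelyContinuous_arcs hk)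
  set Λ := ∫ t, Real.log |diskPoint m k t| ∂τ with hΛ
  have hpotκ : ∀ x ∈ seg m k, Integrable (fun y => Real.log |x - y|) κ ∧ pot κ x = pot μ x + Λ := by
    intro x hx
    have i0 := (hpot x).1
    have i1 : Integrable (fun y => Real.log |x - y|) (μ.restrict (seg m k)) := i0.integrableOn
    have i2 : Integrable (fun y => Real.log |x - y|) τ := i0.integrableOn
    have i3 := integrable_sweep hk hq₀ hτ2 (integrable_log_arcs (m := m) hk x)
    refine ⟨i1.add_measure i3, ?_⟩
    have h1 : pot κ x = pot (μ.restrict (seg m k)) x + pot (sweep m k τ) x :=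
      integral_add_measure i1 i3
    have h2 : pot μ x = pot (μ.restrict (seg m k)) x + pot τ x :=
      (integral_add_compl hsm i0).symm
    rw [h1, pot_sweep hk hq₀ hτ hx i2 hq, h2]
    ring
  have hbd : ∀ᵐ x ∂κ, ∀ᵐ y ∂κ, |x - y| ≤ T :=
    ae_ae_abs_sub_le (hκseg.mono fun x hx => hseg hx) (hκseg.mono fun x hx => hseg hx)
  have hκκ : LogIntegrable κ κ := by
    refine logIntegrable_of_le_pot (c := I + Λ) hT hbd (hκseg.mono fun x hx => ⟨(hpotκ x hx).1, ?_⟩)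
    rw [(hpotκ x hx).2]
    linarith [(hpot x).2]
  have hlogarcs : ∀ {σ : Measure ℝ} [IsFiniteMeasure σ], (∀ᵐ x ∂σ, x ∈ seg m k) →
      LogIntegrable σ (arcs m k) := by
    intro σ _ hσ
    rw [← bal_zero]
    refine logIntegrable_bal hk (by simp) (T := T) (hσ.mono fun x hx => ?_)
    have := hseg hx
    exact abs_le.2 ⟨by linarith [this.1], this.2⟩
  have hκa := hlogarcs hκseg
  have haa := hlogarcs (ae_arcs_mem_seg (m := m) (k := k))
  have hκpot : ∀ {σ : Measure ℝ} [IsFiniteMeasure σ], σ ≪ volume → (∀ᵐ x ∂σ, x ∈ seg m k) →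
      ∀ᵐ x ∂σ, pot κ x = I + Λ := by
    intro σ _ hσ1 hσ2
    filter_upwards [hσ1.ae_le ((ae_restrict_iff' hsm).1 heq), hσ2] with x h1 h2
    rw [(hpotκ x h2).2, h1 h2]
  have hconst : ∀ {σ : Measure ℝ} [IsFiniteMeasure σ] {f : ℝ → ℝ} {c : ℝ}, (∀ᵐ x ∂σ, f x = c) →
      ∫ x, f x ∂σ = c * σ.real univ := by
    intro σ _ f c h
    rw [integral_congr_ae h, integral_const, smul_eq_mul, mul_comm]
  have hκ1 : κ.real univ = 1 := by
    rw [Measure.real, hκmass, measure_univ, ENNReal.toReal_one]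
  -- Both `κ` and the arcsine law have constant potentials, almost everywhere for Lebesgue measure
  -- on the interval. Their mutual energy, computed from either potential, gives `I + Λ = log
  -- (|k|/2)`; so the energy of the difference is 0 and the two measures coincide.
  have e1 : mutualEnergy κ κ = I + Λ := by
    rw [mutualEnergy_eq_integral_pot hκκ, hconst (hκpot hκac hκseg), hκ1, mul_one]
  have e2 : mutualEnergy (arcs m k) (arcs m k) = Real.log (|k| / 2) := by
    rw [mutualEnergy_eq_integral_pot haa, hconst (ae_arcs_mem_seg.mono fun x hx => pot_arcs hk hx),
      probReal_univ, mul_one]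
  have e3 : mutualEnergy κ (arcs m k) = Real.log (|k| / 2) := by
    rw [mutualEnergy_eq_integral_pot hκa, hconst (hκseg.mono fun x hx => pot_arcs hk hx), hκ1,
      mul_one]
  have e4 : mutualEnergy κ (arcs m k) = I + Λ := by
    rw [mutualEnergy_comm, mutualEnergy_eq_integral_pot hκa.symm,
      hconst (hκpot (absolutelyContinuous_arcs hk) ae_arcs_mem_seg), probReal_univ, mul_one]
  refine eq_of_energyDiff_eq_zero (D := T) (S := Icc 0 T) (by linarith)
    (hκseg.mono fun x hx => hseg hx) (ae_arcs_mem_seg.mono fun x hx => hseg hx)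
    (fun x hx y hy => abs_sub_le_of_mem_Icc hx hy) hκmass hκκ haa hκa ?_
  have : energyDiff κ (arcs m k) =
      mutualEnergy κ κ + mutualEnergy (arcs m k) (arcs m k) - 2 * mutualEnergy κ (arcs m k) := rfl
  rw [this, e1, e2]
  linarith

/-- Under the same assumptions, Lebesgue measure on the interval is absolutely continuous. -/
theorem volume_eq_zero_of_measure_eq_zero (hk : k ≠ 0)
    (hq₀ : q₀ < 1) (hout : ∀ᵐ t ∂μ, t ∈ seg m k ∨ |diskPoint m k t| ≤ q₀)
    (hsum : μ.restrict (seg m k) + sweep m k (μ.restrict (seg m k)ᶜ) = arcs m k)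
    {B : Set ℝ} (hB : MeasurableSet B) (hBs : B ⊆ seg m k) (hμB : μ B = 0) : volume B = 0 := by
  have hsm : MeasurableSet (seg m k) := measurableSet_Icc
  set τ := μ.restrict (seg m k)ᶜ with hτdef
  have hτ : ∀ᵐ t ∂τ, t ∉ seg m k ∧ |diskPoint m k t| ≤ q₀ := by
    filter_upwards [ae_restrict_mem hsm.compl, ae_restrict_of_ae hout] with t h1 h2
    exact ⟨h1, h2.resolve_left h1⟩
  have hτ2 := hτ.mono fun t ht => ht.2
  set w := sweepDensity m k τ with hw
  have hwm : Measurable w := measurable_sweepDensity m k τ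
  have hle : sweep m k τ ≤ arcs m k := by
    rw [← hsum]
    exact Measure.le_add_left le_rfl
  have hw1 : ∀ᵐ y ∂(arcs m k), w y ≤ 1 := by
    have h : ∀ᵐ y ∂(arcs m k), ENNReal.ofReal (w y) ≤ 1 := by
      refine ae_le_of_forall_setLIntegral_le_of_sigmaFinite hwm.ennreal_ofReal fun s hs _ => ?_
      rw [← withDensity_apply _ hs, setLIntegral_const, one_mul]
      exact hle s
    exact h.mono fun y hy => ENNReal.ofReal_le_one.1 hy
  have hw1v : ∀ᵐ y : ℝ, y ∈ seg m k → w y ≤ 1 :=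
    (ae_restrict_iff' hsm).1 ((absolutelyContinuous_restrict_seg hk).ae_le hw1)
  -- The bound `w ≤ 1` is known almost everywhere, hence at `y ± η` for some small `η`. Strict
  -- midpoint convexity of `w` makes it strict at `y` itself; when there is no outer mass, `w = 0`.
  have hlt : ∀ y ∈ Ioo (m - |k|) (m + |k|), w y < 1 := by
    intro y hy
    by_cases hτ0 : τ = 0
    · have : w y = 0 := by simp [hw, sweepDensity, hτ0]
      rw [this]
      exact one_pos
    set h := min (y - (m - |k|)) (m + |k| - y) with hh
    have hh0 : 0 < h := lt_min (by linarith [hy.1]) (by linarith [hy.2])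
    have hp : ∀ᵐ η : ℝ, y + η ∈ seg m k → w (y + η) ≤ 1 :=
      (measurePreserving_add_left volume y).quasiMeasurePreserving.ae hw1v
    have hn : ∀ᵐ η : ℝ, y - η ∈ seg m k → w (y - η) ≤ 1 :=
      (Measure.measurePreserving_sub_left volume y).quasiMeasurePreserving.ae hw1v
    have hne : (ae (volume.restrict (Ioo 0 h))).NeBot := by
      rw [ae_neBot]
      intro h0
      have := congrArg (fun m => m univ) h0
      simp only [Measure.restrict_apply_univ, Real.volume_Ioo, Measure.coe_zero, Pi.zero_apply,
        ENNReal.ofReal_eq_zero] at this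
      linarith
    obtain ⟨η, hη, hη1, hη2⟩ := ((ae_restrict_mem (μ := volume) measurableSet_Ioo).and
      ((ae_restrict_of_ae hp).and (ae_restrict_of_ae (s := Ioo 0 h) hn))).exists
    have hηl : η < y - (m - |k|) := hη.2.trans_le (min_le_left _ _)
    have hηr : η < m + |k| - y := hη.2.trans_le (min_le_right _ _)
    have hys : y ∈ seg m k := Ioo_subset_Icc_self hy
    have hyp : y + η ∈ seg m k := ⟨by linarith [hy.1, hη.1], by linarith⟩
    have hyn : y - η ∈ seg m k := ⟨by linarith, by linarith [hy.2, hη.1]⟩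
    have i0 := integrable_balDensity_diskPoint hk hq₀ hτ2 hys
    have i1 := integrable_balDensity_diskPoint hk hq₀ hτ2 hyp
    have i2 := integrable_balDensity_diskPoint hk hq₀ hτ2 hyn
    have hpos : 0 < ∫ t, ((balDensity m k (diskPoint m k t) (y - η) +
        balDensity m k (diskPoint m k t) (y + η)) / 2 - balDensity m k (diskPoint m k t) y) ∂τ := by
      have hae : ∀ᵐ t ∂τ, 0 < (balDensity m k (diskPoint m k t) (y - η) +
          balDensity m k (diskPoint m k t) (y + η)) / 2 - balDensity m k (diskPoint m k t) y :=
        hτ.mono fun t ht => sub_pos.2 (balDensity_lt_midpoint hk ht.1 hη.1 hyn hyp)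
      have hint := ((i2.add i1).div_const 2).sub i0
      refine lt_of_le_of_ne (integral_nonneg_of_ae (hae.mono fun t ht => ht.le)) fun h0 => ?_
      have h1 := (integral_eq_zero_iff_of_nonneg_ae (hae.mono fun t ht => ht.le) hint).1 h0.symm
      have : (ae τ).NeBot := ae_neBot.2 hτ0
      obtain ⟨t, ht1, ht2⟩ := (hae.and h1).exists
      exact ht1.ne' ht2
    have i3 : Integrable (fun t => (balDensity m k (diskPoint m k t) (y - η) +
        balDensity m k (diskPoint m k t) (y + η)) / 2) τ := (i2.add i1).div_const 2
    rw [integral_sub i3 i0, integral_div, integral_add i2 i1] at hpos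
    have g1 := hη1 hyp
    have g2 := hη2 hyn
    simp only [hw, sweepDensity] at g1 g2 ⊢
    linarith
  -- Where `μ` has no mass the swept measure is the whole arcsine law. Its density is less than 1,
  -- so `B` must be null.
  have hsB : sweep m k τ B = arcs m k B := by
    rw [← hsum, Measure.add_apply, Measure.restrict_apply hB, inter_eq_left.2 hBs, hμB, zero_add]
  have hends : ∀ z : ℝ, ∀ᵐ y ∂(arcs m k), y ≠ z := fun z => by
    have := nullSingletonClass_of_absolutelyContinuous (absolutelyContinuous_arcs (m := m) hk)
    filter_upwards [measure_eq_zero_iff_ae_notMem.1 (measure_singleton (μ := arcs m k) z)] with y hy h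
    exact hy h
  have hlt' : ∀ᵐ y ∂(arcs m k), ENNReal.ofReal (w y) < 1 := by
    filter_upwards [ae_arcs_mem_seg, hends (m - |k|), hends (m + |k|)] with y h1 h2 h3
    exact ENNReal.ofReal_lt_one.2
      (hlt y ⟨lt_of_le_of_ne h1.1 h2.symm, lt_of_le_of_ne h1.2 h3⟩)
  have harcs : arcs m k B = 0 := by
    by_contra hne
    have h1 : sweep m k τ B = ∫⁻ y in B, ENNReal.ofReal (w y) ∂(arcs m k) := withDensity_apply _ hB
    have hfin : ∫⁻ y in B, ENNReal.ofReal (w y) ∂(arcs m k) ≠ ⊤ := by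
      rw [← h1, hsB]
      exact measure_ne_top _ _
    have h2 := setLIntegral_strict_mono hB hne measurable_one hfin (hlt'.mono fun y hy _ => hy)
    rw [← h1, hsB] at h2
    simp at h2
  have h := absolutelyContinuous_restrict_seg hk harcs
  rwa [Measure.restrict_apply hB, inter_eq_left.2 hBs] at h

end Positivity

/-! ### The odd kernel and its cubic remainder -/

section Kernel

theorem abs_half_log_sub_log_sub_le {u : ℝ} (hu : |u| ≤ 1 / 2) :
    |(Real.log (1 + u) - Real.log (1 - u)) / 2 - u| ≤ 2 * |u| ^ 3 := by
  have key : ∀ v : ℝ, |v| ≤ 1 / 2 → |v + v ^ 2 / 2 + Real.log (1 - v)| ≤ 2 * |v| ^ 3 := by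
    intro v hv
    have h := Real.abs_log_sub_add_sum_range_le (x := v) (by linarith) 2
    have h2 : |v| ^ 3 / (1 - |v|) ≤ 2 * |v| ^ 3 := by
      rw [div_le_iff₀ (by linarith)]
      nlinarith [pow_nonneg (abs_nonneg v) 3]
    refine le_trans (le_of_eq ?_) (h.trans h2)
    congr 1
    simp [Finset.sum_range_succ]
    norm_num
  have h1 := abs_le.1 (key u hu)
  have h2 := abs_le.1 (key (-u) (by rwa [abs_neg]))
  rw [abs_neg, sub_neg_eq_add] at h2
  rw [abs_le]
  constructor <;> nlinarith

theorem cosh_sub_one_le {θ : ℝ} (h0 : 0 ≤ θ) (h1 : θ ≤ 1) : Real.cosh θ - 1 ≤ θ ^ 2 := by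
  have h := Real.cosh_le_exp_half_sq θ
  have h2 : Real.exp (θ ^ 2 / 2) ≤ 1 + θ ^ 2 := by
    have h3 : |θ ^ 2 / 2| ≤ 1 := by
      rw [abs_of_nonneg (by positivity)]
      nlinarith
    have := (abs_le.1 (Real.abs_exp_sub_one_sub_id_le h3)).2
    nlinarith [sq_nonneg θ, pow_nonneg h0 4, mul_nonneg (sq_nonneg θ) (sub_nonneg.2 h1)]
  linarith

theorem sinh_le_two_mul {θ : ℝ} (h0 : 0 ≤ θ) (h1 : θ ≤ 1) : Real.sinh θ ≤ 2 * θ := by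
  have h2 := cosh_sub_one_le h0 h1
  have h3 := Real.cosh_sq θ
  have h4 := Real.one_le_cosh θ
  refine le_of_sq_le_sq ?_ (by linarith)
  have h5 : Real.sinh θ ^ 2 = (Real.cosh θ - 1) * (Real.cosh θ + 1) := by linarith
  rw [h5]
  have h6 : Real.cosh θ + 1 ≤ 4 := by nlinarith
  calc (Real.cosh θ - 1) * (Real.cosh θ + 1) ≤ θ ^ 2 * 4 :=
        mul_le_mul h2 h6 (by linarith) (by positivity)
    _ = _ := by ring

/-- The kernel `log |e^θ - ζ| - log |e^{-θ} - ζ|`. -/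
noncomputable def oddKernel (ζ : ℂ) (θ : ℝ) : ℝ :=
  Real.log ‖(Real.exp θ : ℂ) - ζ‖ - Real.log ‖(Real.exp (-θ) : ℂ) - ζ‖

/-- Written as `e^θ (a - b)` with `a` even and `b` odd in `θ`: the change `θ ↦ -θ` flips the sign of
`b` only, so the quotient `b / a` governs `oddKernel`. -/
theorem normSq_exp_sub (ζ : ℂ) (θ : ℝ) :
    ‖(Real.exp θ : ℂ) - ζ‖ ^ 2 = Real.exp θ *
      ((1 + ‖ζ‖ ^ 2) * Real.cosh θ - 2 * ζ.re - (‖ζ‖ ^ 2 - 1) * Real.sinh θ) := by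
  rw [← Complex.normSq_eq_norm_sq, ← Complex.normSq_eq_norm_sq, Complex.normSq_apply,
    Complex.normSq_apply, Real.cosh_eq, Real.sinh_eq]
  simp only [Complex.sub_re, Complex.sub_im, Complex.ofReal_re, Complex.ofReal_im]
  have h : Real.exp θ * Real.exp (-θ) = 1 := by rw [← Real.exp_add, add_neg_cancel, Real.exp_zero]
  linear_combination (-(ζ.re * ζ.re + ζ.im * ζ.im)) * h

/-- The quotient whose inverse hyperbolic tangent is `θ - oddKernel ζ θ`. -/
noncomputable def kernelQuot (ζ : ℂ) (θ : ℝ) : ℝ :=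
  ((‖ζ‖ ^ 2 - 1) * Real.sinh θ) / ((1 + ‖ζ‖ ^ 2) * Real.cosh θ - 2 * ζ.re)

variable {ζ : ℂ} {κ θ : ℝ}

theorem kernel_denom_ge (ζ : ℂ) (θ : ℝ) :
    (‖ζ‖ - 1) ^ 2 ≤ (1 + ‖ζ‖ ^ 2) - 2 * ζ.re ∧
      (1 + ‖ζ‖ ^ 2) - 2 * ζ.re ≤ (1 + ‖ζ‖ ^ 2) * Real.cosh θ - 2 * ζ.re := by
  have h1 : ζ.re ≤ ‖ζ‖ := Complex.re_le_norm ζ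
  have h2 := Real.one_le_cosh θ
  constructor
  · nlinarith
  · nlinarith [mul_nonneg (by positivity : (0 : ℝ) ≤ 1 + ‖ζ‖ ^ 2) (sub_nonneg.2 h2)]

/-- The constant `κ` measures how close `ζ` is to the unit circle. All later bounds depend on `ζ`
through `κ` only, which makes them uniform over an outer measure. -/
theorem kernelQuot_mem (hζ : 1 < ‖ζ‖) (hκ : (‖ζ‖ + 1) / (‖ζ‖ - 1) ≤ κ) (hθ : 0 ≤ θ) :
    kernelQuot ζ θ ∈ Icc 0 (κ * Real.sinh θ) := by
  have hs : 0 ≤ Real.sinh θ := Real.sinh_nonneg_iff.2 hθ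
  obtain ⟨h1, h2⟩ := kernel_denom_ge ζ θ
  have h0 : 0 < ‖ζ‖ - 1 := sub_pos.2 hζ
  have hA : 0 < (1 + ‖ζ‖ ^ 2) * Real.cosh θ - 2 * ζ.re := by
    have := pow_pos h0 2
    linarith
  have hN : 0 ≤ (‖ζ‖ ^ 2 - 1) * Real.sinh θ := mul_nonneg (by nlinarith) hs
  refine ⟨div_nonneg hN hA.le, ?_⟩
  calc kernelQuot ζ θ ≤ ((‖ζ‖ ^ 2 - 1) * Real.sinh θ) / (‖ζ‖ - 1) ^ 2 :=
        div_le_div_of_nonneg_left hN (by positivity) (h1.trans h2)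
    _ = (‖ζ‖ + 1) / (‖ζ‖ - 1) * Real.sinh θ := by
        field_simp
        ring
    _ ≤ _ := mul_le_mul_of_nonneg_right hκ hs

theorem abs_kernelQuot_sub_le (hζ : 1 < ‖ζ‖) (hκ : (‖ζ‖ + 1) / (‖ζ‖ - 1) ≤ κ) (hθ : 0 ≤ θ) :
    |kernelQuot ζ θ - (‖ζ‖ ^ 2 - 1) / ((1 + ‖ζ‖ ^ 2) - 2 * ζ.re) * Real.sinh θ| ≤
      κ ^ 3 * Real.sinh θ * (Real.cosh θ - 1) := by
  have hs : 0 ≤ Real.sinh θ := Real.sinh_nonneg_iff.2 hθ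
  have hc := Real.one_le_cosh θ
  obtain ⟨h1, h2⟩ := kernel_denom_ge ζ θ
  have hm := kernelQuot_mem hζ hκ hθ
  have h0 : 0 < ‖ζ‖ - 1 := sub_pos.2 hζ
  have hA0 : 0 < (1 + ‖ζ‖ ^ 2) - 2 * ζ.re := by
    have := pow_pos h0 2
    linarith
  have hA : 0 < (1 + ‖ζ‖ ^ 2) * Real.cosh θ - 2 * ζ.re := by linarith
  have hκ0 : 0 ≤ κ := le_trans (div_nonneg (by positivity) h0.le) hκ
  have heq : kernelQuot ζ θ - (‖ζ‖ ^ 2 - 1) / ((1 + ‖ζ‖ ^ 2) - 2 * ζ.re) * Real.sinh θ =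
      -(kernelQuot ζ θ * ((1 + ‖ζ‖ ^ 2) / ((1 + ‖ζ‖ ^ 2) - 2 * ζ.re) * (Real.cosh θ - 1))) := by
    unfold kernelQuot
    field_simp
    ring
  have hr : (1 + ‖ζ‖ ^ 2) / ((1 + ‖ζ‖ ^ 2) - 2 * ζ.re) ≤ κ ^ 2 := by
    calc (1 + ‖ζ‖ ^ 2) / ((1 + ‖ζ‖ ^ 2) - 2 * ζ.re) ≤ (‖ζ‖ + 1) ^ 2 / (‖ζ‖ - 1) ^ 2 :=
          div_le_div₀ (by positivity) (by nlinarith) (by positivity) h1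
      _ = ((‖ζ‖ + 1) / (‖ζ‖ - 1)) ^ 2 := by rw [div_pow]
      _ ≤ κ ^ 2 := pow_le_pow_left₀ (div_nonneg (by positivity) h0.le) hκ 2
  have hr0 : 0 ≤ (1 + ‖ζ‖ ^ 2) / ((1 + ‖ζ‖ ^ 2) - 2 * ζ.re) := div_nonneg (by positivity) hA0.le
  rw [heq, abs_neg, abs_of_nonneg (mul_nonneg hm.1 (mul_nonneg hr0 (sub_nonneg.2 hc)))]
  calc kernelQuot ζ θ * ((1 + ‖ζ‖ ^ 2) / ((1 + ‖ζ‖ ^ 2) - 2 * ζ.re) * (Real.cosh θ - 1))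
      ≤ (κ * Real.sinh θ) * (κ ^ 2 * (Real.cosh θ - 1)) :=
        mul_le_mul hm.2 (mul_le_mul_of_nonneg_right hr (sub_nonneg.2 hc))
          (mul_nonneg hr0 (sub_nonneg.2 hc)) (mul_nonneg hκ0 hs)
    _ = _ := by ring

/-- This keeps `e^θ` away from the pole, where `Real.log 0 = 0` would break the product formula for
logarithms. -/
theorem exp_sub_ne_zero (hζ : 1 < ‖ζ‖) (hu : kernelQuot ζ θ < 1) : (Real.exp θ : ℂ) - ζ ≠ 0 := by
  obtain ⟨h1, h2⟩ := kernel_denom_ge ζ θ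
  have h0 : 0 < ‖ζ‖ - 1 := sub_pos.2 hζ
  have hA : 0 < (1 + ‖ζ‖ ^ 2) * Real.cosh θ - 2 * ζ.re := by
    have := pow_pos h0 2
    linarith
  rw [kernelQuot, div_lt_one hA] at hu
  have := normSq_exp_sub ζ θ
  intro h
  rw [h, norm_zero] at this
  have h3 : 0 < Real.exp θ *
      ((1 + ‖ζ‖ ^ 2) * Real.cosh θ - 2 * ζ.re - (‖ζ‖ ^ 2 - 1) * Real.sinh θ) :=
    mul_pos (Real.exp_pos θ) (by linarith)
  norm_num at this
  linarith

theorem oddKernel_eq (hζ : 1 < ‖ζ‖) (hθ : 0 ≤ θ) (hu : kernelQuot ζ θ < 1) :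
    oddKernel ζ θ = θ - (Real.log (1 + kernelQuot ζ θ) - Real.log (1 - kernelQuot ζ θ)) / 2 := by
  obtain ⟨h1, h2⟩ := kernel_denom_ge ζ θ
  have h0 : 0 < ‖ζ‖ - 1 := sub_pos.2 hζ
  have hu0 := (kernelQuot_mem hζ le_rfl hθ).1
  set A := (1 + ‖ζ‖ ^ 2) * Real.cosh θ - 2 * ζ.re with hAdef
  have hA : 0 < A := by
    have := pow_pos h0 2
    linarith
  set u := kernelQuot ζ θ with hudef
  have hD : (‖ζ‖ ^ 2 - 1) * Real.sinh θ = A * u := by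
    rw [hudef, kernelQuot, mul_div_cancel₀ _ hA.ne']
  have e1 : ‖(Real.exp θ : ℂ) - ζ‖ ^ 2 = Real.exp θ * (A * (1 - u)) := by
    rw [normSq_exp_sub, ← hAdef, hD]
    ring
  have e2 : ‖(Real.exp (-θ) : ℂ) - ζ‖ ^ 2 = Real.exp (-θ) * (A * (1 + u)) := by
    rw [normSq_exp_sub, Real.cosh_neg, Real.sinh_neg, ← hAdef, mul_neg, hD]
    ring
  have l1 : 2 * Real.log ‖(Real.exp θ : ℂ) - ζ‖ = θ + (Real.log A + Real.log (1 - u)) := by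
    have : Real.log (‖(Real.exp θ : ℂ) - ζ‖ ^ 2) = θ + (Real.log A + Real.log (1 - u)) := by
      rw [e1, Real.log_mul (Real.exp_pos _).ne' (mul_pos hA (by linarith)).ne', Real.log_exp,
        Real.log_mul hA.ne' (by linarith)]
    rw [← this, Real.log_pow]
    norm_num
  have l2 : 2 * Real.log ‖(Real.exp (-θ) : ℂ) - ζ‖ = -θ + (Real.log A + Real.log (1 + u)) := by
    have : Real.log (‖(Real.exp (-θ) : ℂ) - ζ‖ ^ 2) = -θ + (Real.log A + Real.log (1 + u)) := by
      rw [e2, Real.log_mul (Real.exp_pos _).ne' (mul_pos hA (by linarith)).ne', Real.log_exp,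
        Real.log_mul hA.ne' (by linarith)]
    rw [← this, Real.log_pow]
    norm_num
  unfold oddKernel
  linarith

theorem kernelQuot_le_half (hζ : 1 < ‖ζ‖) (hκ : (‖ζ‖ + 1) / (‖ζ‖ - 1) ≤ κ) (hκ1 : 1 ≤ κ)
    (hθ : 0 ≤ θ) (hθκ : θ * (4 * κ) ≤ 1) :
    kernelQuot ζ θ ≤ 2 * κ * θ ∧ kernelQuot ζ θ ≤ 1 / 2 := by
  have h := (kernelQuot_mem hζ hκ hθ).2
  have hs := sinh_le_two_mul hθ (by nlinarith)
  have : κ * Real.sinh θ ≤ κ * (2 * θ) := mul_le_mul_of_nonneg_left hs (by linarith)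
  constructor <;> linarith

theorem oddKernel_le (hζ : 1 < ‖ζ‖) (hκ : (‖ζ‖ + 1) / (‖ζ‖ - 1) ≤ κ) (hκ1 : 1 ≤ κ)
    (hθ : 0 ≤ θ) (hθκ : θ * (4 * κ) ≤ 1) : oddKernel ζ θ ≤ θ := by
  have h1 := kernelQuot_le_half hζ hκ hκ1 hθ hθκ
  have h0 := (kernelQuot_mem hζ hκ hθ).1
  rw [oddKernel_eq hζ hθ (by linarith)]
  have : Real.log (1 - kernelQuot ζ θ) ≤ Real.log (1 + kernelQuot ζ θ) :=
    Real.log_le_log (by linarith) (by linarith)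
  linarith

theorem abs_oddKernel_le (hζ : 1 < ‖ζ‖) (hκ : (‖ζ‖ + 1) / (‖ζ‖ - 1) ≤ κ) (hκ1 : 1 ≤ κ)
    (hθ : 0 ≤ θ) (hθκ : θ * (4 * κ) ≤ 1) : |oddKernel ζ θ| ≤ 5 * κ * θ := by
  have h1 := kernelQuot_le_half hζ hκ hκ1 hθ hθκ
  have h0 := (kernelQuot_mem hζ hκ hθ).1
  have hle := oddKernel_le hζ hκ hκ1 hθ hθκ
  have h2 := abs_half_log_sub_log_sub_le (u := kernelQuot ζ θ) (by rw [abs_of_nonneg h0]; exact h1.2)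
  rw [abs_of_nonneg h0] at h2
  have h3 : 2 * kernelQuot ζ θ ^ 3 ≤ kernelQuot ζ θ := by nlinarith [mul_nonneg h0 h0]
  have h4 := (abs_le.1 h2).2
  have heq := oddKernel_eq hζ hθ (by linarith)
  rw [abs_le]
  constructor
  · nlinarith
  · nlinarith

/-- With `u` the quotient, `oddKernel` is `θ - artanh u`. Both `artanh u - u` and `u - b sinh θ` are
cubic in `θ`, and the linear terms cancel in the doubling. -/
theorem abs_oddKernel_two_mul_sub_le (hζ : 1 < ‖ζ‖) (hκ : (‖ζ‖ + 1) / (‖ζ‖ - 1) ≤ κ) (hκ1 : 1 ≤ κ)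
    (hθ : 0 ≤ θ) (hθκ : θ * (8 * κ) ≤ 1) :
    |oddKernel ζ (2 * θ) - 2 * oddKernel ζ θ| ≤ 200 * κ ^ 3 * θ ^ 3 := by
  have h2θ : 0 ≤ 2 * θ := by linarith
  have hθκ' : θ * (4 * κ) ≤ 1 := by nlinarith
  have hθκ2 : 2 * θ * (4 * κ) ≤ 1 := by linarith
  have hθ1 : 2 * θ ≤ 1 := by nlinarith
  have p1 := kernelQuot_le_half hζ hκ hκ1 hθ hθκ'
  have p2 := kernelQuot_le_half hζ hκ hκ1 h2θ hθκ2
  have n1 := (kernelQuot_mem hζ hκ hθ).1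
  have n2 := (kernelQuot_mem hζ hκ h2θ).1
  have l1 := abs_half_log_sub_log_sub_le (u := kernelQuot ζ θ) (by rw [abs_of_nonneg n1]; exact p1.2)
  have l2 := abs_half_log_sub_log_sub_le (u := kernelQuot ζ (2 * θ))
    (by rw [abs_of_nonneg n2]; exact p2.2)
  rw [abs_of_nonneg n1] at l1
  rw [abs_of_nonneg n2] at l2
  -- In units of `κ³θ³` the errors are `128 + 2·16` from `artanh`, `16 + 2·2` from replacing the
  -- quotient by `b sinh`, and 4 from `sinh 2θ - 2 sinh θ`: 184 in all, below 200.
  have c1 : 2 * kernelQuot ζ θ ^ 3 ≤ 16 * (κ ^ 3 * θ ^ 3) := by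
    have := pow_le_pow_left₀ n1 p1.1 3
    nlinarith
  have c2 : 2 * kernelQuot ζ (2 * θ) ^ 3 ≤ 128 * (κ ^ 3 * θ ^ 3) := by
    have := pow_le_pow_left₀ n2 p2.1 3
    nlinarith
  have q1 := abs_kernelQuot_sub_le hζ hκ hθ
  have q2 := abs_kernelQuot_sub_le hζ hκ h2θ
  have hs1 := sinh_le_two_mul hθ (by linarith)
  have hs2 := sinh_le_two_mul h2θ hθ1
  have hc1 := cosh_sub_one_le hθ (by linarith)
  have hc2 := cosh_sub_one_le h2θ hθ1
  have hc1' := Real.one_le_cosh θ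
  have hc2' := Real.one_le_cosh (2 * θ)
  have hsn1 : 0 ≤ Real.sinh θ := Real.sinh_nonneg_iff.2 hθ
  have hsn2 : 0 ≤ Real.sinh (2 * θ) := Real.sinh_nonneg_iff.2 h2θ
  have hκ3 : 0 ≤ κ ^ 3 := by positivity
  have m1 : Real.sinh θ * (Real.cosh θ - 1) ≤ 2 * θ ^ 3 := by
    calc _ ≤ (2 * θ) * θ ^ 2 := mul_le_mul hs1 hc1 (by linarith) (by linarith)
      _ = _ := by ring
  have m2 : Real.sinh (2 * θ) * (Real.cosh (2 * θ) - 1) ≤ 16 * θ ^ 3 := by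
    calc _ ≤ (2 * (2 * θ)) * (2 * θ) ^ 2 := mul_le_mul hs2 hc2 (by linarith) (by linarith)
      _ = _ := by ring
  have q1' : κ ^ 3 * Real.sinh θ * (Real.cosh θ - 1) ≤ 2 * (κ ^ 3 * θ ^ 3) := by
    rw [mul_assoc]
    have := mul_le_mul_of_nonneg_left m1 hκ3
    linarith
  have q2' : κ ^ 3 * Real.sinh (2 * θ) * (Real.cosh (2 * θ) - 1) ≤ 16 * (κ ^ 3 * θ ^ 3) := by
    rw [mul_assoc]
    have := mul_le_mul_of_nonneg_left m2 hκ3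
    linarith
  set b := (‖ζ‖ ^ 2 - 1) / ((1 + ‖ζ‖ ^ 2) - 2 * ζ.re) with hb
  have hbκ : 0 ≤ b ∧ b ≤ κ := by
    have h0 : 0 < ‖ζ‖ - 1 := sub_pos.2 hζ
    have h1 := (kernel_denom_ge ζ 0).1
    have hN : 0 ≤ ‖ζ‖ ^ 2 - 1 := by nlinarith
    have hp := pow_pos h0 2
    refine ⟨div_nonneg hN (by linarith), le_trans ?_ hκ⟩
    calc b ≤ (‖ζ‖ ^ 2 - 1) / (‖ζ‖ - 1) ^ 2 := div_le_div_of_nonneg_left hN hp h1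
      _ = _ := by
        field_simp
        ring
  have hsd : Real.sinh (2 * θ) - 2 * Real.sinh θ = 2 * (Real.sinh θ * (Real.cosh θ - 1)) := by
    rw [Real.sinh_two_mul]
    ring
  have hbs0 : 0 ≤ b * (Real.sinh (2 * θ) - 2 * Real.sinh θ) := by
    rw [hsd]
    exact mul_nonneg hbκ.1 (mul_nonneg zero_le_two (mul_nonneg hsn1 (by linarith)))
  have hκ13 : κ ≤ κ ^ 3 := by nlinarith [mul_nonneg (by linarith : (0 : ℝ) ≤ κ) (by nlinarith : (0 : ℝ) ≤ κ ^ 2 - 1)]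
  have hθ3 : 0 ≤ θ ^ 3 := by positivity
  have hbs : b * (Real.sinh (2 * θ) - 2 * Real.sinh θ) ≤ 4 * (κ ^ 3 * θ ^ 3) := by
    rw [hsd]
    calc b * (2 * (Real.sinh θ * (Real.cosh θ - 1))) ≤ κ ^ 3 * (2 * (2 * θ ^ 3)) :=
          mul_le_mul (hbκ.2.trans hκ13) (by linarith)
            (mul_nonneg zero_le_two (mul_nonneg hsn1 (by linarith))) hκ3
      _ = _ := by ring
  have e1 := oddKernel_eq hζ hθ (by linarith)
  have e2 := oddKernel_eq hζ h2θ (by linarith)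
  have a1 := abs_le.1 l1
  have a2 := abs_le.1 l2
  have a3 := abs_le.1 q1
  have a4 := abs_le.1 q2
  have hp : 0 ≤ κ ^ 3 * θ ^ 3 := mul_nonneg hκ3 hθ3
  rw [e1, e2, mul_assoc, abs_le]
  constructor <;> linarith

end Kernel

/-! ### Regularity of logarithms and potentials at an endpoint -/

section Jump

/-- The difference between the value of `F` at the point `m + k cosh θ` and the integral of `F`
against the balayage of that point on `[m - |k|, m + |k|]`. -/
noncomputable def jump (m k : ℝ) (F : ℝ → ℝ) (θ : ℝ) : ℝ :=
  F (m + k * Real.cosh θ) - ∫ y, F y ∂(bal m k (Real.exp (-θ)))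

/-- Near the end point `m + k`, the jump is `O(θ)`, and is linear in `θ` up to `O(θ³)`. -/
def EndpointRegular (m k : ℝ) (F : ℝ → ℝ) : Prop :=
  Integrable F (arcs m k) ∧ ∃ C θ₀ : ℝ, 0 < θ₀ ∧ ∀ θ, 0 < θ → θ < θ₀ →
    |jump m k F θ| ≤ C * θ ∧ |jump m k F (2 * θ) - 2 * jump m k F θ| ≤ C * θ ^ 3

variable {m k θ : ℝ} {F G : ℝ → ℝ}

theorem abs_exp_neg_lt_one (hθ : 0 < θ) : |Real.exp (-θ)| < 1 := by
  rw [Real.abs_exp, Real.exp_lt_one_iff]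
  linarith

theorem jump_add (hk : k ≠ 0) (hF : Integrable F (arcs m k)) (hG : Integrable G (arcs m k))
    (hθ : 0 < θ) : jump m k (fun x => F x + G x) θ = jump m k F θ + jump m k G θ := by
  have hq := abs_exp_neg_lt_one hθ
  rw [jump, integral_add (integrable_bal_of_arcs hk hq hF) (integrable_bal_of_arcs hk hq hG), jump,
    jump]
  ring

theorem jump_const_mul (c : ℝ) : jump m k (fun x => c * F x) θ = c * jump m k F θ := by
  rw [jump, integral_const_mul, jump]
  ring

theorem jump_const (hk : k ≠ 0) (hθ : 0 < θ) (c : ℝ) : jump m k (fun _ => c) θ = 0 := by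
  have := isProbabilityMeasure_bal (m := m) hk (abs_exp_neg_lt_one hθ)
  rw [jump, integral_const, probReal_univ, one_smul, sub_self]

theorem EndpointRegular.add (hk : k ≠ 0) (hF : EndpointRegular m k F) (hG : EndpointRegular m k G) :
    EndpointRegular m k (fun x => F x + G x) := by
  obtain ⟨iF, C, θ₀, h0, h⟩ := hF
  obtain ⟨iG, C', θ₀', h0', h'⟩ := hG
  refine ⟨iF.add iG, C + C', min θ₀ θ₀', lt_min h0 h0', fun θ h1 h2 => ?_⟩
  obtain ⟨e1, e2⟩ := h θ h1 (h2.trans_le (min_le_left _ _))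
  obtain ⟨e3, e4⟩ := h' θ h1 (h2.trans_le (min_le_right _ _))
  rw [jump_add hk iF iG h1, jump_add hk iF iG (by linarith)]
  refine ⟨(abs_add_le _ _).trans (by linarith), ?_⟩
  have : jump m k F (2 * θ) + jump m k G (2 * θ) - 2 * (jump m k F θ + jump m k G θ) =
    (jump m k F (2 * θ) - 2 * jump m k F θ) + (jump m k G (2 * θ) - 2 * jump m k G θ) := by ring
  rw [this]
  exact (abs_add_le _ _).trans (by linarith)

theorem EndpointRegular.const_mul (hF : EndpointRegular m k F) (c : ℝ) :
    EndpointRegular m k (fun x => c * F x) := by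
  obtain ⟨iF, C, θ₀, h0, h⟩ := hF
  refine ⟨iF.const_mul c, |c| * C, θ₀, h0, fun θ h1 h2 => ?_⟩
  obtain ⟨e1, e2⟩ := h θ h1 h2
  rw [jump_const_mul, jump_const_mul]
  have : c * jump m k F (2 * θ) - 2 * (c * jump m k F θ) =
    c * (jump m k F (2 * θ) - 2 * jump m k F θ) := by ring
  rw [this, abs_mul, abs_mul, mul_assoc, mul_assoc]
  exact ⟨mul_le_mul_of_nonneg_left e1 (abs_nonneg c), mul_le_mul_of_nonneg_left e2 (abs_nonneg c)⟩

theorem endpointRegular_const (hk : k ≠ 0) (c : ℝ) : EndpointRegular m k (fun _ => c) := by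
  refine ⟨integrable_const c, 0, 1, one_pos, fun θ h1 _ => ?_⟩
  rw [jump_const hk h1, jump_const hk (by linarith)]
  simp

theorem EndpointRegular.sum {ι : Type*} (hk : k ≠ 0) (s : Finset ι) {f : ι → ℝ → ℝ}
    (h : ∀ i ∈ s, EndpointRegular m k (f i)) : EndpointRegular m k (fun x => ∑ i ∈ s, f i x) := by
  classical
  induction s using Finset.induction_on with
  | empty => simpa using endpointRegular_const hk 0
  | insert i s his ih =>
    simp_rw [Finset.sum_insert his]
    exact (h i (Finset.mem_insert_self i s)).add hk
      (ih fun j hj => h j (Finset.mem_insert_of_mem hj))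

theorem EndpointRegular.multiset_sum {ι : Type*} (hk : k ≠ 0) (s : Multiset ι) {f : ι → ℝ → ℝ}
    (h : ∀ i ∈ s, EndpointRegular m k (f i)) :
    EndpointRegular m k (fun x => (s.map fun i => f i x).sum) := by
  induction s using Multiset.induction_on with
  | empty => simpa using endpointRegular_const hk 0
  | cons i s ih =>
    simp_rw [Multiset.map_cons, Multiset.sum_cons]
    exact (h i (Multiset.mem_cons_self i s)).add hk
      (ih fun j hj => h j (Multiset.mem_cons_of_mem hj))

theorem integrable_id_arcs (m k : ℝ) : Integrable (fun y : ℝ => y) (arcs m k) := by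
  refine (integrable_const (|m| + |k|)).mono' measurable_id.aestronglyMeasurable ?_
  filter_upwards [ae_arcs_mem_seg] with y hy
  rw [Real.norm_eq_abs, abs_le]
  exact ⟨by linarith [hy.1, neg_abs_le m], by linarith [hy.2, le_abs_self m]⟩

theorem endpointRegular_id (hk : k ≠ 0) : EndpointRegular m k (fun x => x) := by
  have hj : ∀ θ, 0 < θ → jump m k (fun x => x) θ = k * Real.sinh θ := fun θ h => by
    rw [jump, integral_bal_id hk (abs_exp_neg_lt_one h), Real.sinh_eq, Real.cosh_eq]
    ring
  refine ⟨integrable_id_arcs m k, 4 * |k|, 1, one_pos, fun θ h1 h2 => ?_⟩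
  have hs0 := Real.sinh_nonneg_iff.2 h1.le
  have hs := sinh_le_two_mul h1.le h2.le
  have hc := cosh_sub_one_le h1.le h2.le
  have hc1 := Real.one_le_cosh θ
  have hk0 := abs_nonneg k
  rw [hj θ h1, hj (2 * θ) (by linarith), Real.sinh_two_mul]
  have : k * (2 * Real.sinh θ * Real.cosh θ) - 2 * (k * Real.sinh θ) =
    k * (2 * (Real.sinh θ * (Real.cosh θ - 1))) := by ring
  rw [this, abs_mul, abs_mul, abs_of_nonneg hs0,
    abs_of_nonneg (a := 2 * (Real.sinh θ * (Real.cosh θ - 1)))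
      (mul_nonneg two_pos.le (mul_nonneg hs0 (by linarith)))]
  have h3 : Real.sinh θ * (Real.cosh θ - 1) ≤ 2 * θ * θ ^ 2 :=
    mul_le_mul hs hc (by linarith) (by linarith)
  constructor
  · nlinarith
  · calc |k| * (2 * (Real.sinh θ * (Real.cosh θ - 1))) ≤ |k| * (2 * (2 * θ * θ ^ 2)) :=
        mul_le_mul_of_nonneg_left (by linarith) hk0
      _ = _ := by ring

theorem log_norm_cosh_sub (hk : k ≠ 0) {α ζ : ℂ} (hζ : 1 ≤ ‖ζ‖)
    (hα : α = m + k / 2 * (ζ + ζ⁻¹)) (hθ : 0 < θ) (hne : (Real.exp θ : ℂ) - ζ ≠ 0) :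
    Real.log ‖((m + k * Real.cosh θ : ℝ) : ℂ) - α‖ = Real.log (|k| / 2) +
      Real.log ‖(Real.exp θ : ℂ) - ζ‖ + Real.log ‖(Real.exp (-θ) : ℂ) - ζ‖ - Real.log ‖ζ‖ := by
  have hζ0 : ζ ≠ 0 := norm_pos_iff.1 (by linarith)
  have hne2 : (Real.exp (-θ) : ℂ) - ζ ≠ 0 := by
    intro h
    rw [sub_eq_zero] at h
    rw [← h, Complex.norm_real, Real.norm_eq_abs] at hζ
    exact absurd (abs_exp_neg_lt_one hθ) (not_lt.2 hζ)
  have hfac : ((m + k * Real.cosh θ : ℝ) : ℂ) - α =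
      -((k / 2 : ℝ) : ℂ) * ((Real.exp θ : ℂ) - ζ) * ((Real.exp (-θ) : ℂ) - ζ) / ζ := by
    have h1 : (Real.exp θ : ℂ) * (Real.exp (-θ) : ℂ) = 1 := by
      rw [← Complex.ofReal_mul, ← Real.exp_add, add_neg_cancel, Real.exp_zero, Complex.ofReal_one]
    rw [hα, Real.cosh_eq, eq_div_iff hζ0]
    push_cast at h1 ⊢
    have h2 : ζ⁻¹ * ζ = 1 := inv_mul_cancel₀ hζ0
    linear_combination (-(k : ℂ) / 2) * h2 + (k : ℂ) / 2 * h1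
  have hk2 : ‖-((k / 2 : ℝ) : ℂ)‖ = |k| / 2 := by
    rw [norm_neg, Complex.norm_real, Real.norm_eq_abs, abs_div, abs_two]
  have hk0 : |k| / 2 ≠ 0 := by
    have := abs_pos.2 hk
    positivity
  rw [hfac, norm_div, norm_mul, norm_mul, hk2,
    Real.log_div (mul_ne_zero (mul_ne_zero hk0 (norm_ne_zero_iff.2 hne)) (norm_ne_zero_iff.2 hne2))
      (norm_ne_zero_iff.2 hζ0),
    Real.log_mul (mul_ne_zero hk0 (norm_ne_zero_iff.2 hne)) (norm_ne_zero_iff.2 hne2),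
    Real.log_mul hk0 (norm_ne_zero_iff.2 hne)]

/-- At `m + k cosh θ` the logarithm splits into the factors `e^θ - ζ` and `e^{-θ} - ζ`, while its
integral against the balayage contains the second factor twice. The difference is the odd kernel,
and the constants drop out. -/
theorem jump_log (hk : k ≠ 0) {α ζ : ℂ} (hζ : 1 ≤ ‖ζ‖)
    (hα : α = m + k / 2 * (ζ + ζ⁻¹)) (hθ : 0 < θ) (hne : (Real.exp θ : ℂ) - ζ ≠ 0) :
    jump m k (fun x => Real.log ‖(x : ℂ) - α‖) θ = oddKernel ζ θ := by
  rw [jump, integral_bal_log hk (abs_exp_neg_lt_one hθ) hζ hα,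
    log_norm_cosh_sub hk hζ hα hθ hne, oddKernel]
  ring

theorem mem_seg_of_norm_eq_one {ζ : ℂ} (hζ : ‖ζ‖ = 1) :
    ∃ y ∈ seg m k, ((y : ℝ) : ℂ) = m + k / 2 * (ζ + ζ⁻¹) := by
  refine ⟨m + k * ζ.re, ?_, ?_⟩
  · have h : |k * ζ.re| ≤ |k| := by
      rw [abs_mul]
      exact mul_le_of_le_one_right (abs_nonneg k) (hζ ▸ Complex.abs_re_le_norm ζ)
    have := abs_le.1 h
    exact ⟨by linarith, by linarith⟩
  · rw [Complex.inv_eq_conj hζ, Complex.add_conj]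
    push_cast
    ring

theorem endpointRegular_log (hk : k ≠ 0) {α : ℂ} (hα : ∀ y ∈ seg m k, (y : ℂ) ≠ α) :
    EndpointRegular m k (fun x => Real.log ‖(x : ℂ) - α‖) := by
  obtain ⟨ζ, hζ, hαζ⟩ := exists_joukowski (m := m) hk α
  have hζ1 : 1 < ‖ζ‖ := by
    refine lt_of_le_of_ne hζ fun h => ?_
    obtain ⟨y, hy, hyα⟩ := mem_seg_of_norm_eq_one (m := m) (k := k) h.symm
    exact hα y hy (hyα.trans hαζ.symm)
  set κ := (‖ζ‖ + 1) / (‖ζ‖ - 1) with hκ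
  have hκ1 : 1 ≤ κ := by
    rw [hκ, le_div_iff₀ (by linarith)]
    linarith
  refine ⟨integrable_arcs_log hk α, 200 * κ ^ 3, 1 / (8 * κ), by positivity, fun θ h1 h2 => ?_⟩
  rw [lt_div_iff₀ (by positivity)] at h2
  have h3 : θ * (4 * κ) ≤ 1 := by nlinarith
  have hne := exp_sub_ne_zero hζ1
    ((kernelQuot_le_half hζ1 le_rfl hκ1 h1.le h3).2.trans_lt (by norm_num))
  have hne2 := exp_sub_ne_zero (θ := 2 * θ) hζ1
    ((kernelQuot_le_half hζ1 le_rfl hκ1 (by linarith) (by linarith)).2.trans_lt (by norm_num))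
  rw [jump_log hk hζ hαζ h1 hne, jump_log hk hζ hαζ (by linarith) hne2]
  refine ⟨(abs_oddKernel_le hζ1 le_rfl hκ1 h1.le h3).trans ?_,
    abs_oddKernel_two_mul_sub_le hζ1 le_rfl hκ1 h1.le h2.le⟩
  refine mul_le_mul_of_nonneg_right ?_ h1.le
  nlinarith [pow_le_pow_right₀ hκ1 (show 1 ≤ 3 by norm_num)]

/-- For a pole on the circle the odd part in `normSq_exp_sub` vanishes. The mass on the band itself
therefore contributes a term exactly linear in `θ`, without error. -/
theorem oddKernel_of_norm_eq_one {ζ : ℂ} (hζ : ‖ζ‖ = 1) (hθ : 0 < θ) : oddKernel ζ θ = θ := by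
  have h1 : ‖(Real.exp θ : ℂ) - ζ‖ = Real.exp θ * ‖(Real.exp (-θ) : ℂ) - ζ‖ := by
    have h := normSq_exp_sub ζ θ
    have h' := normSq_exp_sub ζ (-θ)
    rw [hζ, Real.cosh_neg, Real.sinh_neg] at h'
    rw [hζ] at h
    have h2 : Real.exp θ * Real.exp (-θ) = 1 := by rw [← Real.exp_add, add_neg_cancel, Real.exp_zero]
    refine (sq_eq_sq₀ (norm_nonneg _) (by positivity)).1 ?_
    rw [mul_pow, h, h']
    linear_combination (-Real.exp θ * ((1 + 1 ^ 2) * Real.cosh θ - 2 * ζ.re)) * h2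
  have hne : (Real.exp (-θ) : ℂ) - ζ ≠ 0 := by
    intro h
    rw [sub_eq_zero] at h
    rw [← h, Complex.norm_real, Real.norm_eq_abs] at hζ
    exact absurd (abs_exp_neg_lt_one hθ) hζ.not_lt
  rw [oddKernel, h1, Real.log_mul (Real.exp_pos θ).ne' (norm_ne_zero_iff.2 hne), Real.log_exp]
  ring

variable {q₀ : ℝ}

/-- The jump of the logarithmic kernel with pole `t`. -/
noncomputable def potKernel (m k t θ : ℝ) : ℝ :=
  Real.log |m + k * Real.cosh θ - t| - pot (bal m k (Real.exp (-θ))) t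

theorem potKernel_eq_oddKernel (hk : k ≠ 0) {t : ℝ} {ζ : ℂ} (hζ : 1 ≤ ‖ζ‖)
    (ht : (t : ℂ) = m + k / 2 * (ζ + ζ⁻¹)) (hθ : 0 < θ) (hne : (Real.exp θ : ℂ) - ζ ≠ 0) :
    potKernel m k t θ = oddKernel ζ θ := by
  rw [← jump_log hk hζ ht hθ hne, jump, potKernel, pot]
  simp_rw [norm_ofReal_sub, log_abs_sub_comm t]

theorem potKernel_of_mem_seg (hk : k ≠ 0) {t : ℝ} (ht : t ∈ seg m k) (hθ : 0 < θ) :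
    potKernel m k t θ = θ := by
  obtain ⟨φ, -, hφ⟩ := exists_cos_eq_of_mem_seg hk ht
  set ζ : ℂ := circleMap 0 1 φ with hζ
  have hζ1 : ‖ζ‖ = 1 := by simp [hζ]
  have htζ : (t : ℂ) = m + k / 2 * (ζ + ζ⁻¹) := by
    rw [Complex.inv_eq_conj hζ1, Complex.add_conj, hζ, circleMap_zero_one_re, hφ]
    push_cast
    ring
  have hne : (Real.exp θ : ℂ) - ζ ≠ 0 := by
    intro h
    rw [sub_eq_zero] at h
    rw [← h, Complex.norm_real, Real.norm_eq_abs, Real.abs_exp, Real.exp_eq_one_iff] at hζ1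
    exact hθ.ne' hζ1
  rw [potKernel_eq_oddKernel hk hζ1.ge htζ hθ hne, oddKernel_of_norm_eq_one hζ1 hθ]

theorem potKernel_bounds (hk : k ≠ 0) (h0 : 0 ≤ q₀) (hq₀ : q₀ < 1) {t : ℝ}
    (ht : t ∈ seg m k ∨ |diskPoint m k t| ≤ q₀) (hθ : 0 < θ)
    (hθκ : θ * (8 * ((1 + q₀) / (1 - q₀))) ≤ 1) :
    potKernel m k t θ ≤ θ ∧ |potKernel m k t θ| ≤ 5 * ((1 + q₀) / (1 - q₀)) * θ ∧
      |potKernel m k t (2 * θ) - 2 * potKernel m k t θ| ≤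
        200 * ((1 + q₀) / (1 - q₀)) ^ 3 * θ ^ 3 := by
  set κ := (1 + q₀) / (1 - q₀) with hκ
  have hκ1 : 1 ≤ κ := by
    rw [hκ, le_div_iff₀ (by linarith)]
    linarith
  have h3 : θ * (4 * κ) ≤ 1 := by nlinarith
  by_cases hts : t ∈ seg m k
  · rw [potKernel_of_mem_seg hk hts hθ, potKernel_of_mem_seg hk hts (by linarith), sub_self, abs_zero,
      abs_of_pos hθ]
    exact ⟨le_rfl, by nlinarith, by positivity⟩
  have htq := ht.resolve_left hts
  obtain ⟨hq0, hq1, -, hqt⟩ := diskPoint_spec hk hts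
  set q := diskPoint m k t with hq
  set ζ : ℂ := ((q⁻¹ : ℝ) : ℂ) with hζdef
  have hnorm : ‖ζ‖ = |q|⁻¹ := by rw [hζdef, Complex.norm_real, Real.norm_eq_abs, abs_inv]
  have hqpos : 0 < |q| := abs_pos.2 hq0
  have hζ1 : 1 < ‖ζ‖ := by
    rw [hnorm]
    exact (one_lt_inv₀ hqpos).2 hq1
  have htζ : (t : ℂ) = m + k / 2 * (ζ + ζ⁻¹) := by
    rw [hqt, hζdef]
    push_cast
    rw [inv_inv]
    ring
  -- With `ζ = q⁻¹` the quotient is `(1 + |q|) / (1 - |q|)`, which increases with `|q| ≤ q₀`.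
  have hκ' : (‖ζ‖ + 1) / (‖ζ‖ - 1) ≤ κ := by
    rw [hκ, div_le_div_iff₀ (by linarith) (by linarith)]
    have h4 : ‖ζ‖ * |q| = 1 := by rw [hnorm, inv_mul_cancel₀ hqpos.ne']
    have h5 : 1 ≤ ‖ζ‖ * q₀ := by
      rw [← h4]
      exact mul_le_mul_of_nonneg_left htq (norm_nonneg _)
    linarith
  have hne := exp_sub_ne_zero hζ1
    ((kernelQuot_le_half hζ1 hκ' hκ1 hθ.le h3).2.trans_lt (by norm_num))
  have hne2 := exp_sub_ne_zero (θ := 2 * θ) hζ1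
    ((kernelQuot_le_half hζ1 hκ' hκ1 (by linarith) (by linarith)).2.trans_lt (by norm_num))
  rw [potKernel_eq_oddKernel hk hζ1.le htζ hθ hne,
    potKernel_eq_oddKernel hk hζ1.le htζ (by linarith) hne2]
  exact ⟨oddKernel_le hζ1 hκ' hκ1 hθ.le h3, abs_oddKernel_le hζ1 hκ' hκ1 hθ.le h3,
    abs_oddKernel_two_mul_sub_le hζ1 hκ' hκ1 hθ.le hθκ⟩

variable {σ : Measure ℝ} [IsFiniteMeasure σ] {T : ℝ}

theorem integrable_potKernel (hk : k ≠ 0) (hT : ∀ᵐ x ∂σ, |x| ≤ T)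
    (hi : ∀ x, Integrable (fun y => Real.log |x - y|) σ) (hθ : 0 < θ) :
    Integrable (fun t => potKernel m k t θ) σ := by
  have hq := abs_exp_neg_lt_one hθ
  have := isProbabilityMeasure_bal (m := m) hk hq
  exact (hi _).sub (logIntegrable_bal hk hq hT).integrable_pot

/-- Fubini moves the jump inside the potential; the symmetry of the mutual energy exchanges the two
measures. -/
theorem jump_pot (hk : k ≠ 0) (hT : ∀ᵐ x ∂σ, |x| ≤ T)
    (hi : ∀ x, Integrable (fun y => Real.log |x - y|) σ) (hθ : 0 < θ) :
    jump m k (pot σ) θ = ∫ t, potKernel m k t θ ∂σ := by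
  have hq := abs_exp_neg_lt_one hθ
  have := isProbabilityMeasure_bal (m := m) hk hq
  have h := logIntegrable_bal (m := m) hk hq hT
  unfold potKernel
  rw [integral_sub (hi _) h.integrable_pot, jump, ← mutualEnergy_eq_integral_pot h,
    ← mutualEnergy_eq_integral_pot h.symm, mutualEnergy_comm]
  rfl

theorem integrable_pot_arcs (hk : k ≠ 0) (hT : ∀ᵐ x ∂σ, |x| ≤ T) :
    Integrable (pot σ) (arcs m k) := by
  have h := logIntegrable_bal (σ := σ) (m := m) hk (q := 0) (by simp) hT
  have := isProbabilityMeasure_bal (m := m) hk (q := 0) (by simp)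
  have h2 := h.symm.integrable_pot
  rwa [bal_zero] at h2

theorem endpointRegular_pot (hk : k ≠ 0) (hT : ∀ᵐ x ∂σ, |x| ≤ T)
    (hi : ∀ x, Integrable (fun y => Real.log |x - y|) σ) (h0 : 0 ≤ q₀) (hq₀ : q₀ < 1)
    (hout : ∀ᵐ t ∂σ, t ∈ seg m k ∨ |diskPoint m k t| ≤ q₀) :
    EndpointRegular m k (pot σ) := by
  set κ := (1 + q₀) / (1 - q₀) with hκ
  have hκ1 : 1 ≤ κ := by
    rw [hκ, le_div_iff₀ (by linarith)]
    linarith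
  have hM : 0 ≤ σ.real univ := ENNReal.toReal_nonneg
  refine ⟨integrable_pot_arcs hk hT, 200 * κ ^ 3 * σ.real univ, 1 / (8 * κ), by positivity,
    fun θ h1 h2 => ?_⟩
  rw [lt_div_iff₀ (by positivity)] at h2
  have hb := hout.mono fun t ht => potKernel_bounds hk h0 hq₀ ht h1 h2.le
  have i1 := integrable_potKernel (m := m) hk hT hi h1
  have i2 := integrable_potKernel (m := m) (θ := 2 * θ) hk hT hi (by linarith)
  rw [jump_pot hk hT hi h1, jump_pot hk hT hi (by linarith), ← integral_const_mul,
    ← integral_sub i2 (i1.const_mul 2)]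
  rw [← Real.norm_eq_abs, ← Real.norm_eq_abs]
  constructor
  · refine (norm_integral_le_of_norm_le_const (C := 5 * κ * θ) (hb.mono fun t ht => ht.2.1)).trans ?_
    have : 5 * κ ≤ 200 * κ ^ 3 := by nlinarith [pow_le_pow_right₀ hκ1 (show 1 ≤ 3 by norm_num)]
    calc 5 * κ * θ * σ.real univ ≤ 200 * κ ^ 3 * θ * σ.real univ := by gcongr
      _ = _ := by ring
  · refine (norm_integral_le_of_norm_le_const (C := 200 * κ ^ 3 * θ ^ 3)
      (hb.mono fun t ht => ht.2.2)).trans (le_of_eq ?_)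
    ring

theorem jump_pot_le [IsProbabilityMeasure σ] (hk : k ≠ 0) (hT : ∀ᵐ x ∂σ, |x| ≤ T)
    (hi : ∀ x, Integrable (fun y => Real.log |x - y|) σ) (h0 : 0 ≤ q₀) (hq₀ : q₀ < 1)
    (hout : ∀ᵐ t ∂σ, t ∈ seg m k ∨ |diskPoint m k t| ≤ q₀) (hθ : 0 < θ)
    (hθκ : θ * (8 * ((1 + q₀) / (1 - q₀))) ≤ 1) : jump m k (pot σ) θ ≤ θ := by
  rw [jump_pot hk hT hi hθ]
  calc ∫ t, potKernel m k t θ ∂σ ≤ ∫ _, θ ∂σ :=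
        integral_mono_ae (integrable_potKernel hk hT hi hθ) (integrable_const _)
          (hout.mono fun t ht => (potKernel_bounds hk h0 hq₀ ht hθ hθκ).1)
    _ = θ := by rw [integral_const, probReal_univ, one_smul]

end Jump

/-! ### Doubling, convexity and comparison of potentials near an endpoint -/

section Endpoint

/-- After `n` halvings `H(θ)` is at least `2^n H(θ/2^n)` minus a convergent sum of cubic errors. In
`2^n H(θ/2^n)` the quadratic term of the lower bound tends to 0, and the linear one stays as small
as desired. -/
theorem lower_bound_of_doubling {H : ℝ → ℝ} {C θ₀ : ℝ}
    (hdbl : ∀ θ, 0 < θ → θ < θ₀ → |H (2 * θ) - 2 * H θ| ≤ C * θ ^ 3)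
    (hlow : ∀ ε, 0 < ε → ∃ M θ₁ : ℝ, 0 < θ₁ ∧ ∀ θ, 0 < θ → θ < θ₁ → -(M * θ ^ 2 + ε * θ) ≤ H θ)
    {θ : ℝ} (h0 : 0 < θ) (h1 : θ < θ₀) : -(C * θ ^ 3) ≤ H θ := by
  have hC : 0 ≤ C := by
    have h2 := (abs_nonneg _).trans (hdbl θ h0 h1)
    exact nonneg_of_mul_nonneg_left h2 (by positivity)
  have hind : ∀ n : ℕ, 2 ^ n * H (θ / 2 ^ n) - C * θ ^ 3 * (1 - 1 / 2 ^ n) ≤ H θ := by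
    intro n
    induction n with
    | zero => simp
    | succ n ih =>
      refine le_trans ?_ ih
      have hp : (0 : ℝ) < 2 ^ n := by positivity
      have hp1 : (1 : ℝ) ≤ 2 ^ n := one_le_pow₀ one_le_two
      have h2 := (abs_le.1 (hdbl (θ / 2 ^ (n + 1)) (by positivity)
        ((div_le_self h0.le (one_le_pow₀ one_le_two)).trans_lt h1))).1
      have h3 : 2 * (θ / 2 ^ (n + 1)) = θ / 2 ^ n := by
        rw [pow_succ]
        field_simp
      rw [h3] at h2
      have h4 : 2 ^ n * (C * (θ / 2 ^ (n + 1)) ^ 3) ≤ C * θ ^ 3 * (1 / 2 ^ (n + 1)) := by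
        have : 2 ^ n * (C * (θ / 2 ^ (n + 1)) ^ 3) =
            C * θ ^ 3 * ((1 / 2 ^ (n + 1)) * (1 / (4 * 2 ^ n))) := by
          rw [pow_succ (2 : ℝ) n]
          field_simp
          norm_num
        rw [this]
        refine mul_le_mul_of_nonneg_left ?_ (by positivity)
        refine mul_le_of_le_one_right (by positivity) ?_
        rw [div_le_one (by positivity)]
        linarith
      have h5 : (1 : ℝ) / 2 ^ n = 2 * (1 / 2 ^ (n + 1)) := by
        rw [pow_succ (2 : ℝ) n]
        field_simp
      have h7 : (2 : ℝ) ^ (n + 1) * H (θ / 2 ^ (n + 1)) = 2 ^ n * (2 * H (θ / 2 ^ (n + 1))) := by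
        rw [pow_succ (2 : ℝ) n]
        ring
      have h6 := mul_le_mul_of_nonneg_left h2 hp.le
      rw [h5, h7]
      linarith
  refine le_of_forall_pos_le_add fun ε hε => ?_
  -- The factor `2^n` cancels the halving in the linear term, so with this slope it costs exactly
  -- `ε/2`.
  obtain ⟨M, θ₁, hθ₁, hM⟩ := hlow (ε / (2 * θ)) (by positivity)
  have hlim : Tendsto (fun n : ℕ => θ / 2 ^ n) atTop (𝓝 0) := by
    have h2 := (tendsto_pow_atTop_nhds_zero_of_lt_one (r := (1 / 2 : ℝ)) (by norm_num)
      (by norm_num)).const_mul θ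
    rw [mul_zero] at h2
    refine h2.congr fun n => ?_
    rw [one_div, inv_pow]
    rfl
  have hev1 : ∀ᶠ n : ℕ in atTop, θ / 2 ^ n < θ₁ := hlim.eventually_lt_const hθ₁
  have hlim2 : Tendsto (fun n : ℕ => M * θ * (θ / 2 ^ n)) atTop (𝓝 0) := by
    simpa using hlim.const_mul (M * θ)
  obtain ⟨n, hn1, hn2⟩ := (hev1.and (hlim2.eventually_lt_const (half_pos hε))).exists
  have hp : (0 : ℝ) < 2 ^ n := by positivity
  have h2 := mul_le_mul_of_nonneg_left (hM (θ / 2 ^ n) (by positivity) hn1) hp.le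
  have h3 : (2 : ℝ) ^ n * -(M * (θ / 2 ^ n) ^ 2 + ε / (2 * θ) * (θ / 2 ^ n)) =
      -(M * θ * (θ / 2 ^ n) + ε / 2) := by
    field_simp
  rw [h3] at h2
  have h4 := hind n
  have h5 : C * θ ^ 3 * (1 - 1 / 2 ^ n) ≤ C * θ ^ 3 := by
    refine mul_le_of_le_one_right (by positivity) ?_
    have : (0 : ℝ) ≤ 1 / 2 ^ n := by positivity
    linarith
  linarith

theorem half_sq_le_cosh_sub_one {θ : ℝ} (hθ : 0 ≤ θ) : θ ^ 2 / 2 ≤ Real.cosh θ - 1 := by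
  have h1 : θ / 2 ≤ Real.sinh (θ / 2) := Real.self_le_sinh_iff.2 (by linarith)
  have h2 := Real.cosh_two_mul (θ / 2)
  have h3 := Real.cosh_sq (θ / 2)
  rw [show 2 * (θ / 2) = θ by ring] at h2
  nlinarith

theorem nonneg_of_convexOn_of_cosh {G : ℝ → ℝ} {s₁ C θ₀ : ℝ} (hG : ConvexOn ℝ (Ioo 1 s₁) G)
    (hθ₀ : 0 < θ₀) (hH : ∀ θ, 0 < θ → θ < θ₀ →
      |G (Real.cosh θ)| ≤ C * θ ∧ -(C * θ ^ 3) ≤ G (Real.cosh θ))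
    {s : ℝ} (hs : s ∈ Ioo 1 s₁) : 0 ≤ G s := by
  by_contra hneg
  rw [not_le] at hneg
  have hcosh : Tendsto Real.cosh (𝓝[>] 0) (𝓝 1) := by
    have : Tendsto Real.cosh (𝓝 0) (𝓝 (Real.cosh 0)) := Real.continuous_cosh.tendsto 0
    rw [Real.cosh_zero] at this
    exact this.mono_left nhdsWithin_le_nhds
  have hsmall : ∀ᶠ θ : ℝ in 𝓝[>] 0, 0 < θ ∧ θ < θ₀ := by
    filter_upwards [Ioo_mem_nhdsGT hθ₀] with θ h using h
  have hGlim : Tendsto (fun θ => G (Real.cosh θ)) (𝓝[>] 0) (𝓝 0) := by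
    have h1 : Tendsto (fun θ : ℝ => C * θ) (𝓝[>] 0) (𝓝 0) := by
      have : Tendsto (fun θ : ℝ => C * θ) (𝓝 0) (𝓝 (C * 0)) := (continuous_const_mul C).tendsto 0
      rw [mul_zero] at this
      exact this.mono_left nhdsWithin_le_nhds
    refine squeeze_zero_norm' ?_ h1
    filter_upwards [hsmall] with θ h using (hH θ h.1 h.2).1
  -- Since `G → 0` at 1, convexity puts `G` below the chord from `(1, 0)` to `(s, G s)`. At `x =
  -- cosh θ` a negative `G s` would force `G` below a negative multiple of `θ²/2`, against the bound
  -- `-Cθ³`.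
  have hbound : ∀ x, 1 < x → x < s → (s - 1) * G x ≤ (x - 1) * G s := by
    intro x hx1 hxs
    have hl : Tendsto (fun θ => (s - x) * G (Real.cosh θ) + (x - Real.cosh θ) * G s) (𝓝[>] 0)
        (𝓝 ((s - x) * 0 + (x - 1) * G s)) :=
      (hGlim.const_mul _).add ((tendsto_const_nhds.sub hcosh).mul_const _)
    have hl2 : Tendsto (fun θ => (s - Real.cosh θ) * G x) (𝓝[>] 0) (𝓝 ((s - 1) * G x)) :=
      (tendsto_const_nhds.sub hcosh).mul_const _
    rw [mul_zero, zero_add] at hl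
    refine le_of_tendsto_of_tendsto hl2 hl ?_
    filter_upwards [hsmall, hcosh.eventually_lt_const hx1] with θ h1 h2
    have h3 : 1 < Real.cosh θ := Real.one_lt_cosh.2 h1.1.ne'
    have h4 := hG.2 ⟨h3, h2.trans (hxs.trans hs.2)⟩ hs
      (show 0 ≤ (s - x) / (s - Real.cosh θ) from div_nonneg (by linarith) (by linarith))
      (show 0 ≤ (x - Real.cosh θ) / (s - Real.cosh θ) from div_nonneg (by linarith) (by linarith)) (by
        rw [← add_div, div_eq_one_iff_eq (by linarith)]
        ring)
    have hpos : 0 < s - Real.cosh θ := by linarith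
    simp only [smul_eq_mul] at h4
    have h5 : (s - x) / (s - Real.cosh θ) * Real.cosh θ + (x - Real.cosh θ) / (s - Real.cosh θ) * s
        = x := by
      field_simp
      ring
    rw [h5] at h4
    calc (s - Real.cosh θ) * G x ≤ (s - Real.cosh θ) * ((s - x) / (s - Real.cosh θ) * G (Real.cosh θ)
          + (x - Real.cosh θ) / (s - Real.cosh θ) * G s) := mul_le_mul_of_nonneg_left h4 hpos.le
      _ = _ := by field_simp
  have hl : Tendsto (fun θ : ℝ => -(C * (s - 1) * θ)) (𝓝[>] 0) (𝓝 0) := by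
    have : Tendsto (fun θ : ℝ => -(C * (s - 1) * θ)) (𝓝 0) (𝓝 (-(C * (s - 1) * 0))) :=
      (continuous_const_mul (C * (s - 1))).neg.tendsto 0
    rw [mul_zero, neg_zero] at this
    exact this.mono_left nhdsWithin_le_nhds
  have hev : ∀ᶠ θ : ℝ in 𝓝[>] 0, -(C * (s - 1) * θ) ≤ G s / 2 := by
    filter_upwards [hsmall, hcosh.eventually_lt_const hs.1] with θ h1 h2
    have h3 : 1 < Real.cosh θ := Real.one_lt_cosh.2 h1.1.ne'
    have h4 := hbound _ h3 h2
    have h5 := (hH θ h1.1 h1.2).2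
    have h6 := half_sq_le_cosh_sub_one h1.1.le
    have h7 : (Real.cosh θ - 1) * G s ≤ θ ^ 2 / 2 * G s :=
      mul_le_mul_of_nonpos_right (by linarith) hneg.le
    have h8 : (s - 1) * -(C * θ ^ 3) ≤ (s - 1) * G (Real.cosh θ) :=
      mul_le_mul_of_nonneg_left h5 (by linarith [hs.1])
    have h9 : θ ^ 2 * -(C * (s - 1) * θ) ≤ θ ^ 2 * (G s / 2) := by nlinarith
    exact le_of_mul_le_mul_left h9 (pow_pos h1.1 2)
  have := le_of_tendsto hl hev
  linarith

theorem log_sub_log_le {u v : ℝ} (hu : 0 < u) (hv : 0 < v) :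
    Real.log u - Real.log v ≤ |u - v| / v := by
  rw [← Real.log_div hu.ne' hv.ne']
  refine (Real.log_le_sub_one_of_pos (by positivity)).trans ?_
  rw [div_sub_one hv.ne']
  exact div_le_div_of_nonneg_right (le_abs_self _) hv.le

theorem abs_log_sub_log_le {η u v : ℝ} (hη : 0 < η) (hu : η ≤ u) (hv : η ≤ v) :
    |Real.log u - Real.log v| ≤ |u - v| / η := by
  have h1 := log_sub_log_le (hη.trans_le hu) (hη.trans_le hv)
  have h2 := log_sub_log_le (hη.trans_le hv) (hη.trans_le hu)
  have h3 : |u - v| / v ≤ |u - v| / η := div_le_div_of_nonneg_left (abs_nonneg _) hη hv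
  have h4 : |v - u| / u ≤ |v - u| / η := div_le_div_of_nonneg_left (abs_nonneg _) hη hu
  rw [abs_sub_comm v u] at h2 h4
  rw [abs_le]
  constructor <;> linarith

variable {μ ν : Measure ℝ} [IsFiniteMeasure μ] [IsFiniteMeasure ν]

theorem setIntegral_log_sub_far_le {η a x : ℝ} (hη : 0 < η) (hx : |x - a| < η / 2) :
    |∫ y in (Metric.ball a η)ᶜ, (Real.log |x - y| - Real.log |a - y|) ∂μ| ≤
      |x - a| / (η / 2) * μ.real univ := by
  have h : ∀ᵐ y ∂(μ.restrict (Metric.ball a η)ᶜ),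
      ‖Real.log |x - y| - Real.log |a - y|‖ ≤ |x - a| / (η / 2) := by
    filter_upwards [ae_restrict_mem Metric.isOpen_ball.measurableSet.compl] with y hy
    rw [mem_compl_iff, Metric.mem_ball, not_lt, dist_comm, Real.dist_eq] at hy
    have h1 : |a - y| ≤ |x - a| + |x - y| := by
      rw [abs_sub_comm x a]
      exact abs_sub_le a x y
    have h2 := abs_log_sub_log_le (u := |x - y|) (v := |a - y|) (half_pos hη) (by linarith)
      (by linarith)
    rw [Real.norm_eq_abs]
    refine h2.trans (div_le_div_of_nonneg_right ?_ (half_pos hη).le)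
    have h3 := abs_abs_sub_abs_le_abs_sub (x - y) (a - y)
    rwa [sub_sub_sub_cancel_right] at h3
  have h2 := norm_integral_le_of_norm_le_const h
  rw [Real.norm_eq_abs] at h2
  refine h2.trans (mul_le_mul_of_nonneg_left ?_ (by positivity))
  exact ENNReal.toReal_mono (measure_ne_top _ _) (Measure.restrict_le_self _)

/-- If `μ ≤ D ν` near `a`, where `ν` lies on one side of `a`, then `U_μ - D U_ν` is bounded by its
value at `a` plus a linear term on the other side. -/
theorem pot_sub_pot_le_of_dominated [NullSingletonClass ν] {D a η : ℝ} (hD : 0 ≤ D) (hη : 0 < η)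
    (hiμ : ∀ x, Integrable (fun y => Real.log |x - y|) μ)
    (hiν : ∀ x, Integrable (fun y => Real.log |x - y|) ν)
    (hdom : μ.restrict (Metric.ball a η) ≤ ENNReal.ofReal D • ν.restrict (Metric.ball a η))
    {x : ℝ} (hx : |x - a| < η / 2)
    (hside : ∀ᵐ y ∂ν, y ∈ Metric.ball a η → (x - a) * (y - a) ≤ 0) :
    (pot μ x - pot μ a) - D * (pot ν x - pot ν a) ≤
      (μ.real univ + D * ν.real univ) / (η / 2) * |x - a| := by
  have hb : MeasurableSet (Metric.ball a η) := Metric.isOpen_ball.measurableSet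
  set w : ℝ → ℝ := fun y => Real.log |x - y| - Real.log |a - y| with hw
  have iμ : Integrable w μ := (hiμ x).sub (hiμ a)
  have iν : Integrable w ν := (hiν x).sub (hiν a)
  have e1 : pot μ x - pot μ a = ∫ y in Metric.ball a η, w y ∂μ + ∫ y in (Metric.ball a η)ᶜ, w y ∂μ := by
    rw [integral_add_compl hb iμ, hw, integral_sub (hiμ x) (hiμ a)]
    rfl
  have e2 : pot ν x - pot ν a = ∫ y in Metric.ball a η, w y ∂ν + ∫ y in (Metric.ball a η)ᶜ, w y ∂ν := by
    rw [integral_add_compl hb iν, hw, integral_sub (hiν x) (hiν a)]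
    rfl
  -- Near `a` the mass of `ν` lies on the side opposite to `x`, so `|x - y| ≥ |a - y|`. The
  -- integrand is nonnegative there, and the domination of measures may be integrated; the far part
  -- is Lipschitz.
  have hnn : ∀ᵐ y ∂(ν.restrict (Metric.ball a η)), 0 ≤ w y := by
    filter_upwards [ae_restrict_mem hb, ae_restrict_of_ae hside, ae_restrict_of_ae
      (measure_eq_zero_iff_ae_notMem.1 (measure_singleton (μ := ν) a))] with y h1 h2 h3
    have h4 := h2 h1
    have h5 : 0 < |a - y| := abs_pos.2 fun h => h3 (by simp; linarith)
    refine sub_nonneg.2 (Real.log_le_log h5 ?_)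
    refine sq_le_sq.1 ?_
    nlinarith [sq_nonneg (x - a)]
  have h1 : ∫ y in Metric.ball a η, w y ∂μ ≤ D * ∫ y in Metric.ball a η, w y ∂ν := by
    have h2 := integral_mono_measure hdom
      (Measure.smul_absolutelyContinuous.ae_le hnn) (iν.restrict.smul_measure ENNReal.ofReal_ne_top)
    rwa [integral_smul_measure, ENNReal.toReal_ofReal hD, smul_eq_mul] at h2
  have h2 := (abs_le.1 (setIntegral_log_sub_far_le (μ := μ) hη hx)).2
  have h3 := (abs_le.1 (setIntegral_log_sub_far_le (μ := ν) hη hx)).1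
  have h4 := mul_le_mul_of_nonneg_left h3 hD
  rw [e1, e2]
  have h5 : (μ.real univ + D * ν.real univ) / (η / 2) * |x - a| =
      |x - a| / (η / 2) * μ.real univ + D * (|x - a| / (η / 2) * ν.real univ) := by ring
  rw [h5]
  linarith

end Endpoint

/-! ### Nonnegativity next to an endpoint -/

section EndpointNonneg

variable {μ ν : Measure ℝ} [IsProbabilityMeasure μ] [IsProbabilityMeasure ν]

theorem nonneg_of_endpoint {m k q₀ T I lam₀ d s₁ : ℝ} {L : ℝ → ℝ} (hk : k ≠ 0)
    [NullSingletonClass ν]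
    (hμT : ∀ᵐ x ∂μ, |x| ≤ T) (hνT : ∀ᵐ x ∂ν, |x| ≤ T)
    (hiμ : ∀ x, Integrable (fun y => Real.log |x - y|) μ)
    (hiν : ∀ x, Integrable (fun y => Real.log |x - y|) ν)
    (h0 : 0 ≤ q₀) (hq₀ : q₀ < 1)
    (houtμ : ∀ᵐ t ∂μ, t ∈ seg m k ∨ |diskPoint m k t| ≤ q₀)
    (houtν : ∀ᵐ t ∂ν, t ∈ seg m k ∨ |diskPoint m k t| ≤ q₀)
    (hL : EndpointRegular m k L) (hLd : DifferentiableAt ℝ L (m + k))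
    (hLμ : ∀ᵐ x ∂(volume.restrict (seg m k)), L x = lam₀ * pot μ x)
    (hLa : L (m + k) = lam₀ * pot μ (m + k))
    (hν : ∀ᵐ x ∂(volume.restrict (seg m k)), pot ν x = I) (hνge : ∀ x, I ≤ pot ν x)
    (hlam₀ : 0 < lam₀) (hd : 0 ≤ d)
    (hdom : ∀ ε, 0 < ε → ∃ η, 0 < η ∧ μ.restrict (Metric.ball (m + k) η) ≤
      ENNReal.ofReal (d + ε) • ν.restrict (Metric.ball (m + k) η))
    (hside : ∃ η, 0 < η ∧ ∀ᵐ y ∂ν, y ∈ Metric.ball (m + k) η → y ∈ seg m k)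
    (hconv : ConvexOn ℝ (Ioo 1 s₁) fun s =>
      L (m + k * s) - lam₀ * pot μ (m + k * s) + lam₀ * d * (pot ν (m + k * s) - I))
    {s : ℝ} (hs : s ∈ Ioo 1 s₁) :
    0 ≤ L (m + k * s) - lam₀ * pot μ (m + k * s) + lam₀ * d * (pot ν (m + k * s) - I) := by
  set g : ℝ → ℝ := fun x => L x + (-lam₀) * pot μ x + lam₀ * d * (pot ν x + (-I)) with hg
  have hge : ∀ x, L x - lam₀ * pot μ x + lam₀ * d * (pot ν x - I) = g x := fun x => by
    simp only [hg]
    ring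
  simp_rw [hge] at hconv ⊢
  have rν := endpointRegular_pot hk hνT hiν h0 hq₀ houtν
  have hreg : EndpointRegular m k g :=
    (hL.add hk ((endpointRegular_pot hk hμT hiμ h0 hq₀ houtμ).const_mul _)).add hk
      ((rν.add hk (endpointRegular_const hk _)).const_mul _)
  have hvol : ∀ {P : ℝ → Prop} {q : ℝ}, (∀ᵐ x ∂(volume.restrict (seg m k)), P x) →
      ∀ᵐ x ∂(bal m k q), P x := by
    intro P q h
    rw [ae_restrict_iff' (show MeasurableSet (seg m k) from measurableSet_Icc)] at h
    filter_upwards [(absolutelyContinuous_bal hk).ae_le h, ae_bal_mem_seg] with x h1 h2 using h1 h2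
  -- The function `g` vanishes almost everywhere on the band and balayage measures are absolutely
  -- continuous, so the subtracted integral is 0. The endpoint regularity of `g` thus concerns `g`
  -- itself.
  have hjump : ∀ θ, 0 < θ → jump m k g θ = g (m + k * Real.cosh θ) := by
    intro θ hθ
    rw [jump, integral_eq_zero_of_ae, sub_zero]
    filter_upwards [hvol hLμ, hvol hν] with x h1 h2
    simp only [hg, h1, h2, Pi.zero_apply]
    ring
  have hjumpν : ∀ θ, 0 < θ → jump m k (pot ν) θ = pot ν (m + k * Real.cosh θ) - I := by
    intro θ hθ
    have := isProbabilityMeasure_bal (m := m) hk (abs_exp_neg_lt_one hθ)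
    rw [jump, integral_congr_ae (hvol hν), integral_const, probReal_univ, one_smul]
  obtain ⟨-, C, θ₀, hθ₀, hC⟩ := hreg
  refine nonneg_of_convexOn_of_cosh (G := fun s => g (m + k * s)) (C := C) hconv hθ₀ (fun θ h1 h2 => ?_) hs
  refine ⟨by rw [← hjump θ h1]; exact (hC θ h1 h2).1, ?_⟩
  refine lower_bound_of_doubling (H := fun θ => g (m + k * Real.cosh θ)) (C := C) (θ₀ := θ₀)
    (fun θ h1 h2 => ?_) (fun ε hε => ?_) h1 h2
  · have := (hC θ h1 h2).2
    rwa [hjump θ h1, hjump (2 * θ) (by linarith)] at this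
  -- The excess `ε'` in the domination of measures enters with the factor `lam₀`.
  set ε' := ε / lam₀ with hε'
  have hε'0 : 0 < ε' := by positivity
  obtain ⟨η₁, hη₁, hdom⟩ := hdom ε' hε'0
  obtain ⟨η₂, hη₂, hside⟩ := hside
  set a := m + k with ha
  set η := min η₁ η₂ with hη
  have hη0 : 0 < η := lt_min hη₁ hη₂
  have hdom' : μ.restrict (Metric.ball a η) ≤ ENNReal.ofReal (d + ε') • ν.restrict (Metric.ball a η) := by
    have hsub : Metric.ball a η ⊆ Metric.ball a η₁ := Metric.ball_subset_ball (min_le_left _ _)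
    have h3 := Measure.restrict_mono_measure hdom (Metric.ball a η)
    rwa [Measure.restrict_smul, Measure.restrict_restrict_of_subset hsub,
      Measure.restrict_restrict_of_subset hsub] at h3
  obtain ⟨M₁, hM₁⟩ := hLd.isBigO_sub.bound
  obtain ⟨η₃, hη₃, hM₁⟩ := Metric.eventually_nhds_iff_ball.1 hM₁
  set M₂ := (μ.real univ + (d + ε') * ν.real univ) / (η / 2) with hM₂
  have hM₂0 : 0 ≤ M₂ := by
    simp only [hM₂, probReal_univ]
    positivity
  set κ := (1 + q₀) / (1 - q₀) with hκ
  have hκ0 : 0 < κ := div_pos (by linarith) (by linarith)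
  have hcosh : Tendsto (fun θ => |k| * (Real.cosh θ - 1)) (𝓝[>] 0) (𝓝 0) := by
    have h3 : Tendsto (fun θ => |k| * (Real.cosh θ - 1)) (𝓝 0) (𝓝 (|k| * (Real.cosh 0 - 1))) :=
      ((Real.continuous_cosh.sub continuous_const).const_mul _).tendsto 0
    rw [Real.cosh_zero, sub_self, mul_zero] at h3
    exact h3.mono_left nhdsWithin_le_nhds
  have hev : ∀ᶠ θ : ℝ in 𝓝[>] 0, -((|M₁| + lam₀ * M₂) * |k| * θ ^ 2 + ε * θ) ≤
      g (m + k * Real.cosh θ) := by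
    filter_upwards [hcosh.eventually_lt_const (half_pos hη0), hcosh.eventually_lt_const hη₃,
      Ioo_mem_nhdsGT (show (0 : ℝ) < 1 / (8 * κ) by positivity),
      Ioo_mem_nhdsGT (show (0 : ℝ) < 1 by norm_num)] with θ h3 h4 h5 h6
    set x := m + k * Real.cosh θ with hx
    have hc := Real.one_le_cosh θ
    have hxa : x - a = k * (Real.cosh θ - 1) := by
      rw [hx, ha]
      ring
    have hxa' : |x - a| = |k| * (Real.cosh θ - 1) := by
      rw [hxa, abs_mul, abs_of_nonneg (a := Real.cosh θ - 1) (by linarith)]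
    have h7 := pot_sub_pot_le_of_dominated (D := d + ε') (by positivity) hη0 hiμ hiν hdom'
      (x := x) (by rw [hxa']; exact h3) (by
        filter_upwards [hside] with y hy hyb
        have hy' := hy (Metric.ball_subset_ball (min_le_right _ _) hyb)
        have h8 : k * (y - a) ≤ 0 := by
          rcases lt_or_gt_of_ne hk with hk0 | hk0
          · have := hy'.1
            rw [abs_of_neg hk0] at this
            nlinarith
          · have := hy'.2
            rw [abs_of_pos hk0] at this
            nlinarith
        rw [hxa, mul_right_comm]
        exact mul_nonpos_of_nonpos_of_nonneg h8 (by linarith))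
    rw [← hM₂] at h7
    have h8 := hM₁ x (by rw [Metric.mem_ball, Real.dist_eq, hxa']; exact h4)
    rw [Real.norm_eq_abs, Real.norm_eq_abs] at h8
    have h9 := jump_pot_le (m := m) hk hνT hiν h0 hq₀ houtν h5.1 (by
      have := h5.2
      rw [lt_div_iff₀ (by positivity)] at this
      exact this.le)
    rw [hjumpν θ h5.1] at h9
    have h10 : |x - a| ≤ |k| * θ ^ 2 := by
      rw [hxa']
      exact mul_le_mul_of_nonneg_left (cosh_sub_one_le h6.1.le h6.2.le) (abs_nonneg k)
    have h11 : M₁ * |x - a| ≤ |M₁| * |x - a| :=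
      mul_le_mul_of_nonneg_right (le_abs_self _) (abs_nonneg _)
    have h12 := (abs_le.1 h8).1
    have h13 := mul_le_mul_of_nonneg_left h7 hlam₀.le
    have h14 : lam₀ * ε' = ε := by
      rw [hε']
      field_simp
    have h15 : 0 ≤ lam₀ * (d + ε') * (pot ν a - I) :=
      mul_nonneg (by positivity) (sub_nonneg.2 (hνge a))
    have h16 : ε * (pot ν x - I) ≤ ε * θ := mul_le_mul_of_nonneg_left h9 hε.le
    have h17 : (|M₁| + lam₀ * M₂) * |x - a| ≤ (|M₁| + lam₀ * M₂) * (|k| * θ ^ 2) :=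
      mul_le_mul_of_nonneg_left h10 (by positivity)
    -- Replacing `d` by `d + ε'` costs `ε (U_ν(x) - I) ≤ ε θ`. The other differences are bounded
    -- below by a multiple of `-|x - a|`, which is `O(θ²)`, and the value at `a` is nonnegative
    -- since `U_ν ≥ I`.
    have h18 : g x = (L x - L a) - lam₀ * ((pot μ x - pot μ a) - (d + ε') * (pot ν x - pot ν a)) +
        lam₀ * (d + ε') * (pot ν a - I) - ε * (pot ν x - I) := by
      rw [← h14]
      simp only [hg]
      rw [hLa]
      ring
    rw [h18]
    linarith
  obtain ⟨θ₁, hθ₁, hsub⟩ := mem_nhdsGT_iff_exists_Ioo_subset.1 hev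
  exact ⟨_, θ₁, hθ₁, fun θ h3 h4 => hsub ⟨h3, h4⟩⟩

end EndpointNonneg

/-! ### Logarithms of polynomials as sums over complex roots -/

section RootSums

/-- `log |Q(x)|` written in terms of the complex roots of `Q`. -/
noncomputable def logRoots (Q : ℤ[X]) (x : ℝ) : ℝ :=
  Real.log ‖(Q.leadingCoeff : ℂ)‖ +
    ((Q.map (Int.castRingHom ℂ)).roots.map fun α => Real.log ‖(x : ℂ) - α‖).sum

/-- The sum of `1 / (x - α)` over the complex roots of `Q`. -/
noncomputable def invRootSum (Q : ℤ[X]) (x : ℝ) : ℝ :=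
  ((Q.map (Int.castRingHom ℂ)).roots.map fun α => (1 / ((x : ℂ) - α)).re).sum

theorem eval_map_castRingHom (Q : ℤ[X]) (x : ℝ) :
    (Q.map (Int.castRingHom ℂ)).eval (x : ℂ) = ((aeval x Q : ℝ) : ℂ) := by
  rw [eval_map]
  have h := Polynomial.hom_eval₂ Q (Int.castRingHom ℝ) Complex.ofRealHom x
  rw [aeval_def]
  have h2 : Complex.ofRealHom.comp (Int.castRingHom ℝ) = Int.castRingHom ℂ := RingHom.ext_int _ _
  rw [h2] at h
  exact h.symm

theorem norm_multiset_prod_map {ι : Type*} (s : Multiset ι) (f : ι → ℂ) :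
    ‖(s.map f).prod‖ = (s.map fun i => ‖f i‖).prod := by
  induction s using Multiset.induction_on with
  | empty => simp
  | cons i s ih => simp [ih]

theorem re_multiset_sum_map {ι : Type*} (s : Multiset ι) (f : ι → ℂ) :
    (s.map f).sum.re = (s.map fun i => (f i).re).sum := by
  induction s using Multiset.induction_on with
  | empty => simp
  | cons i s ih => simp [ih]

theorem abs_aeval_eq (Q : ℤ[X]) (x : ℝ) : |aeval x Q| = ‖(Q.leadingCoeff : ℂ)‖ *
    ((Q.map (Int.castRingHom ℂ)).roots.map fun α => ‖(x : ℂ) - α‖).prod := by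
  have h := (IsAlgClosed.splits (Q.map (Int.castRingHom ℂ))).eval_eq_prod_roots (x : ℂ)
  rw [eval_map_castRingHom, leadingCoeff_map_of_injective (RingHom.injective_int _)] at h
  have h2 := congrArg norm h
  rw [Complex.norm_real, Real.norm_eq_abs, norm_mul] at h2
  rw [h2]
  congr 1
  rw [norm_multiset_prod_map]

theorem ofReal_sub_ne_zero_of_mem_roots {Q : ℤ[X]} {x : ℝ} (h : aeval x Q ≠ 0) {α : ℂ}
    (hα : α ∈ (Q.map (Int.castRingHom ℂ)).roots) : (x : ℂ) ≠ α := by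
  rintro rfl
  have := (mem_roots'.1 hα).2
  rw [IsRoot.def, eval_map_castRingHom, Complex.ofReal_eq_zero] at this
  exact h this

theorem log_multiset_prod {ι : Type*} (s : Multiset ι) {f : ι → ℝ} (h : ∀ i ∈ s, f i ≠ 0) :
    Real.log (s.map f).prod = (s.map fun i => Real.log (f i)).sum := by
  induction s using Multiset.induction_on with
  | empty => simp
  | cons i s ih =>
    rw [Multiset.map_cons, Multiset.prod_cons, Multiset.map_cons, Multiset.sum_cons,
      Real.log_mul (h i (Multiset.mem_cons_self i s)) ?_, ih fun j hj => h j (Multiset.mem_cons_of_mem hj)]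
    refine Multiset.prod_ne_zero fun h0 => ?_
    obtain ⟨j, hj, hj0⟩ := Multiset.mem_map.1 h0
    exact h j (Multiset.mem_cons_of_mem hj) hj0

/-- The hypothesis excludes the roots. There the left side is the default `Real.log 0 = 0`, whereas
the sum over the roots loses only the vanishing factors. -/
theorem log_abs_aeval {Q : ℤ[X]} {x : ℝ} (h : aeval x Q ≠ 0) :
    Real.log |aeval x Q| = logRoots Q x := by
  have hne : ∀ α ∈ (Q.map (Int.castRingHom ℂ)).roots, ‖(x : ℂ) - α‖ ≠ 0 := fun α hα =>
    norm_ne_zero_iff.2 (sub_ne_zero.2 (ofReal_sub_ne_zero_of_mem_roots h hα))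
  have h0 := abs_ne_zero.2 h
  rw [abs_aeval_eq] at h0 ⊢
  rw [Real.log_mul (left_ne_zero_of_mul h0) (right_ne_zero_of_mul h0), log_multiset_prod _ hne]
  rfl

theorem endpointRegular_logRoots {m k : ℝ} (hk : k ≠ 0) {Q : ℤ[X]}
    (h : ∀ y ∈ seg m k, aeval y Q ≠ 0) : EndpointRegular m k (logRoots Q) :=
  (endpointRegular_const hk _).add hk (EndpointRegular.multiset_sum hk _ fun _ hα =>
    endpointRegular_log hk fun y hy => ofReal_sub_ne_zero_of_mem_roots (h y hy) hα)

theorem hasDerivAt_multiset_sum {ι : Type*} (s : Multiset ι) {f f' : ι → ℝ → ℝ} {x : ℝ}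
    (h : ∀ i ∈ s, HasDerivAt (f i) (f' i x) x) :
    HasDerivAt (fun x => (s.map fun i => f i x).sum) ((s.map fun i => f' i x).sum) x := by
  induction s using Multiset.induction_on with
  | empty => simpa using hasDerivAt_const x (0 : ℝ)
  | cons i s ih =>
    simp_rw [Multiset.map_cons, Multiset.sum_cons]
    exact (h i (Multiset.mem_cons_self i s)).add (ih fun j hj => h j (Multiset.mem_cons_of_mem hj))

/-- Formally the real part of the derivative of a complex logarithm; the squared modulus avoids the
choice of a branch. -/
theorem hasDerivAt_log_norm_sub {x : ℝ} {α : ℂ} (h : (x : ℂ) ≠ α) :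
    HasDerivAt (fun x : ℝ => Real.log ‖(x : ℂ) - α‖) (1 / ((x : ℂ) - α)).re x := by
  have hn : ∀ x : ℝ, ‖(x : ℂ) - α‖ ^ 2 = (x - α.re) ^ 2 + α.im ^ 2 := fun x => by
    rw [← Complex.normSq_eq_norm_sq, Complex.normSq_apply]
    simp
    ring
  have h1 : (fun x : ℝ => Real.log ‖(x : ℂ) - α‖) =
      fun x => Real.log ((x - α.re) ^ 2 + α.im ^ 2) / 2 := by
    ext x
    rw [← hn, Real.log_pow]
    push_cast
    ring
  have h2 : (x - α.re) ^ 2 + α.im ^ 2 ≠ 0 := by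
    rw [← hn]
    exact pow_ne_zero 2 (norm_ne_zero_iff.2 (sub_ne_zero.2 h))
  have h3 : (1 / ((x : ℂ) - α)).re = (x - α.re) / ((x - α.re) ^ 2 + α.im ^ 2) := by
    rw [one_div, Complex.inv_re, ← hn, Complex.normSq_eq_norm_sq]
    simp
  rw [h1, h3]
  have h4 : HasDerivAt (fun x : ℝ => (x - α.re) ^ 2 + α.im ^ 2) (2 * (x - α.re)) x := by
    have := (((hasDerivAt_id x).sub_const α.re).pow 2).add_const (α.im ^ 2)
    simpa using this
  refine ((h4.log h2).div_const 2).congr_deriv ?_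
  field_simp

theorem hasDerivAt_re_inv_sub {x : ℝ} {α : ℂ} (h : (x : ℂ) ≠ α) :
    HasDerivAt (fun x : ℝ => (1 / ((x : ℂ) - α)).re) (-(1 / ((x : ℂ) - α) ^ 2).re) x := by
  have h1 : HasDerivAt (fun z : ℂ => 1 / (z - α)) (-(1 / ((x : ℂ) - α) ^ 2)) (x : ℂ) := by
    have := ((hasDerivAt_id (x : ℂ)).sub_const α).inv (sub_ne_zero.2 h)
    simp only [id, one_div] at this ⊢
    refine this.congr_deriv ?_
    rw [neg_div, one_div]
  have h2 := h1.real_of_complex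
  rwa [Complex.neg_re] at h2

theorem rootSum_eq (Q : ℤ[X]) (x : ℝ) : rootSum Q x =
    ((Q.map (Int.castRingHom ℂ)).roots.map fun α => (1 / ((x : ℂ) - α) ^ 2).re).sum := by
  rw [rootSum, re_multiset_sum_map]

theorem hasDerivAt_logRoots {Q : ℤ[X]} {x : ℝ} (h : aeval x Q ≠ 0) :
    HasDerivAt (logRoots Q) (invRootSum Q x) x :=
  (hasDerivAt_multiset_sum _ (f := fun α x => Real.log ‖(x : ℂ) - α‖)
    (f' := fun α x => (1 / ((x : ℂ) - α)).re) fun _ hα =>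
    hasDerivAt_log_norm_sub (ofReal_sub_ne_zero_of_mem_roots h hα)).const_add _

theorem hasDerivAt_invRootSum {Q : ℤ[X]} {x : ℝ} (h : aeval x Q ≠ 0) :
    HasDerivAt (invRootSum Q) (-rootSum Q x) x := by
  have h1 := hasDerivAt_multiset_sum (x := x) (Q.map (Int.castRingHom ℂ)).roots
    (f := fun α x => (1 / ((x : ℂ) - α)).re) (f' := fun α x => -(1 / ((x : ℂ) - α) ^ 2).re) fun _ hα =>
    hasDerivAt_re_inv_sub (ofReal_sub_ne_zero_of_mem_roots h hα)
  have h2 : ∀ s : Multiset ℂ, (s.map fun α => -(1 / ((x : ℂ) - α) ^ 2).re).sum =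
      -(s.map fun α => (1 / ((x : ℂ) - α) ^ 2).re).sum := fun s => by
    rw [← Multiset.sum_map_neg', Multiset.map_map]
    rfl
  rw [h2, ← rootSum_eq] at h1
  exact h1

end RootSums

/-! ### Derivatives of potentials off the support -/

section PotentialDerivatives

variable {σ : Measure ℝ} [IsFiniteMeasure σ] {K : Set ℝ} {x : ℝ}

theorem exists_ball_dist_ge (hK : IsCompact K) (hσ : ∀ᵐ y ∂σ, y ∈ K) (hx : x ∉ K) :
    ∃ r, 0 < r ∧ ∀ᵐ y ∂σ, ∀ z ∈ Metric.ball x r, r ≤ |z - y| := by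
  obtain ⟨d, T, hd, h⟩ := exists_dist_bounds hK hx
  refine ⟨d / 2, half_pos hd, hσ.mono fun y hy z hz => ?_⟩
  rw [Metric.mem_ball, Real.dist_eq, abs_sub_comm] at hz
  have := abs_sub_le x z y
  linarith [(h y hy).1]

/-- Off a compact set carrying `σ` the kernel and its derivative are bounded on a small ball around
`x`, so differentiation under the integral is allowed. -/
theorem hasDerivAt_pot (hK : IsCompact K) (hσ : ∀ᵐ y ∂σ, y ∈ K) (hx : x ∉ K) :
    HasDerivAt (pot σ) (∫ y, 1 / (x - y) ∂σ) x := by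
  obtain ⟨r, hr, hb⟩ := exists_ball_dist_ge hK hσ hx
  refine (hasDerivAt_integral_of_dominated_loc_of_deriv_le (bound := fun _ => 1 / r)
    (F := fun x y => Real.log |x - y|) (F' := fun x y => 1 / (x - y))
    (Metric.ball_mem_nhds x hr)
    (Eventually.of_forall fun z => (measurable_log_abs_sub_left z).aestronglyMeasurable)
    (integrable_log_of_notMem hK hσ hx)
    (show Measurable fun y : ℝ => 1 / (x - y) by fun_prop).aestronglyMeasurable ?_
    (integrable_const _) ?_).2
  · filter_upwards [hb] with y hy z hz
    rw [Real.norm_eq_abs, abs_div, abs_one]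
    exact one_div_le_one_div_of_le hr (hy z hz)
  · filter_upwards [hb] with y hy z hz
    have h0 : z - y ≠ 0 := abs_pos.1 (hr.trans_le (hy z hz))
    simp_rw [Real.log_abs]
    exact ((hasDerivAt_id z).sub_const y).log h0

theorem hasDerivAt_integral_inv (hK : IsCompact K) (hσ : ∀ᵐ y ∂σ, y ∈ K) (hx : x ∉ K) :
    Integrable (fun y => 1 / (x - y) ^ 2) σ ∧
    HasDerivAt (fun x => ∫ y, 1 / (x - y) ∂σ) (-∫ y, 1 / (x - y) ^ 2 ∂σ) x := by
  obtain ⟨r, hr, hb⟩ := exists_ball_dist_ge hK hσ hx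
  have h1 : Integrable (fun y => 1 / (x - y)) σ := by
    refine (integrable_const (1 / r)).mono'
      (show Measurable fun y : ℝ => 1 / (x - y) by fun_prop).aestronglyMeasurable ?_
    filter_upwards [hb] with y hy
    rw [Real.norm_eq_abs, abs_div, abs_one]
    exact one_div_le_one_div_of_le hr (hy x (Metric.mem_ball_self hr))
  have h := hasDerivAt_integral_of_dominated_loc_of_deriv_le (bound := fun _ => 1 / r ^ 2) (μ := σ)
    (F := fun x y => 1 / (x - y)) (F' := fun x y => -(1 / (x - y) ^ 2))
    (Metric.ball_mem_nhds x hr)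
    (Eventually.of_forall fun z =>
      (show Measurable fun y : ℝ => 1 / (z - y) by fun_prop).aestronglyMeasurable) h1
    (show Measurable fun y : ℝ => -(1 / (x - y) ^ 2) by fun_prop).aestronglyMeasurable ?_
    (integrable_const _) ?_
  · rw [← integral_neg]
    refine ⟨?_, h.2⟩
    simpa using h.1.neg
  · filter_upwards [hb] with y hy z hz
    rw [norm_neg, Real.norm_eq_abs, abs_div, abs_one, abs_pow]
    exact one_div_le_one_div_of_le (by positivity) (pow_le_pow_left₀ hr.le (hy z hz) 2)
  · filter_upwards [hb] with y hy z hz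
    have h0 : z - y ≠ 0 := abs_pos.1 (hr.trans_le (hy z hz))
    have := ((hasDerivAt_id z).sub_const y).inv h0
    simp only [id, one_div] at this ⊢
    refine this.congr_deriv ?_
    rw [neg_div, one_div]

theorem IsDensity.integral_eq {ρ : ℝ → ℝ} {S : Set ℝ} (h : IsDensity ρ σ) (hS : MeasurableSet S)
    (hσ : ∀ᵐ y ∂σ, y ∈ S) {φ : ℝ → ℝ} (hφ : Integrable φ σ) :
    IntegrableOn (fun y => ρ y * φ y) S ∧ ∫ y, φ y ∂σ = ∫ y in S, ρ y * φ y := by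
  have hσ' : σ = (volume.restrict S).withDensity (fun y => ENNReal.ofReal (ρ y)) := by
    rw [← restrict_withDensity hS, ← h.eq_withDensity, Measure.restrict_eq_self_of_ae_mem hσ]
  have hm := h.measurable.ennreal_ofReal
  have hlt : ∀ᵐ x ∂(volume.restrict S), ENNReal.ofReal (ρ x) < ⊤ :=
    Eventually.of_forall fun _ => ENNReal.ofReal_lt_top
  rw [hσ', integrable_withDensity_iff_integrable_smul' hm hlt] at hφ
  have h2 := integral_withDensity_eq_integral_toReal_smul hm hlt φ
  rw [← hσ'] at h2
  simp only [ENNReal.toReal_ofReal (h.nonneg _), smul_eq_mul] at hφ h2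
  exact ⟨hφ, h2⟩

end PotentialDerivatives

/-! ### Convexity from positive curvature -/

section Convexity

variable {μ ν : Measure ℝ} [IsFiniteMeasure μ] [IsFiniteMeasure ν] {S : Set ℝ} {ρ ρ' : ℝ → ℝ}

theorem curvature_eq {A : Finset ℤ[X]} {lamQ : ℤ[X] → ℝ} {lam₀ d x : ℝ} (hS : IsCompact S)
    (hμS : ∀ᵐ y ∂μ, y ∈ S) (hνS : ∀ᵐ y ∂ν, y ∈ S) (hρ : IsDensity ρ μ) (hρ' : IsDensity ρ' ν)
    (hx : x ∉ S) : curvature A lamQ lam₀ S (fun y => ρ y - d * ρ' y) x =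
      ∑ Q ∈ A, lamQ Q * rootSum Q x +
        lam₀ * (∫ y, 1 / (x - y) ^ 2 ∂μ - d * ∫ y, 1 / (x - y) ^ 2 ∂ν) := by
  obtain ⟨i1, e1⟩ := hρ.integral_eq hS.measurableSet hμS (hasDerivAt_integral_inv hS hμS hx).1
  obtain ⟨i2, e2⟩ := hρ'.integral_eq hS.measurableSet hνS (hasDerivAt_integral_inv hS hνS hx).1
  rw [curvature, e1, e2, ← integral_const_mul d, ← integral_sub i1 (i2.const_mul d)]
  congr 2
  refine integral_congr_ae (Eventually.of_forall fun y => ?_)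
  show (ρ y - d * ρ' y) / (x - y) ^ 2 = ρ y * (1 / (x - y) ^ 2) - d * (ρ' y * (1 / (x - y) ^ 2))
  ring

/-- Two differentiations turn `-log` and `-U` into sums and integrals of `1 / (x - ·)²`, so the
second derivative is the curvature `K_j`. -/
theorem convexOn_of_curvature_pos {A : Finset ℤ[X]} {lamQ : ℤ[X] → ℝ} {lam₀ d c I u v : ℝ}
    (hS : IsCompact S) (hμS : ∀ᵐ y ∂μ, y ∈ S) (hνS : ∀ᵐ y ∂ν, y ∈ S) (hρ : IsDensity ρ μ)
    (hρ' : IsDensity ρ' ν) (hroot : ∀ x ∈ Ioo u v, ∀ Q ∈ A, aeval x Q ≠ 0)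
    (hout : ∀ x ∈ Ioo u v, x ∉ S)
    (hpos : ∀ x ∈ Ioo u v, 0 < curvature A lamQ lam₀ S (fun y => ρ y - d * ρ' y) x) :
    ConvexOn ℝ (Ioo u v) fun x =>
      (x - c - ∑ Q ∈ A, lamQ Q * logRoots Q x) - lam₀ * pot μ x + lam₀ * d * (pot ν x - I) := by
  have h1 : ∀ x ∈ Ioo u v, HasDerivAt (fun x =>
      (x - c - ∑ Q ∈ A, lamQ Q * logRoots Q x) - lam₀ * pot μ x + lam₀ * d * (pot ν x - I))
      ((1 - ∑ Q ∈ A, lamQ Q * invRootSum Q x) - lam₀ * ∫ y, 1 / (x - y) ∂μ +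
        lam₀ * d * ∫ y, 1 / (x - y) ∂ν) x := fun x hx =>
    ((((hasDerivAt_id x).sub_const c).sub (HasDerivAt.fun_sum fun Q hQ =>
      (hasDerivAt_logRoots (hroot x hx Q hQ)).const_mul (lamQ Q))).sub
      ((hasDerivAt_pot hS hμS (hout x hx)).const_mul lam₀)).add
      (((hasDerivAt_pot hS hνS (hout x hx)).sub_const I).const_mul (lam₀ * d))
  have h2 : ∀ x ∈ Ioo u v, HasDerivAt (fun x =>
      (1 - ∑ Q ∈ A, lamQ Q * invRootSum Q x) - lam₀ * ∫ y, 1 / (x - y) ∂μ +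
        lam₀ * d * ∫ y, 1 / (x - y) ∂ν) (curvature A lamQ lam₀ S (fun y => ρ y - d * ρ' y) x) x := by
    intro x hx
    have := ((((hasDerivAt_const x (1 : ℝ))).sub (HasDerivAt.fun_sum (u := A) fun Q hQ =>
      (hasDerivAt_invRootSum (hroot x hx Q hQ)).const_mul (lamQ Q))).sub
      ((hasDerivAt_integral_inv hS hμS (hout x hx)).2.const_mul lam₀)).add
      (((hasDerivAt_integral_inv hS hνS (hout x hx)).2).const_mul (lam₀ * d))
    refine this.congr_deriv ?_
    rw [curvature_eq hS hμS hνS hρ hρ' (hout x hx)]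
    simp only [mul_neg, Finset.sum_neg_distrib]
    ring
  refine convexOn_of_hasDerivWithinAt2_nonneg (convex_Ioo u v)
    (f' := fun x => (1 - ∑ Q ∈ A, lamQ Q * invRootSum Q x) - lam₀ * ∫ y, 1 / (x - y) ∂μ +
      lam₀ * d * ∫ y, 1 / (x - y) ∂ν) (f'' := curvature A lamQ lam₀ S (fun y => ρ y - d * ρ' y))
    (fun x hx => (h1 x hx).continuousAt.continuousWithinAt) (fun x hx => ?_) (fun x hx => ?_)
    (fun x hx => ?_)
  · rw [interior_Ioo] at hx ⊢
    exact (h1 x hx).hasDerivWithinAt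
  · rw [interior_Ioo] at hx ⊢
    exact (h2 x hx).hasDerivWithinAt
  · rw [interior_Ioo] at hx
    exact (hpos x hx).le

end Convexity

/-! ### Growth of logarithms of polynomials -/

section Growth

theorem exists_logRoots_le (Q : ℤ[X]) : ∃ C, 0 ≤ C ∧ ∀ x : ℝ, logRoots Q x ≤ C * (1 + |x|) := by
  have h : ∀ s : Multiset ℂ, ∃ C, 0 ≤ C ∧ ∀ x : ℝ,
      (s.map fun α => Real.log ‖(x : ℂ) - α‖).sum ≤ C * (1 + |x|) := by
    intro s
    induction s using Multiset.induction_on with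
    | empty => exact ⟨0, le_rfl, by simp⟩
    | cons α s ih =>
      obtain ⟨C, hC, h⟩ := ih
      refine ⟨C + (1 + ‖α‖), by positivity, fun x => ?_⟩
      rw [Multiset.map_cons, Multiset.sum_cons]
      have h1 : Real.log ‖(x : ℂ) - α‖ ≤ ‖(x : ℂ) - α‖ := Real.log_le_self (norm_nonneg _)
      have h2 : ‖(x : ℂ) - α‖ ≤ |x| + ‖α‖ := by
        have := norm_sub_le (x : ℂ) α
        rwa [Complex.norm_real] at this
      have h3 := h x
      nlinarith [mul_nonneg (norm_nonneg α) (abs_nonneg x)]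
  obtain ⟨C, hC, h⟩ := h (Q.map (Int.castRingHom ℂ)).roots
  refine ⟨|Real.log ‖(Q.leadingCoeff : ℂ)‖| + C, by positivity, fun x => ?_⟩
  have h1 := le_abs_self (Real.log ‖(Q.leadingCoeff : ℂ)‖)
  have h2 := h x
  have h3 := mul_nonneg (abs_nonneg (Real.log ‖(Q.leadingCoeff : ℂ)‖)) (abs_nonneg x)
  rw [logRoots]
  linarith

/-- Linear growth lets a finite first moment control the positive part of `log |Q|`. -/
theorem exists_log_abs_aeval_le (Q : ℤ[X]) :
    ∃ C, 0 ≤ C ∧ ∀ x : ℝ, Real.log |aeval x Q| ≤ C * (1 + |x|) := by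
  obtain ⟨C, hC, h⟩ := exists_logRoots_le Q
  refine ⟨C, hC, fun x => ?_⟩
  by_cases h0 : aeval x Q = 0
  · rw [h0, abs_zero, Real.log_zero]
    positivity
  · rw [log_abs_aeval h0]
    exact h x

theorem lintegral_ofReal_ne_top_of_le {α : Type*} [MeasurableSpace α] {μ : Measure α} {f g : α → ℝ}
    (hg : Integrable g μ) (h : ∀ᵐ x ∂μ, f x ≤ g x) : ∫⁻ x, ENNReal.ofReal (f x) ∂μ ≠ ⊤ :=
  ne_top_of_le_ne_top hg.lintegral_lt_top.ne
    (lintegral_mono_ae (h.mono fun _ hx => ENNReal.ofReal_le_ofReal hx))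

theorem ae_aeval_ne_zero {σ : Measure ℝ} [NullSingletonClass σ] {Q : ℤ[X]} (hQ : Q ≠ 0) :
    ∀ᵐ x ∂σ, aeval x Q ≠ 0 := by
  have hfin : {x : ℝ | aeval x Q = 0}.Finite := by
    refine (Q.rootSet_finite ℝ).subset fun x hx => ?_
    exact (mem_rootSet_of_ne hQ).2 hx
  exact measure_eq_zero_iff_ae_notMem.1 (hfin.countable.measure_zero σ)

end Growth

/-! ### Real-valued consequences of feasibility -/

section Feasible

variable {A : Finset ℤ[X]} {ν : Measure ℝ}

theorem IsFeasible.ae_nonneg (h : IsFeasible A ν) : ∀ᵐ x ∂ν, 0 ≤ x :=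
  (measure_eq_zero_iff_ae_notMem.1 h.nonneg_support).mono fun _ hx => not_lt.1 hx

theorem IsFeasible.integrable_id (h : IsFeasible A ν)
    (hfin : extIntegral (fun x : ℝ => (x : EReal)) ν ≠ ⊤) : Integrable (fun x : ℝ => x) ν := by
  refine ⟨measurable_id.aestronglyMeasurable, ?_⟩
  rw [hasFiniteIntegral_iff_ofReal h.ae_nonneg, lt_top_iff_ne_top]
  intro hT
  apply hfin
  have h1 : ∫⁻ x, ((x : EReal)).toENNReal ∂ν = ⊤ := by
    rw [← hT]
    rfl
  have h2 : ∫⁻ x, (-(x : EReal)).toENNReal ∂ν = 0 := by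
    rw [lintegral_eq_zero_iff' ?_]
    · filter_upwards [h.ae_nonneg] with x hx
      show ENNReal.ofReal (-x) = 0
      exact ENNReal.ofReal_of_nonpos (by linarith)
    · exact (show Measurable fun x : ℝ => ENNReal.ofReal (-x) by fun_prop).aemeasurable
  rw [extIntegral, h1, h2]
  simp

theorem IsFeasible.logEnergy_facts (h : IsFeasible A ν) (hi : Integrable (fun x : ℝ => x) ν) :
    NullSingletonClass ν ∧ LogIntegrable ν ν ∧ 0 ≤ mutualEnergy ν ν := by
  have := h.isProbability
  obtain ⟨h1, h2⟩ := ae_ne_zero_and_integrable_log_of_extIntegral_ne_bot (μ := ν.prod ν)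
    (f := fun z : ℝ × ℝ => z.1 - z.2) (by fun_prop)
    (lintegral_ofReal_ne_top_of_le (g := fun z => |z.1| + |z.2|)
      ((hi.norm.comp_fst ν).add (hi.norm.comp_snd ν))
      (Eventually.of_forall fun z => (Real.log_le_self (abs_nonneg _)).trans (abs_sub _ _)))
    (ne_bot_of_le_ne_bot (by simp) h.energy_nonneg)
  refine ⟨⟨fun x => ?_⟩, h2, ?_⟩
  -- An atom at `x` would charge the diagonal, where the kernel is `-∞`.
  · have h3 : (ν.prod ν) ({x} ×ˢ {x}) = 0 := by
      refine measure_mono_null (fun z hz => ?_) h1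
      obtain ⟨hz1, hz2⟩ := hz
      rw [mem_singleton_iff] at hz1 hz2
      simp [hz1, hz2]
    rw [Measure.prod_prod] at h3
    exact mul_self_eq_zero.1 h3
  · have h3 := h.energy_nonneg
    rw [logEnergy, extIntegral_logAbs_eq h1 h2] at h3
    exact_mod_cast h3

theorem IsFeasible.log_facts (h : IsFeasible A ν) (hi : Integrable (fun x : ℝ => x) ν) {Q : ℤ[X]}
    (hQ : Q ∈ A) : Q ≠ 0 ∧ Integrable (fun x : ℝ => Real.log |aeval x Q|) ν ∧
      0 ≤ ∫ x : ℝ, Real.log |aeval x Q| ∂ν := by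
  have := h.isProbability
  obtain ⟨C, hC, hb⟩ := exists_log_abs_aeval_le Q
  obtain ⟨h1, h2⟩ := ae_ne_zero_and_integrable_log_of_extIntegral_ne_bot (μ := ν)
    (f := fun x : ℝ => aeval x Q) (Polynomial.continuous_aeval Q).measurable
    (lintegral_ofReal_ne_top_of_le (g := fun x => C * (1 + |x|))
      (((integrable_const 1).add hi.norm).const_mul C) (Eventually.of_forall hb))
    (ne_bot_of_le_ne_bot (by simp) (h.log_nonneg Q hQ))
  refine ⟨?_, h2, ?_⟩
  · rintro rfl
    obtain ⟨x, hx⟩ := h1.exists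
    simp at hx
  · have h3 := h.log_nonneg Q hQ
    rw [extIntegral_logAbs_eq h1 h2] at h3
    exact_mod_cast h3

end Feasible

/-! ### Replacing feasible measures by measures on `[0, 18]` -/

section Truncation

theorem one_le_log_nine_half : 1 ≤ Real.log (9 / 2) := by
  rw [Real.le_log_iff_exp_le (by norm_num)]
  linarith [Real.exp_one_lt_three]

theorem seg_nine : seg 9 9 = Icc 0 18 := by
  rw [seg, abs_of_pos (by norm_num)]
  norm_num

theorem log_le_log_ratio {X : ℝ} (hX : 18 ≤ X) : Real.log (9 / 2) ≤ Real.log X :=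
  Real.log_le_log (by norm_num) (by linarith)

/-- At `X = 18` this rests on `18 ≤ (9/2)²`, and beyond it the logarithm grows more slowly than the
right side. The factor 9 is the mean of the arcsine law of `[0, 18]`, and `log (9/2)` the constant
value of its potential on that interval. -/
theorem nine_mul_log_le {X : ℝ} (hX : 18 ≤ X) : 9 * Real.log X ≤ Real.log (9 / 2) * X := by
  have h1 : Real.log 18 ≤ 2 * Real.log (9 / 2) := by
    have : Real.log 18 ≤ Real.log ((9 / 2) ^ 2) := Real.log_le_log (by norm_num) (by norm_num)
    rwa [Real.log_pow] at this
  have h2 : Real.log X ≤ Real.log 18 + (X - 18) / 18 := by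
    have h3 := Real.log_le_sub_one_of_pos (x := X / 18) (by positivity)
    rw [Real.log_div (by positivity) (by norm_num)] at h3
    linarith
  nlinarith [one_le_log_nine_half]

/-- The integral equals `log (9/2) + log |ζ|`, and `|X - α| ≤ X |ζ|`. Since `log X ≥ log (9/2)`, the
factor `log X / log (9/2) ≥ 1` absorbs `log |ζ|`. -/
theorem log_norm_sub_le {X : ℝ} (hX : 18 ≤ X) (α : ℂ) : Real.log ‖(X : ℂ) - α‖ ≤
    Real.log X / Real.log (9 / 2) * ∫ y : ℝ, Real.log ‖(y : ℂ) - α‖ ∂(arcs 9 9) := by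
  have hk : (9 : ℝ) ≠ 0 := by norm_num
  obtain ⟨ζ, hζ, hα⟩ := exists_joukowski (m := 9) hk α
  have hζ0 : ζ ≠ 0 := norm_pos_iff.1 (by linarith)
  have hint := integral_bal_log (q := 0) hk (by simp) hζ hα
  rw [bal_zero] at hint
  simp only [Complex.ofReal_zero, zero_sub, norm_neg] at hint
  rw [abs_of_pos (by norm_num)] at hint
  rw [hint]
  have hc := one_le_log_nine_half
  have hle : ‖(X : ℂ) - α‖ ≤ X * ‖ζ‖ := by
    have h1 : (X : ℂ) - α = ((X - 9 : ℝ) : ℂ) + (-(((9 / 2 : ℝ) : ℂ) * ζ) + -(((9 / 2 : ℝ) : ℂ) * ζ⁻¹)) := by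
      rw [hα]
      push_cast
      ring
    rw [h1]
    refine (norm_add_le _ _).trans ((add_le_add_right (norm_add_le _ _) _).trans ?_)
    rw [norm_neg, norm_neg, norm_mul, norm_mul, norm_inv, Complex.norm_real, Complex.norm_real,
      Real.norm_of_nonneg (by linarith), Real.norm_of_nonneg (by norm_num)]
    have h2 : ‖ζ‖⁻¹ * ‖ζ‖ = 1 := inv_mul_cancel₀ (by positivity)
    have h3 : ‖ζ‖⁻¹ ≤ 1 := inv_le_one_of_one_le₀ hζ
    have h4 : ‖ζ‖⁻¹ + ‖ζ‖ - 2 ≤ ‖ζ‖ - 1 := by linarith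
    nlinarith
  have hX1 : 1 ≤ X * ‖ζ‖ := by nlinarith
  have h5 : Real.log ‖(X : ℂ) - α‖ ≤ Real.log (X * ‖ζ‖) := by
    have := log_abs_le (u := ‖(X : ℂ) - α‖) hX1 (by rwa [abs_norm])
    rwa [abs_norm] at this
  rw [Real.log_mul (by positivity) (by positivity)] at h5
  have h6 := Real.log_nonneg hζ
  have h7 := log_le_log_ratio hX
  have h8 : Real.log (9 / 2) - Real.log ‖ζ‖ + 2 * Real.log ‖ζ‖ = Real.log (9 / 2) + Real.log ‖ζ‖ := by ring
  rw [h8, div_mul_eq_mul_div, le_div_iff₀ (by linarith)]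
  have h9 : Real.log ‖ζ‖ * Real.log (9 / 2) ≤ Real.log ‖ζ‖ * Real.log X :=
    mul_le_mul_of_nonneg_left h7 h6
  nlinarith [mul_le_mul_of_nonneg_right h5 (zero_le_one.trans hc)]

theorem integrable_logRoots_arcs {m k : ℝ} (hk : k ≠ 0) (s : Multiset ℂ) :
    Integrable (fun y : ℝ => (s.map fun α => Real.log ‖(y : ℂ) - α‖).sum) (arcs m k) ∧
      ∫ y : ℝ, (s.map fun α => Real.log ‖(y : ℂ) - α‖).sum ∂(arcs m k) =
        (s.map fun α => ∫ y : ℝ, Real.log ‖(y : ℂ) - α‖ ∂(arcs m k)).sum := by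
  induction s using Multiset.induction_on with
  | empty => simp
  | cons α s ih =>
    simp_rw [Multiset.map_cons, Multiset.sum_cons]
    exact ⟨(integrable_arcs_log hk α).add ih.1,
      by rw [integral_add (integrable_arcs_log hk α) ih.1, ih.2]⟩

/-- Summation of the estimate over the roots. The leading coefficient is a nonzero integer, so its
logarithm is nonnegative and may be enlarged by the factor `log X / log (9/2) ≥ 1`. -/
theorem log_abs_aeval_le_integral_arcs {Q : ℤ[X]} (hQ : Q ≠ 0) :
    Integrable (fun y : ℝ => Real.log |aeval y Q|) (arcs 9 9) ∧
    0 ≤ ∫ y : ℝ, Real.log |aeval y Q| ∂(arcs 9 9) ∧ ∀ X : ℝ, 18 ≤ X → Real.log |aeval X Q| ≤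
      Real.log X / Real.log (9 / 2) * ∫ y : ℝ, Real.log |aeval y Q| ∂(arcs 9 9) := by
  have hk : (9 : ℝ) ≠ 0 := by norm_num
  have : NullSingletonClass (arcs 9 9) :=
    nullSingletonClass_of_absolutelyContinuous (absolutelyContinuous_arcs hk)
  have hae : (logRoots Q) =ᵐ[arcs 9 9] fun y : ℝ => Real.log |aeval y Q| :=
    (ae_aeval_ne_zero hQ).mono fun y hy => (log_abs_aeval hy).symm
  obtain ⟨i1, e1⟩ := integrable_logRoots_arcs (m := 9) hk (Q.map (Int.castRingHom ℂ)).roots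
  have hi : Integrable (logRoots Q) (arcs 9 9) := (integrable_const _).add i1
  have he : ∫ y, logRoots Q y ∂(arcs 9 9) = Real.log ‖(Q.leadingCoeff : ℂ)‖ +
      ((Q.map (Int.castRingHom ℂ)).roots.map fun α =>
        ∫ y : ℝ, Real.log ‖(y : ℂ) - α‖ ∂(arcs 9 9)).sum := by
    unfold logRoots
    rw [integral_add (integrable_const _) i1, e1, integral_const, probReal_univ, one_smul]
  have hlc : 0 ≤ Real.log ‖(Q.leadingCoeff : ℂ)‖ := by
    refine Real.log_nonneg ?_
    rw [Complex.norm_intCast]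
    exact_mod_cast Int.one_le_abs (leadingCoeff_ne_zero.2 hQ)
  have hc := one_le_log_nine_half
  have hroot : ∀ α : ℂ, 0 ≤ ∫ y : ℝ, Real.log ‖(y : ℂ) - α‖ ∂(arcs 9 9) := by
    intro α
    obtain ⟨ζ, hζ, hα⟩ := exists_joukowski (m := 9) hk α
    have hint := integral_bal_log (q := 0) hk (by simp) hζ hα
    rw [bal_zero] at hint
    simp only [Complex.ofReal_zero, zero_sub, norm_neg] at hint
    rw [abs_of_pos (by norm_num)] at hint
    rw [hint]
    have := Real.log_nonneg hζ
    linarith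
  have hJ : 0 ≤ ∫ y, logRoots Q y ∂(arcs 9 9) := by
    rw [he]
    refine add_nonneg hlc (Multiset.sum_nonneg fun c hc => ?_)
    obtain ⟨α, -, rfl⟩ := Multiset.mem_map.1 hc
    exact hroot α
  rw [← integral_congr_ae hae]
  refine ⟨hi.congr hae, hJ, fun X hX => ?_⟩
  have hX1 := log_le_log_ratio hX
  by_cases h0 : aeval X Q = 0
  · rw [h0, abs_zero, Real.log_zero]
    exact mul_nonneg (div_nonneg (by linarith) (by linarith)) hJ
  rw [log_abs_aeval h0, he, mul_add, logRoots, ← Multiset.sum_map_mul_left]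
  refine add_le_add ?_ (Multiset.sum_map_le_sum_map _ _ fun α _ => log_norm_sub_le hX α)
  exact le_mul_of_one_le_left hlc ((one_le_div (by linarith)).2 hX1)

variable {ν : Measure ℝ} [IsProbabilityMeasure ν]

/-- For `x ≤ 18 < y` one has `|x - y| ≤ y`; for `x, y > 18` one has `|x - y| ≤ max x y ≤ x y / 18`.
-/
theorem mutualEnergy_far_le {β π : Measure ℝ} [IsFiniteMeasure β] [IsFiniteMeasure π]
    (hβ : ∀ᵐ x ∂β, x ∈ Icc 0 18) (hπ : ∀ᵐ x ∂π, 18 < x) (hi : Integrable Real.log π)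
    (h1 : LogIntegrable β π) (h2 : LogIntegrable π π) :
    mutualEnergy β π ≤ β.real univ * ∫ x, Real.log x ∂π ∧
    mutualEnergy π π ≤ 2 * π.real univ * ∫ x, Real.log x ∂π - π.real univ ^ 2 * Real.log 18 := by
  have hi1 : Integrable (fun z : ℝ × ℝ => Real.log z.2) (β.prod π) := hi.comp_snd β
  have hi2 : Integrable (fun z : ℝ × ℝ => Real.log z.2) (π.prod π) := hi.comp_snd π
  have hi3 : Integrable (fun z : ℝ × ℝ => Real.log z.1) (π.prod π) := hi.comp_fst π
  have e1 : ∫ z : ℝ × ℝ, Real.log z.2 ∂(β.prod π) = β.real univ * ∫ x, Real.log x ∂π := by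
    rw [integral_prod _ hi1]
    simp only [integral_const, smul_eq_mul]
  have e2 : ∫ z : ℝ × ℝ, Real.log z.2 ∂(π.prod π) = π.real univ * ∫ x, Real.log x ∂π := by
    rw [integral_prod _ hi2]
    simp only [integral_const, smul_eq_mul]
  have e3 : ∫ z : ℝ × ℝ, Real.log z.1 ∂(π.prod π) = π.real univ * ∫ x, Real.log x ∂π := by
    rw [integral_prod_symm _ hi3]
    simp only [integral_const, smul_eq_mul]
  constructor
  · rw [← e1]
    refine integral_mono_ae h1 hi1 ?_
    filter_upwards [Measure.quasiMeasurePreserving_fst.ae hβ,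
      Measure.quasiMeasurePreserving_snd.ae hπ] with z hz1 hz2
    refine log_abs_le (by linarith) (abs_le.2 ⟨?_, ?_⟩)
    · linarith [hz1.1]
    · linarith [hz1.2]
  · have e4 : ∫ z : ℝ × ℝ, (Real.log z.1 + Real.log z.2 - Real.log 18) ∂(π.prod π) =
        2 * π.real univ * ∫ x, Real.log x ∂π - π.real univ ^ 2 * Real.log 18 := by
      have hi4 : Integrable (fun z : ℝ × ℝ => Real.log z.1 + Real.log z.2) (π.prod π) := hi3.add hi2
      rw [integral_sub hi4 (integrable_const _), integral_add hi3 hi2, e2, e3, integral_const,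
        smul_eq_mul, ← univ_prod_univ, measureReal_prod_prod]
      ring
    rw [← e4]
    refine integral_mono_ae h2 ((hi3.add hi2).sub (integrable_const _)) ?_
    filter_upwards [Measure.quasiMeasurePreserving_fst.ae hπ,
      Measure.quasiMeasurePreserving_snd.ae hπ] with z hz1 hz2
    show _ ≤ Real.log z.1 + Real.log z.2 - Real.log 18
    rw [← Real.log_mul (by linarith) (by linarith), ← Real.log_div (by
      have : 0 < z.1 * z.2 := mul_pos (by linarith) (by linarith)
      exact this.ne') (by norm_num)]
    have h3 : z.1 ≤ z.1 * z.2 / 18 := by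
      rw [le_div_iff₀ (by norm_num)]
      nlinarith
    have h4 : z.2 ≤ z.1 * z.2 / 18 := by
      rw [le_div_iff₀ (by norm_num)]
      nlinarith
    refine log_abs_le (by linarith) (abs_le.2 ⟨?_, ?_⟩) <;> linarith

/-- Every feasible measure may be replaced by one on `[0, 18]`. -/
theorem exists_truncation {A : Finset ℤ[X]} (h : IsFeasible A ν)
    (hi : Integrable (fun x : ℝ => x) ν) :
    ∃ ν' : Measure ℝ, IsProbabilityMeasure ν' ∧ (∀ᵐ x ∂ν', x ∈ Icc 0 18) ∧ NullSingletonClass ν' ∧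
      LogIntegrable ν' ν' ∧ 0 ≤ mutualEnergy ν' ν' ∧
      (∀ Q ∈ A, Q ≠ 0 ∧ Integrable (fun x : ℝ => Real.log |aeval x Q|) ν' ∧
        0 ≤ ∫ x : ℝ, Real.log |aeval x Q| ∂ν') ∧ ∫ x, x ∂ν' ≤ ∫ x, x ∂ν := by
  obtain ⟨hns, hlog, hE⟩ := h.logEnergy_facts hi
  have hk : (9 : ℝ) ≠ 0 := by norm_num
  have hB : MeasurableSet (Iic (18 : ℝ)) := measurableSet_Iic
  set β := ν.restrict (Iic (18 : ℝ)) with hβdef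
  set π := ν.restrict (Iic (18 : ℝ))ᶜ with hπdef
  set ω := arcs 9 9 with hω
  have hsum : β + π = ν := Measure.restrict_add_restrict_compl hB
  have hβ : ∀ᵐ x ∂β, x ∈ Icc (0 : ℝ) 18 := by
    filter_upwards [ae_restrict_mem hB, ae_restrict_of_ae h.ae_nonneg] with x h1 h2 using ⟨h2, h1⟩
  have hπ : ∀ᵐ x ∂π, 18 < x := by
    filter_upwards [ae_restrict_mem hB.compl] with x h1 using not_le.1 h1
  have hβν : β ≤ ν := Measure.restrict_le_self
  have hπν : π ≤ ν := Measure.restrict_le_self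
  have iπ : Integrable (fun x : ℝ => x) π := hi.mono_measure hπν
  have iβ : Integrable (fun x : ℝ => x) β := hi.mono_measure hβν
  have ilog : Integrable Real.log π := by
    refine iπ.mono' Real.measurable_log.aestronglyMeasurable ?_
    filter_upwards [hπ] with x hx
    rw [Real.norm_of_nonneg (Real.log_nonneg (by linarith))]
    exact Real.log_le_self (by linarith)
  have hββ := hlog.mono hβν hβν
  have hβπ := hlog.mono hβν hπν
  have hππ := hlog.mono hπν hπν
  obtain ⟨far1, far2⟩ := mutualEnergy_far_le hβ hπ ilog hβπ hππ
  set ε := π.real univ with hε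
  set L := ∫ x, Real.log x ∂π with hL
  set c := Real.log (9 / 2) with hc
  have hc1 : 1 ≤ c := one_le_log_nine_half
  have hε0 : 0 ≤ ε := ENNReal.toReal_nonneg
  have hβε : β.real univ = 1 - ε := by
    have h1 : β.real univ + π.real univ = 1 := by
      rw [← measureReal_add_apply, hsum, probReal_univ]
    linarith
  have hLε : ε * c ≤ L := by
    have h1 : ∫ _, c ∂π ≤ L := integral_mono_ae (integrable_const _) ilog (hπ.mono fun x hx =>
      log_le_log_ratio hx.le)
    rwa [integral_const, smul_eq_mul] at h1
  have hLc : ε ≤ L / c := by rwa [le_div_iff₀ (by linarith)]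
  -- The far part `π` is replaced by `(L/c) ω`, the multiple of the arcsine law that compensates its
  -- loss in every constraint; `w` restores total mass 1. Since `L/c ≥ ε`, the normalisation
  -- satisfies `w ≤ 1`.
  set w := 1 / (1 - ε + L / c) with hw
  set b := w * (L / c) with hb
  have hden : 1 ≤ 1 - ε + L / c := by linarith
  have hw0 : 0 ≤ w := by positivity
  have hw1 : w ≤ 1 := (div_le_one (by linarith)).2 hden
  have hb0 : 0 ≤ b := mul_nonneg hw0 (hε0.trans hLc)
  have hwb : w * (1 - ε) + b = 1 := by
    rw [hb, ← mul_add, hw, one_div, inv_mul_cancel₀ (by linarith)]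
  set W : NNReal := ⟨w, hw0⟩ with hW
  set B : NNReal := ⟨b, hb0⟩ with hBdef
  have hns' : NullSingletonClass ω :=
    nullSingletonClass_of_absolutelyContinuous (absolutelyContinuous_arcs hk)
  have hint : ∀ f : ℝ → ℝ, Integrable f β → Integrable f ω →
      Integrable f (W • β + B • ω) ∧ ∫ x, f x ∂(W • β + B • ω) = w * ∫ x, f x ∂β + b * ∫ x, f x ∂ω := by
    intro f h1 h2
    have h3 : Integrable f (W • β) := h1.smul_measure_nnreal
    have h4 : Integrable f (B • ω) := h2.smul_measure_nnreal
    refine ⟨h3.add_measure h4, ?_⟩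
    rw [integral_add_measure h3 h4, integral_smul_nnreal_measure, integral_smul_nnreal_measure]
    rfl
  have hωseg : ∀ᵐ x ∂ω, x ∈ Icc (0 : ℝ) 18 := by
    rw [← seg_nine]
    exact ae_arcs_mem_seg
  have hβ18 : ∀ᵐ x ∂β, |x| ≤ 18 := hβ.mono fun x hx => abs_le.2 ⟨by linarith [hx.1], hx.2⟩
  have hω18 : ∀ᵐ x ∂ω, |x| ≤ 18 := hωseg.mono fun x hx => abs_le.2 ⟨by linarith [hx.1], hx.2⟩
  have lβω : LogIntegrable β ω := by
    have := logIntegrable_bal (m := 9) (q := 0) hk (by simp) hβ18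
    rwa [bal_zero] at this
  have lωω : LogIntegrable ω ω := by
    have := logIntegrable_bal (m := 9) (q := 0) hk (by simp) hω18
    rwa [bal_zero] at this
  have hpotω : ∀ x ∈ Icc (0 : ℝ) 18, pot ω x = c := by
    intro x hx
    rw [← seg_nine] at hx
    rw [hω, pot_arcs hk hx, abs_of_pos (by norm_num)]
  have eβω : mutualEnergy β ω = (1 - ε) * c := by
    rw [mutualEnergy_eq_integral_pot lβω, integral_congr_ae (hβ.mono hpotω), integral_const,
      smul_eq_mul, hβε]
  have eωω : mutualEnergy ω ω = c := by
    rw [mutualEnergy_eq_integral_pot lωω, integral_congr_ae (hωseg.mono hpotω), integral_const,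
      probReal_univ, one_smul]
  have hEν : 0 ≤ mutualEnergy β β + 2 * mutualEnergy β π + mutualEnergy π π := by
    have h1 := mutualEnergy_combination hββ hππ hβπ 1 1
    rw [one_smul, one_smul, hsum] at h1
    simp only [NNReal.coe_one] at h1
    linarith
  refine ⟨W • β + B • ω, ⟨?_⟩, ?_, ⟨fun x => ?_⟩, logIntegrable_combination hββ lωω lβω W B, ?_,
    fun Q hQ => ?_, ?_⟩
  · have h1 := (hint (fun _ => 1) (integrable_const _) (integrable_const _)).2
    simp only [integral_const, smul_eq_mul, mul_one] at h1
    rw [hβε, show ω.real univ = 1 from probReal_univ, mul_one, hwb] at h1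
    rwa [← ENNReal.toReal_eq_one_iff]
  · refine ae_add_measure_iff.2 ⟨?_, ?_⟩
    · exact Measure.smul_absolutelyContinuous.ae_le hβ
    · exact Measure.smul_absolutelyContinuous.ae_le hωseg
  · have h1 : β {x} = 0 := le_antisymm ((hβν {x}).trans (measure_singleton x).le) zero_le
    have h2 : ω {x} = 0 := measure_singleton x
    simp [h1, h2]
  · rw [mutualEnergy_combination hββ lωω lβω, eβω, eωω]
    have hbc : b * c = w * L := by
      rw [hb]
      field_simp
    have hc18 : c ≤ Real.log 18 := log_le_log_ratio le_rfl
    show 0 ≤ w ^ 2 * mutualEnergy β β + 2 * w * b * ((1 - ε) * c) + b ^ 2 * c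
    -- From `I(ν) ≥ 0` and the far bounds. With `b c = w L` the terms linear in `L` cancel in the
    -- new energy, and a sum of two nonnegative terms remains as its lower bound.
    have h1 : -(2 * L) + ε ^ 2 * Real.log 18 ≤ mutualEnergy β β := by
      rw [hβε] at far1
      nlinarith
    have h2 : w ^ 2 * (-(2 * L) + ε ^ 2 * Real.log 18) ≤ w ^ 2 * mutualEnergy β β :=
      mul_le_mul_of_nonneg_left h1 (sq_nonneg w)
    have h3 : w ^ 2 * (-(2 * L) + ε ^ 2 * Real.log 18) + 2 * w * b * ((1 - ε) * c) + b ^ 2 * c =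
        c * (b - w * ε) ^ 2 + (w * ε) ^ 2 * (Real.log 18 - c) := by
      linear_combination (2 * w) * hbc
    have h4 : 0 ≤ c * (b - w * ε) ^ 2 + (w * ε) ^ 2 * (Real.log 18 - c) :=
      add_nonneg (mul_nonneg (by linarith) (sq_nonneg _)) (mul_nonneg (sq_nonneg _) (by linarith))
    linarith
  · obtain ⟨hQ0, iQ, hQν⟩ := h.log_facts hi hQ
    obtain ⟨iω, -, hX⟩ := log_abs_aeval_le_integral_arcs hQ0
    obtain ⟨h1, h2⟩ := hint _ (iQ.mono_measure hβν) iω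
    refine ⟨hQ0, h1, ?_⟩
    rw [h2]
    set J := ∫ y : ℝ, Real.log |aeval y Q| ∂ω with hJ
    have h3 : ∫ x : ℝ, Real.log |aeval x Q| ∂π ≤ L / c * J := by
      have h4 : ∫ x : ℝ, Real.log |aeval x Q| ∂π ≤ ∫ x, Real.log x / c * J ∂π :=
        integral_mono_ae (iQ.mono_measure hπν) ((ilog.div_const c).mul_const J)
          (hπ.mono fun x hx => hX x hx.le)
      rwa [integral_mul_const, integral_div] at h4
    have h5 : 0 ≤ ∫ x : ℝ, Real.log |aeval x Q| ∂β + ∫ x : ℝ, Real.log |aeval x Q| ∂π := by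
      rw [← integral_add_measure (iQ.mono_measure hβν) (iQ.mono_measure hπν), hsum]
      exact hQν
    have h6 : b * J = w * (L / c * J) := by
      rw [hb]
      ring
    rw [h6, ← mul_add]
    exact mul_nonneg hw0 (by linarith)
  · have iω : Integrable (fun x : ℝ => x) ω := integrable_id_arcs 9 9
    rw [(hint _ iβ iω).2]
    have h1 : ∫ x, x ∂ω = 9 := by
      have := integral_bal_id (m := 9) (k := 9) (q := 0) hk (by simp)
      rwa [bal_zero, mul_zero, add_zero] at this
    have h2 : ∫ x, x ∂ν = ∫ x, x ∂β + ∫ x, x ∂π := by rw [← integral_add_measure iβ iπ, hsum]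
    -- The replacement has first moment `9 L / c` before normalisation, no more than that of the
    -- mass removed.
    have h3 : 9 * L ≤ c * ∫ x, x ∂π := by
      rw [hL, ← integral_const_mul, ← integral_const_mul]
      exact integral_mono_ae (ilog.const_mul 9) (iπ.const_mul c)
        (hπ.mono fun x hx => nine_mul_log_le hx.le)
    have h4 : 0 ≤ ∫ x, x ∂β := integral_nonneg_of_ae (hβ.mono fun x hx => hx.1)
    have h5 : L / c * 9 ≤ ∫ x, x ∂π := by
      rw [div_mul_eq_mul_div, div_le_iff₀ (by linarith)]
      linarith
    have h6 : 0 ≤ ∫ x, x ∂π := integral_nonneg_of_ae (hπ.mono fun x hx => by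
      show (0 : ℝ) ≤ x
      linarith)
    rw [h1, h2, hb]
    have h7 : w * ∫ x, x ∂β ≤ ∫ x, x ∂β := mul_le_of_le_one_left h4 hw1
    have h8 : w * (L / c * 9) ≤ ∫ x, x ∂π :=
      (mul_le_mul_of_nonneg_left h5 hw0).trans (mul_le_of_le_one_left h6 hw1)
    linarith

end Truncation

/-! ### Weak duality and the dual equation in real numbers -/

section Duality

variable {A : Finset ℤ[X]} {μ : Measure ℝ} [IsProbabilityMeasure μ] {lamQ : ℤ[X] → ℝ}
  {lam lam₀ κ c : ℝ}

theorem le_lambdaA_of_forall_le [NullSingletonClass μ] (hμ : ∀ᵐ x ∂μ, x ∈ Icc (0 : ℝ) 18)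
    (hlog : LogIntegrable μ μ)
    (hi : ∀ x, Integrable (fun y => Real.log |x - y|) μ ∧ c ≤ pot μ x) (hlam₀ : 0 ≤ lam₀)
    (hlamQ : ∀ Q ∈ A, 0 ≤ lamQ Q)
    (hpt : ∀ x ∈ Ioo (0 : ℝ) 18, (∀ Q ∈ A, aeval x Q ≠ 0) →
      κ + ∑ Q ∈ A, lamQ Q * Real.log |aeval x Q| + lam₀ * (pot μ x - mutualEnergy μ μ / 2) ≤ x) :
    (κ : EReal) ≤ lambdaA A := by
  refine le_iInf₂ fun ν hν => ?_
  have hν : IsFeasible A ν := hν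
  by_cases htop : extIntegral (fun x : ℝ => (x : EReal)) ν = ⊤
  · rw [htop]
    exact le_top
  have := hν.isProbability
  have hint := hν.integrable_id htop
  rw [extIntegral_eq_coe_integral hint (Eventually.of_forall fun x => rfl)]
  refine EReal.coe_le_coe_iff.2 ?_
  obtain ⟨τ, hτ, hτ18, hτ0, hττ, hτE, hτQ, hle⟩ := exists_truncation hν hint
  refine le_trans ?_ hle
  have hτμ : LogIntegrable τ μ :=
    logIntegrable_of_le_pot (T := 18) (by norm_num) (ae_ae_abs_sub_le hτ18 hμ)
      (Eventually.of_forall hi)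
  -- This is `I(μ) + I(τ) ≤ 2 I(μ, τ)`; with `I(τ) ≥ 0` it gives `∫ U_μ dτ ≥ I(μ)/2`.
  have hdiff := energyDiff_nonpos (D := 18) (by norm_num) hμ hτ18
    (fun x hx y hy => abs_sub_le_of_mem_Icc hx hy) (by rw [measure_univ, measure_univ]) hlog hττ
    hτμ.symm
  have hdiff2 : mutualEnergy μ μ + mutualEnergy τ τ - 2 * mutualEnergy τ μ ≤ 0 := by
    rw [mutualEnergy_comm τ μ]
    exact hdiff
  rw [mutualEnergy_eq_integral_pot hτμ] at hdiff2
  have iτ : Integrable (fun x : ℝ => x) τ := by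
    refine (integrable_const (18 : ℝ)).mono' measurable_id.aestronglyMeasurable ?_
    filter_upwards [hτ18] with x hx
    rw [Real.norm_of_nonneg hx.1]
    exact hx.2
  have iS : Integrable (fun x : ℝ => ∑ Q ∈ A, lamQ Q * Real.log |aeval x Q|) τ :=
    integrable_finsetSum _ fun Q hQ => (hτQ Q hQ).2.1.const_mul _
  have iP : Integrable (fun x : ℝ => lam₀ * (pot μ x - mutualEnergy μ μ / 2)) τ :=
    (hτμ.integrable_pot.sub (integrable_const _)).const_mul _
  have iK : Integrable (fun x : ℝ => κ + ∑ Q ∈ A, lamQ Q * Real.log |aeval x Q|) τ :=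
    (integrable_const κ).add iS
  have hQ0 : ∀ᵐ x ∂τ, ∀ Q ∈ A, aeval x Q ≠ 0 :=
    (Filter.eventually_all_finset A).2 fun Q hQ => ae_aeval_ne_zero (hτQ Q hQ).1
  -- Finite energy excludes atoms, so the pointwise inequality may fail at 0, at 18 and at the roots
  -- of `A`.
  have hne : ∀ z : ℝ, ∀ᵐ x ∂τ, x ≠ z := fun z => by
    filter_upwards [measure_eq_zero_iff_ae_notMem.1 (measure_singleton (μ := τ) z)] with x hx h
    exact hx h
  have hmain : ∫ x, (κ + ∑ Q ∈ A, lamQ Q * Real.log |aeval x Q| +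
      lam₀ * (pot μ x - mutualEnergy μ μ / 2)) ∂τ ≤ ∫ x, x ∂τ := by
    refine integral_mono_ae (iK.add iP) iτ ?_
    filter_upwards [hτ18, hQ0, hne 0, hne 18] with x h1 h2 h3 h4
    exact hpt x ⟨lt_of_le_of_ne h1.1 (Ne.symm h3), lt_of_le_of_ne h1.2 h4⟩ h2
  rw [integral_add iK iP, integral_add (integrable_const κ) iS, integral_const_mul,
    integral_sub hτμ.integrable_pot (integrable_const _), integral_const, integral_const,
    probReal_univ, one_smul, one_smul, integral_finsetSum _ fun Q hQ => (hτQ Q hQ).2.1.const_mul _]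
    at hmain
  have hsum : 0 ≤ ∑ Q ∈ A, ∫ x, lamQ Q * Real.log |aeval x Q| ∂τ := by
    refine Finset.sum_nonneg fun Q hQ => ?_
    rw [integral_const_mul]
    exact mul_nonneg (hlamQ Q hQ) (hτQ Q hQ).2.2
  have hP : 0 ≤ lam₀ * (∫ x, pot μ x ∂τ - mutualEnergy μ μ / 2) :=
    mul_nonneg hlam₀ (by linarith)
  linarith

/-- In `EReal` the value `⊥` absorbs sums, and `-e/2` becomes `⊤` when `e = ⊥`. Either would make
the right side infinite, while the left side is a real number. -/
theorem real_eq_of_ereal_eq {x : ℝ} (hlam₀ : 0 < lam₀) {s p e : EReal} (hs : s ≠ ⊤) (hp : p ≠ ⊤)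
    (he : e ≠ ⊤) (h : (x : EReal) = lam + s + lam₀ * (p - e / 2)) :
    s ≠ ⊥ ∧ p ≠ ⊥ ∧ e ≠ ⊥ := by
  have h2 : (0 : EReal) < 2 := by norm_num
  have h2' : (2 : EReal) ≠ ⊤ := by decide
  have hs' : s ≠ ⊥ := by
    rintro rfl
    rw [EReal.add_bot, EReal.bot_add] at h
    exact EReal.coe_ne_bot x h
  have he' : e ≠ ⊥ := by
    rintro rfl
    rw [EReal.bot_div_of_pos_ne_top h2 h2', sub_eq_add_neg, EReal.neg_bot] at h
    induction p with
    | bot =>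
      rw [EReal.bot_add, EReal.coe_mul_bot_of_pos hlam₀, EReal.add_bot] at h
      exact EReal.coe_ne_bot x h
    | top => exact hp rfl
    | coe p =>
      lift s to ℝ using ⟨hs, hs'⟩
      rw [EReal.coe_add_top, EReal.coe_mul_top_of_pos hlam₀, ← EReal.coe_add, EReal.coe_add_top] at h
      exact EReal.coe_ne_top x h
  refine ⟨hs', ?_, he'⟩
  rintro rfl
  rw [sub_eq_add_neg, EReal.bot_add, EReal.coe_mul_bot_of_pos hlam₀, EReal.add_bot] at h
  exact EReal.coe_ne_bot x h

theorem sum_logAbs_cases (hlamQ : ∀ Q ∈ A, 0 < lamQ Q) (x : ℝ) :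
    (∑ Q ∈ A, (lamQ Q : EReal) * logAbs (aeval x Q) = ⊥) ∨ ((∀ Q ∈ A, aeval x Q ≠ 0) ∧
      ∑ Q ∈ A, (lamQ Q : EReal) * logAbs (aeval x Q) =
        ((∑ Q ∈ A, lamQ Q * Real.log |aeval x Q| : ℝ) : EReal)) := by
  by_cases h : ∀ Q ∈ A, aeval x Q ≠ 0
  · refine Or.inr ⟨h, ?_⟩
    have hsum := map_sum (⟨⟨((↑) : ℝ → EReal), EReal.coe_zero⟩, EReal.coe_add⟩ : ℝ →+ EReal)
      (fun Q => lamQ Q * Real.log |aeval x Q|) A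
    refine Eq.trans ?_ hsum.symm
    refine Finset.sum_congr rfl fun Q hQ => ?_
    rw [logAbs, if_neg (h Q hQ), ← EReal.coe_mul]
    rfl
  · push Not at h
    obtain ⟨Q, hQ, h0⟩ := h
    classical
    left
    rw [← Finset.add_sum_erase A _ hQ, logAbs, if_pos h0, EReal.coe_mul_bot_of_pos (hlamQ Q hQ),
      EReal.bot_add]

/-- On bounded support the positive parts are finite, so no term is `⊤`, and the equation excludes
`⊥`. Finiteness of all the quantities is thus a consequence of the equation. -/
theorem dual_facts (hμ : ∀ᵐ x ∂μ, x ∈ Icc (0 : ℝ) 18) (hlam₀ : 0 < lam₀)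
    (hlamQ : ∀ Q ∈ A, 0 < lamQ Q) {x : ℝ} (hx : x ∈ Icc (0 : ℝ) 18)
    (h : (x : EReal) = (lam : EReal) + (∑ Q ∈ A, (lamQ Q : EReal) * logAbs (aeval x Q))
        + (lam₀ : EReal) * (logPotential μ x - logEnergy μ / 2)) :
    (∀ Q ∈ A, aeval x Q ≠ 0) ∧ Integrable (fun y => Real.log |x - y|) μ ∧ LogIntegrable μ μ ∧
      x = lam + ∑ Q ∈ A, lamQ Q * Real.log |aeval x Q| +
        lam₀ * (pot μ x - mutualEnergy μ μ / 2) := by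
  have hp : ∫⁻ y, ENNReal.ofReal (Real.log |x - y|) ∂μ ≠ ⊤ :=
    lintegral_ofReal_ne_top_of_le (integrable_const (Real.log 18))
      (hμ.mono fun y hy => log_abs_le (by norm_num) (abs_sub_le_of_mem_Icc hx hy))
  have hE : ∫⁻ z : ℝ × ℝ, ENNReal.ofReal (Real.log |z.1 - z.2|) ∂(μ.prod μ) ≠ ⊤ := by
    refine lintegral_ofReal_ne_top_of_le (integrable_const (Real.log 18)) ?_
    filter_upwards [Measure.quasiMeasurePreserving_fst.ae hμ,
      Measure.quasiMeasurePreserving_snd.ae hμ] with z h1 h2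
    exact log_abs_le (by norm_num) (abs_sub_le_of_mem_Icc h1 h2)
  have hcases := sum_logAbs_cases hlamQ x
  have hs : ∑ Q ∈ A, (lamQ Q : EReal) * logAbs (aeval x Q) ≠ ⊤ := by
    rcases hcases with h1 | h1
    · rw [h1]
      exact bot_ne_top
    · rw [h1.2]
      exact EReal.coe_ne_top _
  obtain ⟨h1, h2, h3⟩ := real_eq_of_ereal_eq hlam₀ hs
    (extIntegral_logAbs_ne_top (f := fun y => x - y) hp)
    (extIntegral_logAbs_ne_top (f := fun z : ℝ × ℝ => z.1 - z.2) hE) h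
  obtain ⟨h4, h5⟩ := hcases.resolve_left h1
  obtain ⟨h6, h7⟩ := ae_ne_zero_and_integrable_log_of_extIntegral_ne_bot
    (f := fun y => x - y) (by fun_prop) hp h2
  obtain ⟨h8, h9⟩ := ae_ne_zero_and_integrable_log_of_extIntegral_ne_bot
    (f := fun z : ℝ × ℝ => z.1 - z.2) (by fun_prop) hE h3
  refine ⟨h4, h7, h9, ?_⟩
  have e1 : logPotential μ x = (pot μ x : EReal) := extIntegral_logAbs_eq h6 h7
  have e2 : logEnergy μ = (mutualEnergy μ μ : EReal) := extIntegral_logAbs_eq h8 h9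
  have e3 : (mutualEnergy μ μ : EReal) / 2 = ((mutualEnergy μ μ / 2 : ℝ) : EReal) := by
    rw [EReal.coe_div]
    rfl
  rw [h5, e1, e2, e3, ← EReal.coe_sub, ← EReal.coe_mul, ← EReal.coe_add, ← EReal.coe_add] at h
  exact EReal.coe_injective h

end Duality

/-! ### The pointwise inequality next to one band -/

section Configuration

/-- A measure `μ` satisfying the dual equation on a compact set `S`, together with the
equilibrium measure `ν` of `S`, both absolutely continuous. -/
structure DualConfiguration (A : Finset ℤ[X]) (S : Set ℝ) (μ ν : Measure ℝ) (ρ ρ' : ℝ → ℝ)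
    (lam lam₀ : ℝ) (lamQ : ℤ[X] → ℝ) : Prop where
  isCompact : IsCompact S
  subset : S ⊆ Icc 0 18
  ae_mem_left : ∀ᵐ x ∂μ, x ∈ S
  ae_mem_right : ∀ᵐ x ∂ν, x ∈ S
  density_left : IsDensity ρ μ
  density_right : IsDensity ρ' ν
  integrable_left : ∀ x, Integrable (fun y => Real.log |x - y|) μ
  integrable_right : ∀ x, Integrable (fun y => Real.log |x - y|) ν
  le_pot_right : ∀ x, mutualEnergy ν ν ≤ pot ν x
  pot_right_eq : ∀ᵐ x ∂(volume.restrict S), pot ν x = mutualEnergy ν ν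
  aeval_ne_zero : ∀ x ∈ S, ∀ Q ∈ A, aeval x Q ≠ 0
  dual_eq : ∀ x ∈ S, x = lam + ∑ Q ∈ A, lamQ Q * Real.log |aeval x Q| +
    lam₀ * (pot μ x - mutualEnergy μ μ / 2)
  pos : 0 < lam₀

variable {A : Finset ℤ[X]} {S : Set ℝ} {μ ν : Measure ℝ} [IsProbabilityMeasure μ]
  [IsProbabilityMeasure ν] {ρ ρ' : ℝ → ℝ} {lam lam₀ : ℝ} {lamQ : ℤ[X] → ℝ}

theorem IsDensity.absolutelyContinuous {σ : Measure ℝ} {ρ : ℝ → ℝ} (h : IsDensity ρ σ) :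
    σ ≪ volume := by
  rw [h.eq_withDensity]
  exact withDensity_absolutelyContinuous _ _

/-- Since `q⁻¹ = 2 (t - m)/k - q`, bounded `t` give bounded `|q|⁻¹`. This makes `log |q|` integrable
over the outer mass. -/
theorem exists_lower_bound_diskPoint {m k T : ℝ} (hk : k ≠ 0) (hT : 0 ≤ T) :
    ∃ q₁, 0 < q₁ ∧ ∀ t, t ∉ seg m k → |t - m| ≤ T → q₁ ≤ |diskPoint m k t| := by
  have hk0 := abs_pos.2 hk
  refine ⟨1 / (2 * T / |k| + 1), by positivity, fun t ht htT => ?_⟩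
  obtain ⟨hq0, hq1, -, hqt⟩ := diskPoint_spec hk ht
  set q := diskPoint m k t with hq
  have hqpos : 0 < |q| := abs_pos.2 hq0
  have h1 : q⁻¹ = 2 * (t - m) / k - q := by
    rw [hqt]
    field_simp
    ring
  have h2 : |q|⁻¹ ≤ 2 * T / |k| + 1 := by
    rw [← abs_inv, h1]
    refine (abs_sub _ _).trans (add_le_add ?_ hq1.le)
    rw [abs_div, abs_mul, abs_two]
    exact div_le_div_of_nonneg_right (by linarith) hk0.le
  rw [one_div]
  exact (inv_le_comm₀ hqpos (by positivity)).1 h2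

theorem DualConfiguration.abs_le_left
    (h : DualConfiguration A S μ ν ρ ρ' lam lam₀ lamQ) : ∀ᵐ x ∂μ, |x| ≤ 18 :=
  h.ae_mem_left.mono fun _ hx => abs_le.2 ⟨by linarith [(h.subset hx).1], (h.subset hx).2⟩

theorem DualConfiguration.abs_le_right
    (h : DualConfiguration A S μ ν ρ ρ' lam lam₀ lamQ) : ∀ᵐ x ∂ν, |x| ≤ 18 :=
  h.ae_mem_right.mono fun _ hx => abs_le.2 ⟨by linarith [(h.subset hx).1], (h.subset hx).2⟩

/-- The vanishing set of the equilibrium density must be null: there `ρ / ρ' = 0` by convention, and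
the limit of the ratio would say nothing about `ρ`. -/
theorem DualConfiguration.volume_zero_density
    (h : DualConfiguration A S μ ν ρ ρ' lam lam₀ lamQ) {m k γ : ℝ} (hk : k ≠ 0) (hγ : 0 < γ)
    (hseg : seg m k ⊆ S) (hsep : ∀ t ∈ S, t ∉ seg m k → |k| + γ ≤ |t - m|) :
    volume {x ∈ seg m k | ρ' x = 0} = 0 := by
  have hk0 := abs_pos.2 hk
  have hac := h.density_right.absolutelyContinuous
  have hq₀ : |k| / (|k| + γ) < 1 := (div_lt_one (by positivity)).2 (by linarith)
  have hdisk : ∀ t ∈ S, t ∉ seg m k → |diskPoint m k t| ≤ |k| / (|k| + γ) := by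
    intro t ht hts
    refine (diskPoint_spec hk hts).2.2.1.trans ?_
    rw [abs_div, inv_div]
    exact div_le_div_of_nonneg_left hk0.le (by positivity) (hsep t ht hts)
  have hout : ∀ᵐ t ∂ν, t ∈ seg m k ∨ |diskPoint m k t| ≤ |k| / (|k| + γ) := by
    filter_upwards [h.ae_mem_right] with t ht
    by_cases hts : t ∈ seg m k
    · exact Or.inl hts
    · exact Or.inr (hdisk t ht hts)
  have hsm : MeasurableSet (seg m k) := measurableSet_Icc
  obtain ⟨q₁, hq₁, hlow⟩ := exists_lower_bound_diskPoint (m := m) (T := 18 + |m|) hk (by positivity)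
  have hq : Integrable (fun t => Real.log |diskPoint m k t|) (ν.restrict (seg m k)ᶜ) := by
    refine (integrable_const (|(Real.log q₁)| + |(Real.log 1)|)).mono'
      (Real.measurable_log.comp (measurable_diskPoint m k).abs).aestronglyMeasurable ?_
    filter_upwards [ae_restrict_mem hsm.compl, ae_restrict_of_ae h.abs_le_right] with t h1 h2
    exact abs_log_le_of_mem hq₁ (hlow t h1 ((abs_sub _ _).trans (by linarith)))
      (diskPoint_spec hk h1).2.1.le
  have hsum := restrict_add_sweep_eq_arcs (T := 18) hk (by norm_num) (hseg.trans h.subset) hac hq₀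
    hout hq (fun x => ⟨h.integrable_right x, h.le_pot_right x⟩)
    (ae_mono (Measure.restrict_mono hseg le_rfl) h.pot_right_eq)
  have hBm : MeasurableSet {x ∈ seg m k | ρ' x = 0} :=
    hsm.inter (measurableSet_eq_fun h.density_right.measurable measurable_const)
  refine volume_eq_zero_of_measure_eq_zero hk hq₀ hout hsum hBm (fun x hx => hx.1) ?_
  rw [h.density_right.eq_withDensity, withDensity_apply _ hBm]
  refine (setLIntegral_congr_fun (g := fun _ => 0) hBm fun x hx => ?_).trans (by simp)
  have : ρ' x = 0 := hx.2
  simp [this]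

theorem DualConfiguration.exists_dominated
    (h : DualConfiguration A S μ ν ρ ρ' lam lam₀ lamQ) {m k γ d : ℝ} (hk : k ≠ 0) (hγ : 0 < γ)
    (hseg : seg m k ⊆ S) (hsep : ∀ t ∈ S, t ∉ seg m k → |k| + γ ≤ |t - m|)
    (hd : Tendsto (fun x => ρ x / ρ' x) (𝓝[S \ {m + k}] (m + k)) (𝓝 d)) (hd0 : 0 ≤ d) {ε : ℝ}
    (hε : 0 < ε) : ∃ η, 0 < η ∧ μ.restrict (Metric.ball (m + k) η) ≤
      ENNReal.ofReal (d + ε) • ν.restrict (Metric.ball (m + k) η) := by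
  have hev : ∀ᶠ x in 𝓝[S \ {m + k}] (m + k), ρ x / ρ' x < d + ε :=
    hd.eventually_lt_const (by linarith)
  obtain ⟨η₁, hη₁, hsub⟩ := Metric.mem_nhdsWithin_iff.1 hev
  refine ⟨min η₁ γ, lt_min hη₁ hγ, ?_⟩
  set B := Metric.ball (m + k) (min η₁ γ) with hB
  have hBm : MeasurableSet B := Metric.isOpen_ball.measurableSet
  have hSm := h.isCompact.measurableSet
  have hdens : ∀ {σ : Measure ℝ} {f : ℝ → ℝ}, IsDensity f σ → (∀ᵐ x ∂σ, x ∈ S) →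
      σ.restrict B = (volume.restrict (B ∩ S)).withDensity fun x => ENNReal.ofReal (f x) := by
    intro σ f hf hσ
    rw [← restrict_withDensity (hBm.inter hSm), ← hf.eq_withDensity, ← Measure.restrict_restrict hBm,
      Measure.restrict_eq_self_of_ae_mem hσ]
  rw [hdens h.density_left h.ae_mem_left, hdens h.density_right h.ae_mem_right,
    ← withDensity_smul _ h.density_right.measurable.ennreal_ofReal]
  refine withDensity_mono ?_
  have hzero := measure_eq_zero_iff_ae_notMem.1 (h.volume_zero_density hk hγ hseg hsep)
  filter_upwards [ae_restrict_mem (hBm.inter hSm), ae_restrict_of_ae hzero, ae_restrict_of_ae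
    (measure_eq_zero_iff_ae_notMem.1 (measure_singleton (μ := volume) (m + k)))] with x h1 h2 h3
  -- Within distance `γ` of the endpoint there is no other band, so positivity of `ρ'` on this band
  -- suffices.
  have h4 : x ∈ seg m k := by
    by_contra h5
    have h6 := hsep x h1.2 h5
    have h7 : |x - (m + k)| < γ := by
      have := (Metric.ball_subset_ball (min_le_right _ _)) h1.1
      rwa [Metric.mem_ball, Real.dist_eq] at this
    have h8 : |x - m| ≤ |x - (m + k)| + |k| := by
      have := abs_add_le (x - (m + k)) k
      rwa [show x - (m + k) + k = x - m by ring] at this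
    linarith
  have h5 : ρ' x ≠ 0 := fun h0 => h2 ⟨h4, h0⟩
  have h6 : 0 < ρ' x := lt_of_le_of_ne (h.density_right.nonneg x) h5.symm
  have h7 : ρ x / ρ' x < d + ε :=
    hsub ⟨Metric.ball_subset_ball (min_le_left _ _) h1.1, h1.2, h3⟩
  rw [div_lt_iff₀ h6] at h7
  rw [Pi.smul_apply, smul_eq_mul, ← ENNReal.ofReal_mul (by linarith)]
  exact ENNReal.ofReal_le_ofReal h7.le

theorem DualConfiguration.dual_eq_logRoots
    (h : DualConfiguration A S μ ν ρ ρ' lam lam₀ lamQ) {x : ℝ} (hx : x ∈ S) :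
    x - (lam - lam₀ * (mutualEnergy μ μ / 2)) - ∑ Q ∈ A, lamQ Q * logRoots Q x = lam₀ * pot μ x := by
  have h1 := h.dual_eq x hx
  have h2 : ∑ Q ∈ A, lamQ Q * Real.log |aeval x Q| = ∑ Q ∈ A, lamQ Q * logRoots Q x :=
    Finset.sum_congr rfl fun Q hQ => by rw [log_abs_aeval (h.aeval_ne_zero x hx Q hQ)]
  rw [h2] at h1
  linarith

theorem DualConfiguration.le_of_curvature_pos
    (h : DualConfiguration A S μ ν ρ ρ' lam lam₀ lamQ) {m k γ d u v s₁ δ : ℝ} (hk : k ≠ 0) (hγ : 0 < γ)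
    (hseg : seg m k ⊆ S) (hsep : ∀ t ∈ S, t ∉ seg m k → |k| + γ ≤ |t - m|)
    (hd : Tendsto (fun x => ρ x / ρ' x) (𝓝[S \ {m + k}] (m + k)) (𝓝 d)) (hdδ : d ≤ δ)
    (hE : 0 ≤ mutualEnergy ν ν)
    (huv : ∀ s, m + k * s ∈ Ioo u v ↔ s ∈ Ioo 1 s₁)
    (hroot : ∀ x ∈ Ioo u v, ∀ Q ∈ A, aeval x Q ≠ 0) (hout : ∀ x ∈ Ioo u v, x ∉ S)
    (hpos : ∀ x ∈ Ioo u v, 0 < curvature A lamQ lam₀ S (fun y => ρ y - d * ρ' y) x)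
    {x : ℝ} (hx : x ∈ Ioo u v) (hx18 : x ∈ Icc (0 : ℝ) 18) :
    lam - δ * lam₀ * Real.log 18 + ∑ Q ∈ A, lamQ Q * Real.log |aeval x Q| +
      lam₀ * (pot μ x - mutualEnergy μ μ / 2) ≤ x := by
  have hk0 := abs_pos.2 hk
  have hνs := nullSingletonClass_of_absolutelyContinuous h.density_right.absolutelyContinuous
  have hq₀ : |k| / (|k| + γ) < 1 := (div_lt_one (by positivity)).2 (by linarith)
  have hq₀0 : 0 ≤ |k| / (|k| + γ) := by positivity
  have houtS : ∀ t ∈ S, t ∈ seg m k ∨ |diskPoint m k t| ≤ |k| / (|k| + γ) := by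
    intro t ht
    by_cases hts : t ∈ seg m k
    · exact Or.inl hts
    · refine Or.inr ((diskPoint_spec hk hts).2.2.1.trans ?_)
      rw [abs_div, inv_div]
      exact div_le_div_of_nonneg_left hk0.le (by positivity) (hsep t ht hts)
  have hend : m + k ∈ seg m k := ⟨by linarith [neg_abs_le k], by linarith [le_abs_self k]⟩
  -- The endpoint is not isolated in `S`, so `d` is a genuine limit of nonnegative ratios.
  have hd0 : 0 ≤ d := by
    have hcl : m + k ∈ closure (S \ {m + k}) := by
      have h1 : Ioo (m - |k|) (m + |k|) ⊆ S \ {m + k} := by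
        refine fun y hy => ⟨hseg ⟨hy.1.le, hy.2.le⟩, fun hyk => ?_⟩
        rw [mem_singleton_iff] at hyk
        rcases abs_cases k with h2 | h2
        · linarith [hy.2]
        · linarith [hy.1]
      refine closure_mono h1 ?_
      rw [closure_Ioo (by linarith)]
      exact hend
    have := mem_closure_iff_nhdsWithin_neBot.1 hcl
    exact ge_of_tendsto' hd fun y => div_nonneg (h.density_left.nonneg y) (h.density_right.nonneg y)
  set c := lam - lam₀ * (mutualEnergy μ μ / 2) with hc
  set L : ℝ → ℝ := fun x => x - c - ∑ Q ∈ A, lamQ Q * logRoots Q x with hL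
  have hLreg : EndpointRegular m k L := by
    have h1 := ((endpointRegular_id (m := m) hk).add hk (endpointRegular_const hk (-c))).add hk
      ((EndpointRegular.sum hk A fun Q hQ => (endpointRegular_logRoots hk (Q := Q) fun y hy =>
        h.aeval_ne_zero y (hseg hy) Q hQ).const_mul (lamQ Q)).const_mul (-1))
    refine (congrArg (EndpointRegular m k) (funext fun x => ?_)).mp h1
    simp only [hL]
    ring
  have hLd : DifferentiableAt ℝ L (m + k) :=
    (((hasDerivAt_id _).sub_const c).sub (HasDerivAt.fun_sum fun Q hQ =>
      (hasDerivAt_logRoots (h.aeval_ne_zero _ (hseg hend) Q hQ)).const_mul (lamQ Q))).differentiableAt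
  have hconv := convexOn_of_curvature_pos (lamQ := lamQ) (lam₀ := lam₀) (d := d) (c := c)
    (I := mutualEnergy ν ν) h.isCompact h.ae_mem_left h.ae_mem_right h.density_left h.density_right
    hroot hout hpos
  obtain ⟨s, hsx⟩ : ∃ s, m + k * s = x := ⟨(x - m) / k, by field_simp; ring⟩
  have hs : s ∈ Ioo 1 s₁ := (huv s).1 (hsx ▸ hx)
  have key := nonneg_of_endpoint (L := L) (lam₀ := lam₀) (d := d) (s₁ := s₁) (I := mutualEnergy ν ν)
    hk h.abs_le_left h.abs_le_right h.integrable_left h.integrable_right hq₀0 hq₀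
    (h.ae_mem_left.mono houtS) (h.ae_mem_right.mono houtS) hLreg hLd
    (by
      filter_upwards [ae_restrict_mem (show MeasurableSet (seg m k) from measurableSet_Icc)] with y hy
      exact h.dual_eq_logRoots (hseg hy))
    (h.dual_eq_logRoots (hseg hend))
    (ae_mono (Measure.restrict_mono hseg le_rfl) h.pot_right_eq) h.le_pot_right h.pos hd0
    (fun ε hε => h.exists_dominated hk hγ hseg hsep hd hd0 hε)
    ⟨γ, hγ, by
      filter_upwards [h.ae_mem_right] with y hy hyb
      by_contra hys
      have h6 := hsep y hy hys
      rw [Metric.mem_ball, Real.dist_eq] at hyb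
      have h8 : |y - m| ≤ |y - (m + k)| + |k| := by
        have := abs_add_le (y - (m + k)) k
        rwa [show y - (m + k) + k = y - m by ring] at this
      linarith⟩
    ⟨convex_Ioo 1 s₁, fun s hs t ht a b ha hb hab => by
      have h1 := hconv.2 ((huv s).2 hs) ((huv t).2 ht) ha hb hab
      have h2 : a • (m + k * s) + b • (m + k * t) = m + k * (a • s + b • t) := by
        simp only [smul_eq_mul]
        linear_combination m * hab
      rwa [h2] at h1⟩ hs
  rw [hsx] at key
  have hpotν : pot ν x ≤ Real.log 18 := by
    have h1 := pot_le (ν := ν) (T := 18) (x := x) (by norm_num)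
      (h.ae_mem_right.mono fun y hy => abs_sub_le_of_mem_Icc hx18 (h.subset hy))
    rwa [probReal_univ, mul_one] at h1
  have hlog : ∑ Q ∈ A, lamQ Q * Real.log |aeval x Q| = ∑ Q ∈ A, lamQ Q * logRoots Q x :=
    Finset.sum_congr rfl fun Q hQ => by rw [log_abs_aeval (hroot x hx Q hQ)]
  -- The potential is at most `log 18` because all distances are at most 18, and the energy is
  -- nonnegative. This is the whole loss in the final bound.
  have h1 : d * (pot ν x - mutualEnergy ν ν) ≤ δ * Real.log 18 :=
    mul_le_mul hdδ (by linarith) (sub_nonneg.2 (h.le_pot_right x)) (hd0.trans hdδ)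
  have h2 := mul_le_mul_of_nonneg_left h1 h.pos.le
  rw [hlog]
  simp only [hL, hc] at key
  linarith

end Configuration

/-! ### The geometry of the bands and gaps -/

section Bands

variable {A : Finset ℤ[X]} {S : Set ℝ} {μ ν : Measure ℝ} [IsProbabilityMeasure μ]
  [IsProbabilityMeasure ν] {ρ ρ' : ℝ → ℝ} {lam lam₀ : ℝ} {lamQ : ℤ[X] → ℝ}

theorem add_le_abs_sub_midpoint {p q γ t : ℝ} (ht : t ≤ p - γ ∨ q + γ ≤ t) :
    (q - p) / 2 + γ ≤ |t - (p + q) / 2| := by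
  rcases ht with ht | ht
  · rw [abs_sub_comm]
    exact le_trans (by linarith) (le_abs_self _)
  · exact le_trans (by linarith) (le_abs_self _)

theorem DualConfiguration.le_of_mem_right
    (h : DualConfiguration A S μ ν ρ ρ' lam lam₀ lamQ) {p q v γ d δ : ℝ} (hpq : p < q) (hγ : 0 < γ)
    (hband : Icc p q ⊆ S) (hsep : ∀ t ∈ S, t ∉ Icc p q → t ≤ p - γ ∨ q + γ ≤ t)
    (hd : Tendsto (fun x => ρ x / ρ' x) (𝓝[S \ {q}] q) (𝓝 d)) (hdδ : d ≤ δ)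
    (hE : 0 ≤ mutualEnergy ν ν)
    (hroot : ∀ x ∈ Ioo q v, ∀ Q ∈ A, aeval x Q ≠ 0) (hout : ∀ x ∈ Ioo q v, x ∉ S)
    (hpos : ∀ x ∈ Ioo q v, 0 < curvature A lamQ lam₀ S (fun y => ρ y - d * ρ' y) x)
    {x : ℝ} (hx : x ∈ Ioo q v) (hx18 : x ∈ Icc (0 : ℝ) 18) :
    lam - δ * lam₀ * Real.log 18 + ∑ Q ∈ A, lamQ Q * Real.log |aeval x Q| +
      lam₀ * (pot μ x - mutualEnergy μ μ / 2) ≤ x := by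
  have hk : 0 < (q - p) / 2 := by linarith
  have hseg : seg ((p + q) / 2) ((q - p) / 2) = Icc p q := by
    rw [seg, abs_of_pos hk]
    congr 1 <;> ring
  have hmk : (p + q) / 2 + (q - p) / 2 = q := by ring
  refine h.le_of_curvature_pos (m := (p + q) / 2) (k := (q - p) / 2)
    (s₁ := (v - (p + q) / 2) / ((q - p) / 2)) hk.ne' hγ (hseg ▸ hband) (fun t ht hts => ?_)
    (by rwa [hmk]) hdδ hE (fun s => ?_) hroot hout hpos hx hx18
  · rw [hseg] at hts
    rw [abs_of_pos hk]
    exact add_le_abs_sub_midpoint (hsep t ht hts)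
  · rw [mem_Ioo, mem_Ioo, lt_div_iff₀ hk]
    constructor <;> rintro ⟨h1, h2⟩ <;> constructor <;> nlinarith

theorem DualConfiguration.le_of_mem_left
    (h : DualConfiguration A S μ ν ρ ρ' lam lam₀ lamQ) {p q u γ d δ : ℝ} (hpq : p < q) (hγ : 0 < γ)
    (hband : Icc p q ⊆ S) (hsep : ∀ t ∈ S, t ∉ Icc p q → t ≤ p - γ ∨ q + γ ≤ t)
    (hd : Tendsto (fun x => ρ x / ρ' x) (𝓝[S \ {p}] p) (𝓝 d)) (hdδ : d ≤ δ)
    (hE : 0 ≤ mutualEnergy ν ν)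
    (hroot : ∀ x ∈ Ioo u p, ∀ Q ∈ A, aeval x Q ≠ 0) (hout : ∀ x ∈ Ioo u p, x ∉ S)
    (hpos : ∀ x ∈ Ioo u p, 0 < curvature A lamQ lam₀ S (fun y => ρ y - d * ρ' y) x)
    {x : ℝ} (hx : x ∈ Ioo u p) (hx18 : x ∈ Icc (0 : ℝ) 18) :
    lam - δ * lam₀ * Real.log 18 + ∑ Q ∈ A, lamQ Q * Real.log |aeval x Q| +
      lam₀ * (pot μ x - mutualEnergy μ μ / 2) ≤ x := by
  -- A negative half-length makes `m + k` the left endpoint, and `m + k cosh θ` moves to the left.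
  have hk : (p - q) / 2 < 0 := by linarith
  have hk' : |(p - q) / 2| = (q - p) / 2 := by
    rw [abs_of_neg hk]
    ring
  have hseg : seg ((p + q) / 2) ((p - q) / 2) = Icc p q := by
    rw [seg, hk']
    congr 1 <;> ring
  have hmk : (p + q) / 2 + (p - q) / 2 = p := by ring
  refine h.le_of_curvature_pos (m := (p + q) / 2) (k := (p - q) / 2)
    (s₁ := (u - (p + q) / 2) / ((p - q) / 2)) hk.ne hγ (hseg ▸ hband) (fun t ht hts => ?_)
    (by rwa [hmk]) hdδ hE (fun s => ?_) hroot hout hpos hx hx18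
  · rw [hseg] at hts
    rw [hk']
    exact add_le_abs_sub_midpoint (hsep t ht hts)
  · rw [mem_Ioo, mem_Ioo, lt_div_iff_of_neg hk]
    constructor <;> rintro ⟨h1, h2⟩ <;> constructor <;> nlinarith

variable {l : ℕ} {a : ℕ → ℝ}

theorem mem_bands {x : ℝ} : x ∈ bands l a ↔ ∃ i ≤ l, a (2 * i) ≤ x ∧ x ≤ a (2 * i + 1) := by
  simp only [bands, mem_iUnion, Finset.mem_range, Nat.lt_succ_iff, exists_prop, mem_Icc]

theorem isCompact_bands (l : ℕ) (a : ℕ → ℝ) : IsCompact (bands l a) :=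
  (Finset.range (l + 1)).isCompact_biUnion fun _ _ => isCompact_Icc

theorem lt_of_lt_of_forall_lt_succ (ha : ∀ j, j < 2 * l + 1 → a j < a (j + 1)) {i j : ℕ}
    (hij : i < j) (hj : j ≤ 2 * l + 1) : a i < a j := by
  induction j with
  | zero => omega
  | succ j ih =>
    have h1 := ha j (by omega)
    rcases Nat.lt_succ_iff_lt_or_eq.1 hij with h2 | h2
    · exact (ih h2 (by omega)).trans h1
    · rwa [h2]

theorem le_of_le_of_forall_lt_succ (ha : ∀ j, j < 2 * l + 1 → a j < a (j + 1)) {i j : ℕ}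
    (hij : i ≤ j) (hj : j ≤ 2 * l + 1) : a i ≤ a j := by
  rcases hij.eq_or_lt with h | h
  · rw [h]
  · exact (lt_of_lt_of_forall_lt_succ ha h hj).le

theorem exists_separation (ha : ∀ j, j < 2 * l + 1 → a j < a (j + 1)) :
    ∃ γ, 0 < γ ∧ ∀ i ≤ l, ∀ t ∈ bands l a, t ∉ Icc (a (2 * i)) (a (2 * i + 1)) →
      t ≤ a (2 * i) - γ ∨ a (2 * i + 1) + γ ≤ t := by
  -- The smallest distance between consecutive endpoints separates every band from the others.
  obtain ⟨j₀, hj₀, hmin⟩ := Finset.exists_min_image (Finset.range (2 * l + 1))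
    (fun j => a (j + 1) - a j) ⟨0, by simp⟩
  refine ⟨a (j₀ + 1) - a j₀, sub_pos.2 (ha j₀ (Finset.mem_range.1 hj₀)), fun i hi t ht hts => ?_⟩
  obtain ⟨n, hn, h1, h2⟩ := mem_bands.1 ht
  rcases lt_trichotomy n i with h3 | h3 | h3
  · left
    have h4 := le_of_le_of_forall_lt_succ ha (show 2 * n + 1 ≤ 2 * i - 1 by omega) (by omega)
    have h5 := hmin (2 * i - 1) (Finset.mem_range.2 (by omega))
    rw [Nat.sub_add_cancel (by omega)] at h5
    linarith
  · exact absurd (h3 ▸ ⟨h1, h2⟩) hts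
  · right
    have h4 := le_of_le_of_forall_lt_succ ha (show 2 * i + 2 ≤ 2 * n by omega) (by omega)
    have h5 := hmin (2 * i + 1) (Finset.mem_range.2 (by omega))
    linarith

theorem notMem_bands_of_mem_gap (ha : ∀ j, j < 2 * l + 1 → a j < a (j + 1)) {i : ℕ} (hi : i < l)
    {x : ℝ} (hx : x ∈ Ioo (a (2 * i + 1)) (a (2 * (i + 1)))) : x ∉ bands l a := by
  intro h
  obtain ⟨n, hn, h1, h2⟩ := mem_bands.1 h
  rcases le_or_gt n i with h3 | h3
  · have := le_of_le_of_forall_lt_succ ha (show 2 * n + 1 ≤ 2 * i + 1 by omega) (by omega)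
    linarith [hx.1]
  · have := le_of_le_of_forall_lt_succ ha (show 2 * (i + 1) ≤ 2 * n by omega) (by omega)
    linarith [hx.2]

theorem exists_gap {x : ℝ} (h0 : a 0 ≤ x) :
    ∀ n ≤ l, x ≤ a (2 * n + 1) → x ∈ bands l a ∨ ∃ i < l, x ∈ Ioo (a (2 * i + 1)) (a (2 * (i + 1))) := by
  intro n
  induction n with
  | zero => exact fun _ h => Or.inl (mem_bands.2 ⟨0, Nat.zero_le l, h0, h⟩)
  | succ n ih =>
    intro hn h
    rcases le_or_gt (a (2 * (n + 1))) x with h1 | h1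
    · exact Or.inl (mem_bands.2 ⟨n + 1, hn, h1, h⟩)
    · rcases le_or_gt x (a (2 * n + 1)) with h2 | h2
      · exact ih (by omega) h2
      · exact Or.inr ⟨n, by omega, h2, h1⟩

/-- The dual equation expresses the potential on `S` through functions continuous on this compact
set, since no root lies on it. -/
theorem exists_le_pot_on (hS : IsCompact S) (hroot : ∀ x ∈ S, ∀ Q ∈ A, aeval x Q ≠ 0)
    (hlam₀ : 0 < lam₀)
    (hdual : ∀ x ∈ S, x = lam + ∑ Q ∈ A, lamQ Q * Real.log |aeval x Q| +
      lam₀ * (pot μ x - mutualEnergy μ μ / 2)) : ∃ c, ∀ x ∈ S, c ≤ pot μ x := by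
  have hcont : ContinuousOn (fun x : ℝ => (x - lam - ∑ Q ∈ A, lamQ Q * Real.log |aeval x Q|) / lam₀ +
      mutualEnergy μ μ / 2) S := by
    have h1 : ∀ Q ∈ A, ContinuousOn (fun x : ℝ => lamQ Q * Real.log |aeval x Q|) S := fun Q hQ =>
      continuousOn_const.mul (ContinuousOn.log (Polynomial.continuous_aeval Q).abs.continuousOn
        fun x hx => abs_ne_zero.2 (hroot x hx Q hQ))
    exact (((continuousOn_id.sub continuousOn_const).sub
      (continuousOn_finsetSum A h1)).div_const lam₀).add continuousOn_const
  obtain ⟨c, hc⟩ := (hS.image_of_continuousOn hcont).bddBelow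
  refine ⟨c, fun x hx => ?_⟩
  have h1 := hc (mem_image_of_mem _ hx)
  have h2 := hdual x hx
  have h3 : (x - lam - ∑ Q ∈ A, lamQ Q * Real.log |aeval x Q|) / lam₀ =
      pot μ x - mutualEnergy μ μ / 2 := by
    rw [div_eq_iff hlam₀.ne']
    linarith
  rw [h3] at h1
  linarith

end Bands

end TraceProblem

theorem proposition6p1
    (A : Finset ℤ[X]) (l : ℕ) (a : ℕ → ℝ)
    (ha : ∀ j, j < 2 * l + 1 → a j < a (j + 1))
    (hS : TraceProblem.bands l a ⊆ Icc 0 18)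
    (μ : Measure ℝ) [IsProbabilityMeasure μ]
    (hsupp : μ.support = TraceProblem.bands l a)
    (lam : ℝ) (lam₀ : ℝ) (lamQ : ℤ[X] → ℝ)
    (hlam : 0 < lam) (hlam₀ : 0 < lam₀) (hlamQ : ∀ Q ∈ A, 0 < lamQ Q)
    -- the dual equation holds with equality on `Σ`, in the extended reals
    (hdual : ∀ x ∈ TraceProblem.bands l a,
      (x : EReal) = (lam : EReal)
        + (∑ Q ∈ A, (lamQ Q : EReal) * TraceProblem.logAbs (aeval x Q))
        + (lam₀ : EReal) * (TraceProblem.logPotential μ x - TraceProblem.logEnergy μ / 2))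
    (μeq : Measure ℝ) (heq : TraceProblem.IsEquilibriumMeasure (TraceProblem.bands l a) μeq)
    -- the constant value `I(μeq)` of the equilibrium potential on `Σ` is nonnegative
    (hcap : 0 ≤ TraceProblem.logEnergy μeq)
    -- the roots: exactly one in each gap, and only `0` outside the convex hull of `Σ` in `[0, ∞)`
    (r : ℕ → ℝ)
    (hgap : ∀ i, i < l →
      TraceProblem.realRoots A ∩ Ioo (a (2 * i + 1)) (a (2 * (i + 1))) = {r i})
    (hout : TraceProblem.realRoots A ∩ (Ico 0 (a 0) ∪ Ioi (a (2 * l + 1))) = {0})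
    -- the densities, and the limits of their ratio at the boundary points
    (ρ ρeq : ℝ → ℝ)
    (hρ : TraceProblem.IsDensity ρ μ) (hρeq : TraceProblem.IsDensity ρeq μeq)
    (δ : ℝ) (hδ : 0 < δ) (d : ℕ → ℝ)
    (hd : ∀ j, j ≤ 2 * l + 1 →
      Tendsto (fun x => ρ x / ρeq x) (𝓝[TraceProblem.bands l a \ {a j}] (a j)) (𝓝 (d j)) ∧
        d j ≤ δ)
    -- the second-derivative conditions in the gaps
    (hleft : ∀ i, i < l → ∀ x ∈ Ioo (a (2 * i + 1)) (r i),
      0 < TraceProblem.curvature A lamQ lam₀ (TraceProblem.bands l a)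
        (fun y => ρ y - d (2 * i + 1) * ρeq y) x)
    (hright : ∀ i, i < l → ∀ x ∈ Ioo (r i) (a (2 * (i + 1))),
      0 < TraceProblem.curvature A lamQ lam₀ (TraceProblem.bands l a)
        (fun y => ρ y - d (2 * (i + 1)) * ρeq y) x)
    -- the same conditions in the two outer intervals
    (hfirst : ∀ x ∈ Ioo 0 (a 0),
      0 < TraceProblem.curvature A lamQ lam₀ (TraceProblem.bands l a)
        (fun y => ρ y - d 0 * ρeq y) x)
    (hlast : ∀ x ∈ Ioo (a (2 * l + 1)) 18,
      0 < TraceProblem.curvature A lamQ lam₀ (TraceProblem.bands l a)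
        (fun y => ρ y - d (2 * l + 1) * ρeq y) x) :
    ((lam - δ * lam₀ * Real.log 18 : ℝ) : EReal) ≤ TraceProblem.lambdaA A := by
  open TraceProblem in
  have hSc := isCompact_bands l a
  have hνp := heq.isProbability
  have hμS : ∀ᵐ x ∂μ, x ∈ bands l a := by
    rw [← hsupp]
    exact Measure.support_mem_ae
  have hνS : ∀ᵐ x ∂μeq, x ∈ bands l a :=
    (measure_eq_zero_iff_ae_notMem.1 heq.null_compl).mono fun x hx => not_not.1 hx
  have hμ18 := hμS.mono fun x hx => hS hx
  have hν18 := hνS.mono fun x hx => hS hx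
  have hfacts := fun x hx => dual_facts hμ18 hlam₀ hlamQ (hS hx) (hdual x hx)
  have hne : (bands l a).Nonempty := ⟨a 0, mem_bands.2 ⟨0, Nat.zero_le l, le_rfl, (ha 0 (by omega)).le⟩⟩
  have hlogμ : LogIntegrable μ μ := (hfacts _ hne.some_mem).2.2.1
  have hμn := nullSingletonClass_of_absolutelyContinuous hρ.absolutelyContinuous
  have hνn := nullSingletonClass_of_absolutelyContinuous hρeq.absolutelyContinuous
  obtain ⟨-, hlogν⟩ := logIntegrable_of_logEnergy_ne_bot (T := 18) (by norm_num)
    (ae_ae_abs_sub_le hν18 hν18) (ne_bot_of_le_ne_bot (by simp) hcap)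
  have hE : 0 ≤ mutualEnergy μeq μeq := by
    rw [logEnergy_eq_mutualEnergy hlogν] at hcap
    exact_mod_cast hcap
  have hroot : ∀ x ∈ bands l a, ∀ Q ∈ A, aeval x Q ≠ 0 := fun x hx => (hfacts x hx).1
  have heqn := fun x hx => (hfacts x hx).2.2.2
  obtain ⟨c, hc⟩ := exists_le_pot_on hSc hroot hlam₀ heqn
  -- The minimum principle carries the lower bound on `Σ` to the whole line, and with it the
  -- integrability of the kernel at every point.
  have hpotμ := le_pot_of_le_pot_on hSc hne hμS fun x hx => ⟨(hfacts x hx).2.1, hc x hx⟩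
  have hpotν := le_pot_of_isEquilibriumMeasure (T := 18) (by norm_num) hSc hS heq
    hρeq.absolutelyContinuous hlogν
  have H : DualConfiguration A (bands l a) μ μeq ρ ρeq lam lam₀ lamQ :=
    { isCompact := hSc
      subset := hS
      ae_mem_left := hμS
      ae_mem_right := hνS
      density_left := hρ
      density_right := hρeq
      integrable_left := fun x => (hpotμ x).1
      integrable_right := fun x => (hpotν x).1
      le_pot_right := fun x => (hpotν x).2
      pot_right_eq := ae_pot_eq_of_isEquilibriumMeasure (T := 18) (by norm_num) hSc hS heq
        hρeq.absolutelyContinuous hlogν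
      aeval_ne_zero := hroot
      dual_eq := heqn
      pos := hlam₀ }
  obtain ⟨γ, hγ, hsep⟩ := exists_separation ha
  have hband : ∀ i ≤ l, Icc (a (2 * i)) (a (2 * i + 1)) ⊆ bands l a := fun i hi x hx =>
    mem_bands.2 ⟨i, hi, hx.1, hx.2⟩
  have hlt : ∀ i ≤ l, a (2 * i) < a (2 * i + 1) := fun i hi => ha _ (by omega)
  have hmem : ∀ {x : ℝ}, (∃ Q ∈ A, aeval x Q = 0) → x ∈ realRoots A := fun h => h
  refine le_lambdaA_of_forall_le hμ18 hlogμ hpotμ hlam₀.le (fun Q hQ => (hlamQ Q hQ).le)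
    fun x hx hxroot => ?_
  have hx18 : x ∈ Icc (0 : ℝ) 18 := ⟨hx.1.le, hx.2.le⟩
  rcases lt_or_ge x (a 0) with hx0 | hx0
  · refine H.le_of_mem_left (u := 0) (hlt 0 (Nat.zero_le l)) hγ (hband 0 (Nat.zero_le l))
      (hsep 0 (Nat.zero_le l)) (hd 0 (Nat.zero_le _)).1 (hd 0 (Nat.zero_le _)).2 hE
      (fun y hy Q hQ h0 => ?_) (fun y hy hyS => ?_) hfirst ⟨hx.1, hx0⟩ hx18
    · have h1 : y ∈ ({0} : Set ℝ) := hout ▸ ⟨hmem ⟨Q, hQ, h0⟩, Or.inl ⟨hy.1.le, hy.2⟩⟩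
      -- The only root in `[0, a₀)` is 0, which the open interval omits.
      exact hy.1.ne' h1
    · obtain ⟨n, hn, h1, -⟩ := mem_bands.1 hyS
      exact absurd (hy.2.trans_le ((le_of_le_of_forall_lt_succ ha (Nat.zero_le _) (by omega)).trans h1))
        (lt_irrefl _)
  rcases lt_or_ge (a (2 * l + 1)) x with hxl | hxl
  · refine H.le_of_mem_right (v := 18) (hlt l le_rfl) hγ (hband l le_rfl)
      (hsep l le_rfl) (hd _ le_rfl).1 (hd _ le_rfl).2 hE
      (fun y hy Q hQ h0 => ?_) (fun y hy hyS => ?_) hlast ⟨hxl, hx.2⟩ hx18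
    · have h1 : y ∈ ({0} : Set ℝ) := hout ▸ ⟨hmem ⟨Q, hQ, h0⟩, Or.inr hy.1⟩
      have h2 := (hS (hband l le_rfl ⟨(hlt l le_rfl).le, le_rfl⟩)).1
      rw [mem_singleton_iff] at h1
      linarith [hy.1]
    · obtain ⟨n, hn, -, h1⟩ := mem_bands.1 hyS
      have := le_of_le_of_forall_lt_succ ha (show 2 * n + 1 ≤ 2 * l + 1 by omega) le_rfl
      linarith [hy.1]
  rcases exists_gap hx0 l le_rfl hxl with hxS | ⟨i, hi, hxi⟩
  -- On `Σ` the dual equation holds with equality, and the loss `δ λ₀ log 18` is nonnegative.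
  · have h1 := heqn x hxS
    have h2 : 0 ≤ δ * lam₀ * Real.log 18 :=
      mul_nonneg (mul_nonneg hδ.le hlam₀.le) (Real.log_nonneg (by norm_num))
    linarith
  have hri : r i ∈ realRoots A ∩ Ioo (a (2 * i + 1)) (a (2 * (i + 1))) := by
    rw [hgap i hi]
    exact mem_singleton _
  have hgapout : ∀ y ∈ Ioo (a (2 * i + 1)) (a (2 * (i + 1))), y ≠ r i → ∀ Q ∈ A, aeval y Q ≠ 0 := by
    intro y hy hyr Q hQ h0
    have h1 : y ∈ ({r i} : Set ℝ) := hgap i hi ▸ ⟨hmem ⟨Q, hQ, h0⟩, hy⟩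
    exact hyr h1
  have hxr : x ≠ r i := by
    rintro rfl
    obtain ⟨Q, hQ, h0⟩ := hri.1
    exact hxroot Q hQ h0
  -- The root splits the gap: to its left the comparison starts from the right end of the preceding
  -- band, to its right from the left end of the next one.
  rcases lt_or_gt_of_ne hxr with hxr | hxr
  · exact H.le_of_mem_right (hlt i hi.le) hγ (hband i hi.le) (hsep i hi.le) (hd _ (by omega)).1
      (hd _ (by omega)).2 hE (fun y hy => hgapout y ⟨hy.1, hy.2.trans hri.2.2⟩ hy.2.ne)
      (fun y hy => notMem_bands_of_mem_gap ha hi ⟨hy.1, hy.2.trans hri.2.2⟩) (hleft i hi)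
      ⟨hxi.1, hxr⟩ hx18
  · exact H.le_of_mem_left (hlt (i + 1) hi) hγ (hband (i + 1) hi) (hsep (i + 1) hi)
      (hd _ (by omega)).1 (hd _ (by omega)).2 hE
      (fun y hy => hgapout y ⟨hri.2.1.trans hy.1, hy.2⟩ hy.1.ne')
      (fun y hy => notMem_bands_of_mem_gap ha hi ⟨hri.2.1.trans hy.1, hy.2⟩) (hright i hi)
      ⟨hxr, hxi.2⟩ hx18
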